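/- **Setting.** Let $\Lambda=\{0,\dots,L-1\}^D$ with periodic distance $d(\mathbf r,\mathbf r')=\sum_i\min(|r_i-r_i'|,L-|r_i-r_i'|)$, let $c_{\mathbf r}$ be fermionic annihilation operators on the sites, and let $\gamma^1_{\mathbf r}=c^\dagger_{\mathbf r}+c_{\mathbf r}$, $\gamma^2_{\mathbf r}=i(c^\dagger_{\mathbf r}-c_{\mathbf r})$ be the Majorana operators. For a state $\rho$ put $\Gamma^{\alpha,\beta}_{\mathbf r,\mathbf r'}(\rho)=\frac i2\mathrm{tr}([\gamma^\alpha_{\mathbf r},\gamma^\beta_{\mathbf r'}]\rho)$. A *local encoding* with constant $\varphi_0$ represents each bilinear $\gamma^\alpha_{\mathbf r}\gamma^\beta_{\mathbf r'}$ on $n$ qubits by a Pauli string $P^{\alpha,\beta}_{\mathbf r,\mathbf r'}$ (with a phase, antisymmetric in the two Majoranas) of weight at most $\varphi_0+d(\mathbf r,\mathbf r')$. It comes with a partial isometry $V$ from Fock space to the qubits, whose range is the code space, such that $P^{\alpha,\beta}_{\mathbf r,\mathbf r'}V=V\gamma^\alpha_{\mathbf r}\gamma^\beta_{\mathbf r'}$.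 Encoded states are $V\rho V^\dagger$ with $V^\dagger V\rho=\rho$. Quadratic operators are encoded by replacing each bilinear by its Pauli string. A *layer* is a product of gates $e^{-iH}$ with pairwise disjoint supports, where $H=i\sum h^{\alpha,\beta}_{\mathbf r,\mathbf r'}\gamma^\alpha_{\mathbf r}\gamma^\beta_{\mathbf r'}$, $h$ is real antisymmetric, and each support is a set of sites of diameter at most $\ell$. The gates act on the qubits through the encoded $H$. The noiseless evolution applies $d$ layers to the encoded initial state. The noisy evolution in addition applies, after each layer, the channel $T_p^{\otimes n}$ with $$T_p(\rho)=\left(1-\tfrac34p\right)\rho+\tfrac34p(\alpha_xX\rho X+\alpha_yY\rho Y+\alpha_zZ\rho Z),\qquad \alpha_x,\alpha_y,\alpha_z\ge0,\ \alpha_x+\alpha_y+\alpha_z=1,\ 0\le p\le\tfrac23 .$$ The observable is $O=i\sum O^{\alpha,\beta}_{\mathbf r,\mathbf r'}\gamma^\alpha_{\mathbf r}\gamma^\beta_{\mathbf r'}$, whose coefficient matrix $\widetilde O$ is real and antisymmetric with trace norm $\|\widetilde O\|_1\le1$. Let $\mathrm{Error}=|\langle O\rangle_{\rm noiseless}-\langle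 O\rangle_{\rm noisy}|$ be the difference of its (encoded) expectation values after the two evolutions. **Proposition.** Let $\mu>D$ and suppose that the initial state $\rho_0$ satisfies $|\Gamma^{\alpha,\beta}_{\mathbf r,\mathbf r'}(\rho_0)|\le K/d(\mathbf r,\mathbf r')^\mu$ for all $\mathbf r\ne\mathbf r'$ and all $\alpha,\beta$. Put $$f(p)=\begin{cases}p^{\mu-D}& D<\mu<D+1,\\ p\log(1/p)&\mu=D+1,\\ p&\mu>D+1.\end{cases}$$ Then there is a constant $C>0$, depending only on $D,\mu,K,\varphi_0,\ell$, such that $$\mathrm{Error}\le C\,f(p)\,d^{D+2}$$ for all $L$, $n$, local encodings, initial states, circuits, observables, noise parameters $\alpha_x,\alpha_y,\alpha_z$, depths $d$ and $0\le p\le 2/3$ as above. Moreover $\lim_{p\to0}f(p)=0$, and for circuits of bounded depth the task is stable: for each $d_0$ there is a function $g$, continuous on $[0,2/3]$ with $\lim_{p\to0}g(p)=0$, such that $\mathrm{Error}\le g(p)$ for all systems of any size with $d\le d_0$ and all $0\le p\le2/3$. -/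

import Mathlib

open scoped Matrix Topology ComplexOrder

namespace FermionNoise

noncomputable section

/-! ### Lattice and fermions -/

/-- Sites of the `D`-dimensional lattice `{0, …, L-1}^D`. -/
abbrev Site (D L : ℕ) : Type := Fin D → Fin L

/-- Majorana labels `(r, α)`: a site `r` and `α ∈ {1, 2}` (coded as `0, 1`). -/
abbrev Mode (D L : ℕ) : Type := Site D L × Fin 2

/-- Periodic lattice distance `∑ i, min (|r i - r' i|) (L - |r i - r' i|)`. -/
def siteDist {D L : ℕ} (r r' : Site D L) : ℕ :=
  ∑ i, min (((r i : ℕ) : ℤ) - ((r' i : ℕ) : ℤ)).natAbs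
    (L - (((r i : ℕ) : ℤ) - ((r' i : ℕ) : ℤ)).natAbs)

/-- Operators on the fermionic Fock space; the occupation basis is indexed by the set of
occupied sites. -/
abbrev FockOp (D L : ℕ) : Type := Matrix (Finset (Site D L)) (Finset (Site D L)) ℂ

open scoped Classical in
/-- The annihilation operator `c_r`.  The sign counts the occupied sites that precede `r` in the
lexicographic order of the sites. -/
def annihilation {D L : ℕ} (r : Site D L) : FockOp D L := fun m n =>
  if r ∈ n ∧ m = n.erase r then (-1) ^ (n.filter fun s => toLex s < toLex r).card else 0

/-- The Majorana operators `γ¹ = c† + c` and `γ² = i (c† - c)`. -/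
def majorana {D L : ℕ} (a : Mode D L) : FockOp D L :=
  if a.2 = 0 then (annihilation a.1)ᴴ + annihilation a.1
  else Complex.I • ((annihilation a.1)ᴴ - annihilation a.1)

/-- The correlation matrix `Γ_{a,b}(ρ) = (i/2) tr ([γ_a, γ_b] ρ)`. -/
def correlation {D L : ℕ} (ρ : FockOp D L) (a b : Mode D L) : ℂ :=
  Complex.I / 2 * ((majorana a * majorana b - majorana b * majorana a) * ρ).trace

/-! ### Qubits and Pauli noise -/

/-- Operators on `n` qubits, in the computational basis. -/
abbrev QubitOp (n : ℕ) : Type := Matrix (Fin n → Fin 2) (Fin n → Fin 2) ℂ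

/-- The tensor product `A 0 ⊗ ⋯ ⊗ A (n-1)` of single-qubit operators. -/
def tensorOp {n : ℕ} (A : Fin n → Matrix (Fin 2) (Fin 2) ℂ) : QubitOp n :=
  fun x y => ∏ q, A q (x q) (y q)

/-- The single-qubit Pauli matrices `1, X, Y, Z`. -/
def pauli : Fin 4 → Matrix (Fin 2) (Fin 2) ℂ :=
  ![1, !![0, 1; 1, 0], !![0, -Complex.I; Complex.I, 0], !![1, 0; 0, -1]]

/-- The `n`-qubit Pauli string with the letters `s`. -/
def pauliString {n : ℕ} (s : Fin n → Fin 4) : QubitOp n := tensorOp fun q => pauli (s q)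

/-- The weight of a Pauli string: the number of qubits on which it is not the identity. -/
def pauliWeight {n : ℕ} (s : Fin n → Fin 4) : ℕ := (Finset.univ.filter fun q => s q ≠ 0).card

/-- The probabilities of `1, X, Y, Z` in the single-qubit Pauli channel of rate `p` with
relative strengths `α = (α_x, α_y, α_z)`. -/
def noiseProb (α : Fin 3 → ℝ) (p : ℝ) : Fin 4 → ℝ :=
  ![1 - 3 / 4 * p, 3 / 4 * p * α 0, 3 / 4 * p * α 1, 3 / 4 * p * α 2]

/-- The single-qubit Pauli channel
`T_p ρ = (1 - 3p/4) ρ + (3p/4) (α_x XρX + α_y YρY + α_z ZρZ)`. -/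
def singleQubitNoise (α : Fin 3 → ℝ) (p : ℝ) (ρ : Matrix (Fin 2) (Fin 2) ℂ) :
    Matrix (Fin 2) (Fin 2) ℂ :=
  ∑ j, (noiseProb α p j : ℂ) • (pauli j * ρ * pauli j)

/-- The channel `N_p = T_p ⊗ ⋯ ⊗ T_p` on `n` qubits, with the tensor product multiplied out:
independent Pauli errors on all qubits. -/
def pauliNoise {n : ℕ} (α : Fin 3 → ℝ) (p : ℝ) (ρ : QubitOp n) : QubitOp n :=
  ∑ s : Fin n → Fin 4,
    ((∏ q, noiseProb α p (s q) : ℝ) : ℂ) • (pauliString s * ρ * pauliString s)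

theorem tensorOp_mul {n : ℕ} (A B : Fin n → Matrix (Fin 2) (Fin 2) ℂ) :
    tensorOp A * tensorOp B = tensorOp fun q => A q * B q := by
  ext x y
  simp only [Matrix.mul_apply, tensorOp, Finset.prod_univ_sum, Fintype.piFinset_univ,
    Finset.prod_mul_distrib]

/-- `pauliNoise` is the tensor power of `singleQubitNoise`. -/
theorem pauliNoise_tensorOp {n : ℕ} (α : Fin 3 → ℝ) (p : ℝ)
    (A : Fin n → Matrix (Fin 2) (Fin 2) ℂ) :
    pauliNoise α p (tensorOp A) = tensorOp fun q => singleQubitNoise α p (A q) := by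
  ext x y
  simp only [pauliNoise, pauliString, tensorOp_mul, Matrix.sum_apply, Matrix.smul_apply,
    smul_eq_mul, singleQubitNoise]
  simp only [tensorOp, Matrix.sum_apply, Matrix.smul_apply, smul_eq_mul, Finset.prod_univ_sum,
    Fintype.piFinset_univ, Finset.prod_mul_distrib, Complex.ofReal_prod]

/-! ### Local fermion-to-qubit encodings -/

/-- A fermion-to-qubit encoding into `n` qubits that maps every Majorana bilinear `γ_a γ_b` to a
Pauli string (up to a phase) of weight at most `φ₀ + d(r, r')`.

`code` maps fermionic states into the qubit code space and intertwines each bilinear with the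
Pauli string that represents it.  It is an isometry on a subspace of Fock space, because some
encodings carry only a sector of fixed fermion parity; the code space may be a proper subspace
of the qubit space, as for stabilizer encodings, where the algebraic relations between bilinears
hold for their Pauli strings only on the code space. -/
structure LocalEncoding (D L n φ₀ : ℕ) where
  phase : Mode D L → Mode D L → ℂ
  string : Mode D L → Mode D L → (Fin n → Fin 4)
  code : Matrix (Fin n → Fin 2) (Finset (Site D L)) ℂ
  norm_phase : ∀ a b, ‖phase a b‖ = 1
  phase_swap : ∀ a b, a ≠ b → phase b a = -phase a b
  string_swap : ∀ a b, string b a = string a b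
  weight_le : ∀ a b, pauliWeight (string a b) ≤ φ₀ + siteDist a.1 b.1
  code_isometry : code * codeᴴ * code = code
  intertwines : ∀ a b,
    (phase a b • pauliString (string a b)) * code = code * (majorana a * majorana b)

/-- The qubit operator that represents the Majorana bilinear `γ_a γ_b`. -/
def LocalEncoding.bilinear {D L n φ₀ : ℕ} (E : LocalEncoding D L n φ₀) (a b : Mode D L) :
    QubitOp n :=
  E.phase a b • pauliString (E.string a b)

/-- The qubit operator that represents `i ∑ A_{a,b} γ_a γ_b`. -/
def LocalEncoding.quadratic {D L n φ₀ : ℕ} (E : LocalEncoding D L n φ₀)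
    (A : Matrix (Mode D L) (Mode D L) ℝ) : QubitOp n :=
  Complex.I • ∑ a, ∑ b, (A a b : ℂ) • E.bilinear a b

/-! ### Gaussian circuits -/

/-- A fermionic Gaussian gate `exp (-i H)`, `H = i ∑ h_{a,b} γ_a γ_b`, with `h` real
antisymmetric and supported on a set of sites of diameter at most `ℓ`. -/
structure GaussianGate (D L ℓ : ℕ) where
  support : Finset (Site D L)
  diam_le : ∀ r ∈ support, ∀ r' ∈ support, siteDist r r' ≤ ℓ
  h : Matrix (Mode D L) (Mode D L) ℝ
  antisymm : hᵀ = -h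
  local_h : ∀ a b, h a b ≠ 0 → a.1 ∈ support ∧ b.1 ∈ support

/-- A layer of geometrically local Gaussian gates that act on pairwise disjoint sets of sites. -/
structure GaussianLayer (D L ℓ : ℕ) where
  gates : List (GaussianGate D L ℓ)
  disjoint : gates.Pairwise fun g g' => Disjoint g.support g'.support

/-- The encoded gate: the unitary `exp (-i H)` on the qubits, each bilinear in `H` being replaced
by its Pauli string. -/
def GaussianGate.unitary {D L ℓ n φ₀ : ℕ} (g : GaussianGate D L ℓ)
    (E : LocalEncoding D L n φ₀) : QubitOp n :=
  NormedSpace.exp ((-Complex.I) • E.quadratic g.h)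

/-- The unitary of a layer, the product of the unitaries of its gates. -/
def GaussianLayer.unitary {D L ℓ n φ₀ : ℕ} (l : GaussianLayer D L ℓ)
    (E : LocalEncoding D L n φ₀) : QubitOp n :=
  (l.gates.map fun g => g.unitary E).prod

/-- The noiseless evolution; the head of the list is the first layer. -/
def idealEvolution {D L ℓ n φ₀ : ℕ} (E : LocalEncoding D L n φ₀)
    (circuit : List (GaussianLayer D L ℓ)) (ρ : QubitOp n) : QubitOp n :=
  circuit.foldl (fun σ l => l.unitary E * σ * (l.unitary E)ᴴ) ρ

/-- The noisy evolution: each layer of unitaries is followed by `N_p` on all qubits. -/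
def noisyEvolution {D L ℓ n φ₀ : ℕ} (E : LocalEncoding D L n φ₀) (α : Fin 3 → ℝ) (p : ℝ)
    (circuit : List (GaussianLayer D L ℓ)) (ρ : QubitOp n) : QubitOp n :=
  circuit.foldl (fun σ l => pauliNoise α p (l.unitary E * σ * (l.unitary E)ᴴ)) ρ

/-! ### The task -/

/-- The trace norm (Schatten 1-norm): the sum of the singular values. -/
def traceNorm {ι : Type*} [Fintype ι] [DecidableEq ι] (A : Matrix ι ι ℝ) : ℝ :=
  ∑ i, √((Matrix.isHermitian_conjTranspose_mul_self A).eigenvalues i)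

/-- The task of measuring a normalized quadratic observable `O = i ∑ O_{a,b} γ_a γ_b` after a
Gaussian circuit, in a `D`-dimensional lattice, through a local encoding, with Pauli noise, and
with an initial state whose correlation matrix is bounded by `K / d(r, r')^μ`. -/
structure SimulationTask (D φ₀ ℓ : ℕ) (K μ : ℝ) where
  /-- linear size of the lattice -/
  L : ℕ
  /-- number of qubits -/
  n : ℕ
  encoding : LocalEncoding D L n φ₀
  /-- the initial fermionic state -/
  ρ₀ : FockOp D L
  ρ₀_posSemidef : ρ₀.PosSemidef
  ρ₀_trace : ρ₀.trace = 1
  /-- the initial state lies in the sector that the encoding carries -/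
  ρ₀_encoded : encoding.codeᴴ * encoding.code * ρ₀ = ρ₀
  decay : ∀ a b : Mode D L, a.1 ≠ b.1 →
    ‖correlation ρ₀ a b‖ ≤ K / (siteDist a.1 b.1 : ℝ) ^ μ
  circuit : List (GaussianLayer D L ℓ)
  /-- relative strengths of the errors `X, Y, Z` -/
  α : Fin 3 → ℝ
  α_nonneg : ∀ j, 0 ≤ α j
  α_sum : ∑ j, α j = 1
  /-- coefficients of the observable -/
  O : Matrix (Mode D L) (Mode D L) ℝ
  O_antisymm : Oᵀ = -O
  O_normalized : traceNorm O ≤ 1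

namespace SimulationTask

variable {D φ₀ ℓ : ℕ} {K μ : ℝ} (S : SimulationTask D φ₀ ℓ K μ)

/-- The number of layers. -/
def depth : ℕ := S.circuit.length

/-- The encoded initial state. -/
def qubitState : QubitOp S.n := S.encoding.code * S.ρ₀ * S.encoding.codeᴴ

def noiseless : ℂ :=
  (idealEvolution S.encoding S.circuit S.qubitState * S.encoding.quadratic S.O).trace

def noisy (p : ℝ) : ℂ :=
  (noisyEvolution S.encoding S.α p S.circuit S.qubitState * S.encoding.quadratic S.O).trace

/-- `|⟨O⟩_noiseless - ⟨O⟩_noisy|` at noise rate `p`. -/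
def error (p : ℝ) : ℝ := ‖S.noiseless - S.noisy p‖

end SimulationTask

/-- The rate `f(p)`. -/
def rate (D : ℕ) (μ p : ℝ) : ℝ :=
  if μ < D + 1 then p ^ (μ - D)
  else if μ = D + 1 then p * Real.log (1 / p)
  else p

/-- Stability of a family of tasks against noise: on the range `0 ≤ p ≤ 2/3` of noise rates the
errors of all its members are bounded by one continuous function of `p` that tends to `0` as
`p → 0`. -/
def Stable {ι : Type*} (error : ι → ℝ → ℝ) : Prop :=
  ∃ g : ℝ → ℝ, ContinuousOn g (Set.Icc 0 (2 / 3)) ∧ Filter.Tendsto g (𝓝[>] 0) (𝓝 0) ∧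
    ∀ i, ∀ p ∈ Set.Icc (0 : ℝ) (2 / 3), error i p ≤ g p

end

end FermionNoise

/-!
The noise is a mixture of Pauli errors, so the noisy evolution is an average over *trajectories*, in
which a definite Pauli string occurs after each layer. Every encoded bilinear is itself a Pauli
string, hence commutes or anticommutes with the accumulated error. Moving the error to the left
past a gate therefore flips the signs of some couplings in its generator and leaves a quadratic
operator (`FermionNoise.Twists.quadratic_mul`). The relations between encoded bilinears hold only
on the code space, but they are never used elsewhere: the intertwining relation of the code map
passes to the exponentials of the quadratic operators, so each trajectory is a Gaussian evolution
on Fock space, with flipped signs in the gates and in the observable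
(`FermionNoise.Twists.trace_noisyEvolution`).

A Gaussian layer acts on the covariance matrix `Γ` by conjugation with the orthogonal matrix
`exp (4 h)`, which has range at most `ℓ`, also after sign flips. The expectation value of the
observable is the pairing of its coefficient matrix with the covariance matrix, which the duality of
trace norm and operator norm bounds (`FermionNoise.abs_pairing_le`). It remains to estimate in
operator norm the average change of the covariance matrix, which is done entrywise, with Schur's
test. There are two contributions.

* The measured bilinears change sign. A bilinear at distance `r` does so with probability at most of
  order `min 1 (d p (φ₀ + r))`. After `d` layers the correlations are at most `1` at distances up to
  `4 d ℓ` and of order `d ^ D / r ^ μ` beyond (`FermionNoise.abs_mul_mul_transpose_le_corrBound`).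
  The sum over the lattice of `min 1 (p r) / r ^ μ`, evaluated on dyadic shells, is of order
  `rate D μ p` (`FermionNoise.exists_sum_min_div_rpow_le`).
* The couplings of the gates change sign. In the telescoping sum that replaces the noisy layers by
  ideal ones, starting from the last, all layers after the one that is replaced are ideal. They are
  the same orthogonal matrix in all trajectories and do not change the operator norm of the average.
  The rotation of a mode by the replaced layer is affected only if an error has met one of the
  boundedly many bilinears of its gate, with probability of order `d p`, and the correlations have
  row sums of order `d ^ D` (`FermionNoise.GaussianLayer.formBound_average`). The `d` layers
  together contribute an error of order `p d ^ (D + 2)`.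
-/

namespace FermionNoise

/-! ### Geometry of the periodic lattice -/

theorem siteDist_comm {D L : ℕ} (a b : Site D L) : siteDist a b = siteDist b a := by
  unfold siteDist
  refine Finset.sum_congr rfl fun i _ => ?_
  rw [← Int.natAbs_neg, neg_sub]

theorem siteDist_self {D L : ℕ} (a : Site D L) : siteDist a a = 0 := by
  simp [siteDist]

theorem siteDist_triangle {D L : ℕ} (a b c : Site D L) :
    siteDist a c ≤ siteDist a b + siteDist b c := by
  unfold siteDist
  rw [← Finset.sum_add_distrib]
  refine Finset.sum_le_sum fun i _ => ?_
  have ha := (a i).isLt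
  have hb := (b i).isLt
  have hc := (c i).isLt
  omega

/-- A ball of radius `R` has at most `(2 R + 1) ^ D` sites, whatever the size of the torus: each
coordinate takes at most `2 R + 1` values. -/
theorem card_ball_le {D L : ℕ} (a : Site D L) (R : ℕ) :
    (Finset.univ.filter fun b => siteDist a b ≤ R).card ≤ (2 * R + 1) ^ D := by
  classical
  let s : Fin D → Finset (Fin L) := fun i => Finset.univ.filter fun x =>
    min (((a i : ℕ) : ℤ) - ((x : ℕ) : ℤ)).natAbs (L - (((a i : ℕ) : ℤ) - ((x : ℕ) : ℤ)).natAbs) ≤ R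
  have hs : ∀ i, (s i).card ≤ 2 * R + 1 := by
    intro i
    have hcard : (Finset.Icc (-(R : ℤ)) R).card = 2 * R + 1 := by
      rw [Int.card_Icc]; omega
    rw [← hcard]
    -- every coordinate within circular distance `R` of `a i` is `a i + t` modulo `L`, `|t| ≤ R`
    have hmap : (s i).image (fun x : Fin L => ((x : ℕ) : ℤ)) ⊆
        (Finset.Icc (-(R : ℤ)) R).image fun t => (((a i : ℕ) : ℤ) + t) % (L : ℤ) := by
      intro y hy
      obtain ⟨x, hx, rfl⟩ := Finset.mem_image.mp hy
      have hx' := (Finset.mem_filter.mp hx).2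
      have ha := (a i).isLt
      have hxL := x.isLt
      have hmod : ((x : ℕ) : ℤ) % (L : ℤ) = (x : ℕ) := Int.emod_eq_of_lt (by omega) (by omega)
      rw [Finset.mem_image]
      rcases min_le_iff.mp hx' with h | h
      · refine ⟨((x : ℕ) : ℤ) - (a i : ℕ), Finset.mem_Icc.mpr (by omega), ?_⟩
        rw [add_sub_cancel]; exact hmod
      · rcases le_total (a i : ℕ) (x : ℕ) with h' | h'
        · refine ⟨((x : ℕ) : ℤ) - (a i : ℕ) - L, Finset.mem_Icc.mpr (by omega), ?_⟩
          rw [show ((a i : ℕ) : ℤ) + (((x : ℕ) : ℤ) - (a i : ℕ) - L) = (x : ℕ) - (L : ℤ) by ring,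
            Int.sub_emod_right]
          exact hmod
        · refine ⟨((x : ℕ) : ℤ) - (a i : ℕ) + L, Finset.mem_Icc.mpr (by omega), ?_⟩
          rw [show ((a i : ℕ) : ℤ) + (((x : ℕ) : ℤ) - (a i : ℕ) + L) = (x : ℕ) + (L : ℤ) by ring,
            Int.add_emod_right]
          exact hmod
    have hinj : Function.Injective fun x : Fin L => ((x : ℕ) : ℤ) := fun x y h => by
      apply Fin.ext; simpa using h
    rw [← Finset.card_image_of_injective (s i) hinj]
    exact (Finset.card_le_card hmap).trans Finset.card_image_le
  have hsub : (Finset.univ.filter fun b => siteDist a b ≤ R) ⊆ Fintype.piFinset s := by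
    intro b hb
    rw [Fintype.mem_piFinset]
    intro i
    refine Finset.mem_filter.mpr ⟨Finset.mem_univ _, le_trans ?_ (Finset.mem_filter.mp hb).2⟩
    exact Finset.single_le_sum (f := fun i => min (((a i : ℕ) : ℤ) - ((b i : ℕ) : ℤ)).natAbs
      (L - (((a i : ℕ) : ℤ) - ((b i : ℕ) : ℤ)).natAbs)) (fun _ _ => Nat.zero_le _)
      (Finset.mem_univ i)
  refine (Finset.card_le_card hsub).trans ?_
  rw [Fintype.card_piFinset]
  exact (Finset.prod_le_pow_card _ _ _ fun i _ => hs i).trans (by simp)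

/-- Distance between the sites of two modes. -/
def modeDist {D L : ℕ} (a b : Mode D L) : ℕ := siteDist a.1 b.1

theorem modeDist_comm {D L : ℕ} (a b : Mode D L) : modeDist a b = modeDist b a :=
  siteDist_comm _ _

theorem modeDist_self {D L : ℕ} (a : Mode D L) : modeDist a a = 0 := siteDist_self _

theorem modeDist_triangle {D L : ℕ} (a b c : Mode D L) :
    modeDist a c ≤ modeDist a b + modeDist b c := siteDist_triangle _ _ _

theorem card_modeBall_le {D L : ℕ} (a : Mode D L) (R : ℕ) :
    (Finset.univ.filter fun b => modeDist a b ≤ R).card ≤ 2 * (2 * R + 1) ^ D := by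
  have : (Finset.univ.filter fun b : Mode D L => modeDist a b ≤ R) =
      (Finset.univ.filter fun b : Site D L => siteDist a.1 b ≤ R) ×ˢ
        (Finset.univ : Finset (Fin 2)) := by
    ext b
    rw [Finset.mem_product, Finset.mem_filter, Finset.mem_filter]
    exact ⟨fun h => ⟨⟨Finset.mem_univ _, h.2⟩, Finset.mem_univ _⟩,
      fun h => ⟨Finset.mem_univ _, h.1.2⟩⟩
  rw [this, Finset.card_product, Finset.card_univ, Fintype.card_fin, mul_comm]
  exact Nat.mul_le_mul_left _ (card_ball_le _ _)

theorem card_modeBall_le_real {D L : ℕ} (a : Mode D L) (R : ℕ) :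
    ((Finset.univ.filter fun b => modeDist a b ≤ R).card : ℝ) ≤ 2 * (2 * (R : ℝ) + 1) ^ D := by
  exact_mod_cast card_modeBall_le a R

/-! ### Lattice sums and the rate -/

/-- Sums over the lattice are estimated on dyadic shells, so that only the volume of balls enters
and not the size of spheres. -/
theorem sum_dyadic_le {D L : ℕ} (a : Mode D L) (g : ℕ → ℝ) (u : ℕ → ℝ) (hu : ∀ j, 0 ≤ u j)
    (hg : ∀ j r, 2 ^ j ≤ r → r < 2 ^ (j + 1) → g r ≤ u j) :
    ∃ N, ∑ b with 1 ≤ modeDist a b, g (modeDist a b) ≤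
      ∑ j ∈ Finset.range N, 2 * (5 * (2 : ℝ) ^ j) ^ D * u j := by
  classical
  obtain ⟨N, hN⟩ : ∃ N, ∀ b : Mode D L, Nat.log 2 (modeDist a b) < N := by
    refine ⟨(Finset.univ.sup fun b : Mode D L => Nat.log 2 (modeDist a b)) + 1, fun b => ?_⟩
    exact Nat.lt_succ_of_le
      (Finset.le_sup (f := fun b : Mode D L => Nat.log 2 (modeDist a b)) (Finset.mem_univ b))
  refine ⟨N, ?_⟩
  rw [← Finset.sum_fiberwise_of_maps_to (t := Finset.range N)
    (g := fun b => Nat.log 2 (modeDist a b)) (fun b _ => Finset.mem_range.mpr (hN b))]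
  refine Finset.sum_le_sum fun j _ => ?_
  have hpow : ∀ b : Mode D L, 1 ≤ modeDist a b → Nat.log 2 (modeDist a b) = j →
      2 ^ j ≤ modeDist a b ∧ modeDist a b < 2 ^ (j + 1) := fun b hb hj => by
    rw [← hj]
    exact ⟨Nat.pow_log_le_self 2 (by omega), Nat.lt_pow_succ_log_self (by norm_num) _⟩
  have hle : ∀ b ∈ (Finset.univ.filter fun b : Mode D L => 1 ≤ modeDist a b).filter
      (fun b => Nat.log 2 (modeDist a b) = j), g (modeDist a b) ≤ u j := by
    intro b hb
    simp only [Finset.mem_filter, Finset.mem_univ, true_and] at hb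
    exact hg j _ (hpow b hb.1 hb.2).1 (hpow b hb.1 hb.2).2
  refine (Finset.sum_le_card_nsmul _ _ _ hle).trans ?_
  rw [nsmul_eq_mul]
  refine mul_le_mul_of_nonneg_right ?_ (hu j)
  have hsub : (Finset.univ.filter fun b : Mode D L => 1 ≤ modeDist a b).filter
      (fun b => Nat.log 2 (modeDist a b) = j) ⊆
      Finset.univ.filter fun b => modeDist a b ≤ 2 ^ (j + 1) := by
    intro b hb
    simp only [Finset.mem_filter, Finset.mem_univ, true_and] at hb ⊢
    exact (hpow b hb.1 hb.2).2.le
  refine (Nat.cast_le.mpr (Finset.card_le_card hsub)).trans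
    ((card_modeBall_le_real a _).trans ?_)
  have h1 : (1 : ℝ) ≤ 2 ^ j := one_le_pow₀ (by norm_num)
  push_cast
  rw [pow_succ]
  gcongr
  linarith

theorem sum_geometric_le {q : ℝ} (h0 : 0 ≤ q) (h1 : q < 1) (N : ℕ) :
    ∑ j ∈ Finset.range N, q ^ j ≤ (1 - q)⁻¹ := by
  rw [← tsum_geometric_of_lt_one h0 h1]
  exact (summable_geometric_of_lt_one h0 h1).sum_le_tsum _ fun _ _ => pow_nonneg h0 _

theorem rate_eq_of_lt {D : ℕ} {μ : ℝ} (h : μ < D + 1) (p : ℝ) : rate D μ p = p ^ (μ - D) := by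
  simp [rate, h]

theorem rate_eq_of_eq {D : ℕ} {μ : ℝ} (h : μ = D + 1) (p : ℝ) :
    rate D μ p = p * Real.log (1 / p) := by
  simp [rate, h]

theorem rate_eq_of_gt {D : ℕ} {μ : ℝ} (h : (D : ℝ) + 1 < μ) (p : ℝ) : rate D μ p = p := by
  simp [rate, h.not_gt, h.ne']

theorem log_three_halves_mul_le {p : ℝ} (h0 : 0 ≤ p) (h1 : p ≤ 2 / 3) :
    Real.log (3 / 2) * p ≤ p * Real.log (1 / p) := by
  rcases h0.eq_or_lt with rfl | hp
  · simp
  rw [mul_comm]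
  refine mul_le_mul_of_nonneg_left (Real.log_le_log (by norm_num) ?_) h0
  rw [le_div_iff₀ hp]; linarith

/-- The rate is at least of order `p`: the part of the error that is linear in `p` is absorbed. -/
theorem exists_le_mul_rate (D : ℕ) {μ : ℝ} (hμ : (D : ℝ) < μ) :
    ∃ C : ℝ, 0 < C ∧ ∀ p : ℝ, 0 ≤ p → p ≤ 2 / 3 → p ≤ C * rate D μ p := by
  rcases lt_trichotomy μ (D + 1) with h | h | h
  · refine ⟨1, one_pos, fun p h0 h1 => ?_⟩
    rw [rate_eq_of_lt h, one_mul]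
    rcases h0.eq_or_lt with rfl | hp
    · exact Real.rpow_nonneg le_rfl _
    · calc p = p ^ (1 : ℝ) := (Real.rpow_one p).symm
        _ ≤ p ^ (μ - D) :=
          Real.rpow_le_rpow_of_exponent_ge hp (by linarith) (by linarith)
  · have hl : 0 < Real.log (3 / 2) := Real.log_pos (by norm_num)
    refine ⟨(Real.log (3 / 2))⁻¹, inv_pos.mpr hl, fun p h0 h1 => ?_⟩
    rw [rate_eq_of_eq h, ← div_eq_inv_mul, le_div_iff₀ hl, mul_comm]
    exact log_three_halves_mul_le h0 h1
  · exact ⟨1, one_pos, fun p _ _ => by rw [rate_eq_of_gt h, one_mul]⟩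

theorem rate_nonneg (D : ℕ) {μ : ℝ} (hμ : (D : ℝ) < μ) {p : ℝ} (h0 : 0 ≤ p) (h1 : p ≤ 2 / 3) :
    0 ≤ rate D μ p := by
  obtain ⟨C, hC, h⟩ := exists_le_mul_rate D hμ
  exact nonneg_of_mul_nonneg_right (h0.trans (h p h0 h1)) hC

theorem continuous_rate (D : ℕ) {μ : ℝ} (hμ : (D : ℝ) < μ) : Continuous (rate D μ) := by
  rcases lt_trichotomy μ (D + 1) with h | h | h
  · rw [show rate D μ = fun p => p ^ (μ - D) from funext (rate_eq_of_lt h)]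
    exact Real.continuous_rpow_const (by linarith)
  · rw [show rate D μ = fun p => -(p * Real.log p) from funext fun p => by
      rw [rate_eq_of_eq h, one_div, Real.log_inv, mul_neg]]
    exact Real.continuous_mul_log.neg
  · rw [show rate D μ = fun p => p from funext (rate_eq_of_gt h)]
    exact continuous_id

theorem tendsto_rate (D : ℕ) {μ : ℝ} (hμ : (D : ℝ) < μ) :
    Filter.Tendsto (rate D μ) (𝓝[>] 0) (𝓝 0) := by
  have h0 : rate D μ 0 = 0 := by
    rcases lt_trichotomy μ (D + 1) with h | h | h
    · rw [rate_eq_of_lt h, Real.zero_rpow (by linarith)]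
    · rw [rate_eq_of_eq h, zero_mul]
    · rw [rate_eq_of_gt h]
  have := (continuous_rate D hμ).tendsto 0
  rw [h0] at this
  exact this.mono_left nhdsWithin_le_nhds

/-- On the shell of radius `2 ^ j` the volume times the correlations is of order `2 ^ (-j (μ - D))`
and the probability of an error on a string of that length is at most of order `min 1 (p 2 ^ j)`.
The three cases of the rate are those of a sum of these terms dominated by large radii `1 / p`,
spread evenly over the shells up to `1 / p`, and dominated by small radii. -/
theorem exists_sum_geometric_min_le (D : ℕ) {μ : ℝ} (hμ : (D : ℝ) < μ) :
    ∃ C : ℝ, 0 < C ∧ ∀ p : ℝ, 0 ≤ p → p ≤ 2 / 3 → ∀ N : ℕ,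
      ∑ j ∈ Finset.range N, ((2 : ℝ) ^ (-(μ - D))) ^ j * min 1 (p * 2 ^ j) ≤
        C * rate D μ p := by
  set a : ℝ := μ - D with ha
  have ha0 : 0 < a := by linarith
  set x : ℝ := (2 : ℝ) ^ (-a) with hx
  have hx0 : 0 < x := Real.rpow_pos_of_pos two_pos _
  have hx1 : x < 1 := Real.rpow_lt_one_of_one_lt_of_neg (by norm_num) (by linarith)
  have hy : 2 * x = (2 : ℝ) ^ (1 - a) := by
    rw [hx, sub_eq_add_neg, Real.rpow_add two_pos, Real.rpow_one]
  have hterm : ∀ p : ℝ, ∀ j : ℕ, x ^ j * min 1 (p * 2 ^ j) ≤ p * (2 * x) ^ j := fun p j =>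
    calc x ^ j * min 1 (p * 2 ^ j) ≤ x ^ j * (p * 2 ^ j) := by gcongr; exact min_le_right _ _
      _ = p * (2 * x) ^ j := by rw [mul_pow]; ring
  have htail : ∀ p : ℝ, ∀ j : ℕ, x ^ j * min 1 (p * 2 ^ j) ≤ x ^ j := fun p j =>
    mul_le_of_le_one_right (by positivity) (min_le_left _ _)
  have hpow : ∀ j : ℕ, ∀ b : ℝ, ((2 : ℝ) ^ b) ^ j = ((2 : ℝ) ^ j) ^ b := fun j b => by
    rw [← Real.rpow_natCast, ← Real.rpow_mul two_pos.le, mul_comm, Real.rpow_mul two_pos.le,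
      Real.rpow_natCast]
  -- the shells below and above the radius `1 / p`
  have hsplit : ∀ p : ℝ, 0 < p → p ≤ 2 / 3 → ∃ J : ℕ, (2 : ℝ) ^ J ≤ 1 / p ∧ ∀ N : ℕ,
      ∑ j ∈ Finset.range N, x ^ j * min 1 (p * 2 ^ j) ≤
        p * ∑ j ∈ Finset.range (J + 1), (2 * x) ^ j + (1 - x)⁻¹ * p ^ a := by
    intro p hp hp1
    obtain ⟨J, hJ, hJ'⟩ := exists_nat_pow_near (x := 1 / p) (y := (2 : ℝ))
      (by rw [le_div_iff₀ hp]; linarith) (by norm_num)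
    refine ⟨J, hJ, fun N => ?_⟩
    have hnn : ∀ j : ℕ, 0 ≤ x ^ j * min 1 (p * 2 ^ j) := fun j => by positivity
    calc ∑ j ∈ Finset.range N, x ^ j * min 1 (p * 2 ^ j)
        ≤ ∑ j ∈ Finset.range (J + 1 + N), x ^ j * min 1 (p * 2 ^ j) :=
          Finset.sum_le_sum_of_subset_of_nonneg
            (Finset.range_subset_range.mpr (by omega)) fun j _ _ => hnn j
      _ = ∑ j ∈ Finset.range (J + 1), x ^ j * min 1 (p * 2 ^ j) +
          ∑ j ∈ Finset.range N, x ^ (J + 1 + j) * min 1 (p * 2 ^ (J + 1 + j)) :=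
          Finset.sum_range_add _ _ _
      _ ≤ ∑ j ∈ Finset.range (J + 1), p * (2 * x) ^ j +
          ∑ j ∈ Finset.range N, x ^ (J + 1) * x ^ j := by
          refine add_le_add (Finset.sum_le_sum fun j _ => hterm p j)
            (Finset.sum_le_sum fun j _ => ?_)
          rw [← pow_add]
          exact htail p _
      _ ≤ _ := by
          rw [← Finset.mul_sum, ← Finset.mul_sum]
          refine add_le_add le_rfl ?_
          rw [mul_comm (x ^ (J + 1))]
          refine mul_le_mul (sum_geometric_le hx0.le hx1 N) ?_ (by positivity)
            (inv_nonneg.mpr (by linarith))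
          · rw [hx, hpow, Real.rpow_neg (by positivity), ← Real.inv_rpow (by positivity)]
            refine Real.rpow_le_rpow (by positivity) ?_ ha0.le
            rw [inv_le_comm₀ (by positivity) hp, ← one_div]
            exact hJ'.le
  have hzero : ∀ N : ℕ, ∑ j ∈ Finset.range N, x ^ j * min 1 ((0 : ℝ) * 2 ^ j) = 0 := fun N =>
    Finset.sum_eq_zero fun j _ => by simp
  rcases lt_trichotomy μ (D + 1) with h | h | h
  · have hy1 : 1 < 2 * x := by
      rw [hy]; exact Real.one_lt_rpow (by norm_num) (by linarith)
    refine ⟨2 * x / (2 * x - 1) + (1 - x)⁻¹, by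
      have := inv_pos.mpr (sub_pos.mpr hx1)
      have := div_pos (one_pos.trans hy1) (sub_pos.mpr hy1)
      positivity, fun p h0 h1 N => ?_⟩
    rw [rate_eq_of_lt h]
    rcases h0.eq_or_lt with rfl | hp
    · rw [hzero, Real.zero_rpow (by linarith), mul_zero]
    obtain ⟨J, hJ, hsum⟩ := hsplit p hp h1
    refine (hsum N).trans ?_
    rw [add_mul]
    gcongr ?_ + _
    rw [geom_sum_eq hy1.ne']
    have hyJ : (2 * x) ^ J ≤ p ^ (a - 1) := by
      rw [hy, hpow]
      calc ((2 : ℝ) ^ J) ^ (1 - a) ≤ (1 / p) ^ (1 - a) :=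
            Real.rpow_le_rpow (by positivity) hJ (by linarith)
        _ = p ^ (a - 1) := by
            rw [one_div, Real.inv_rpow hp.le, ← Real.rpow_neg hp.le, neg_sub]
    calc p * (((2 * x) ^ (J + 1) - 1) / (2 * x - 1))
        ≤ p * ((2 * x) ^ (J + 1) / (2 * x - 1)) := by
          have := sub_pos.mpr hy1
          gcongr; linarith
      _ = 2 * x / (2 * x - 1) * (p * (2 * x) ^ J) := by rw [pow_succ]; ring
      _ ≤ 2 * x / (2 * x - 1) * (p * p ^ (a - 1)) := by
          have := sub_pos.mpr hy1
          gcongr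
      _ = _ := by
          rw [show p * p ^ (a - 1) = p ^ a by
            rw [Real.rpow_sub_one hp.ne', mul_div_cancel₀ _ hp.ne']]
  · have ha1 : a = 1 := by rw [ha, h]; ring
    have hl : 0 < Real.log (3 / 2) := Real.log_pos (by norm_num)
    have hl2 : 0 < Real.log 2 := Real.log_pos (by norm_num)
    have hx1' := inv_pos.mpr (sub_pos.mpr hx1)
    refine ⟨(Real.log 2)⁻¹ + (1 + (1 - x)⁻¹) / Real.log (3 / 2), by positivity,
      fun p h0 h1 N => ?_⟩
    rw [rate_eq_of_eq h]
    rcases h0.eq_or_lt with rfl | hp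
    · rw [hzero, zero_mul, mul_zero]
    obtain ⟨J, hJ, hsum⟩ := hsplit p hp h1
    refine (hsum N).trans ?_
    rw [hy, ha1, sub_self, Real.rpow_zero, Real.rpow_one]
    simp only [one_pow, Finset.sum_const, Finset.card_range, nsmul_eq_mul, mul_one]
    have hJlog : (J : ℝ) * Real.log 2 ≤ Real.log (1 / p) := by
      rw [← Real.log_pow]; exact Real.log_le_log (by positivity) hJ
    have hJ1 : (J : ℝ) ≤ (Real.log 2)⁻¹ * Real.log (1 / p) := by
      rw [← div_eq_inv_mul, le_div_iff₀ hl2]; exact hJlog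
    have hp2 := log_three_halves_mul_le h0 h1
    have hp3 : p ≤ p * Real.log (1 / p) / Real.log (3 / 2) := by
      rw [le_div_iff₀ hl, mul_comm]; exact hp2
    push_cast
    calc p * ((J : ℝ) + 1) + (1 - x)⁻¹ * p = p * J + (1 + (1 - x)⁻¹) * p := by ring
      _ ≤ p * ((Real.log 2)⁻¹ * Real.log (1 / p)) +
          (1 + (1 - x)⁻¹) * (p * Real.log (1 / p) / Real.log (3 / 2)) := by gcongr
      _ = _ := by ring
  · have hy1 : 2 * x < 1 := by
      rw [hy]; exact Real.rpow_lt_one_of_one_lt_of_neg (by norm_num) (by linarith)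
    refine ⟨(1 - 2 * x)⁻¹, inv_pos.mpr (by linarith), fun p h0 h1 N => ?_⟩
    rw [rate_eq_of_gt h]
    calc ∑ j ∈ Finset.range N, x ^ j * min 1 (p * 2 ^ j)
        ≤ ∑ j ∈ Finset.range N, p * (2 * x) ^ j := Finset.sum_le_sum fun j _ => hterm p j
      _ = p * ∑ j ∈ Finset.range N, (2 * x) ^ j := by rw [Finset.mul_sum]
      _ ≤ p * (1 - 2 * x)⁻¹ := by gcongr; exact sum_geometric_le (by positivity) hy1 N
      _ = _ := mul_comm _ _

/-- Error probability `min 1 (p r)` of a string of length `r`, weighted with correlations that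
decay as `r ^ (-μ)` and summed over the lattice. -/
theorem exists_sum_min_div_rpow_le (D : ℕ) {μ : ℝ} (hμ : (D : ℝ) < μ) :
    ∃ C : ℝ, 0 < C ∧ ∀ p : ℝ, 0 ≤ p → p ≤ 2 / 3 → ∀ (L : ℕ) (a : Mode D L),
      ∑ b with 1 ≤ modeDist a b, min 1 (p * modeDist a b) / (modeDist a b : ℝ) ^ μ ≤
        C * rate D μ p := by
  obtain ⟨C, hC, hsum⟩ := exists_sum_geometric_min_le D hμ
  have hμ0 : 0 < μ := (Nat.cast_nonneg D).trans_lt hμ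
  refine ⟨4 * 5 ^ D * C, by positivity, fun p h0 h1 L a => ?_⟩
  obtain ⟨N, hN⟩ := sum_dyadic_le a (fun r => min 1 (p * r) / (r : ℝ) ^ μ)
    (fun j => 2 * min 1 (p * 2 ^ j) / ((2 : ℝ) ^ j) ^ μ) (fun j => by positivity) (by
      intro j r hr hr'
      have hr1 : (2 : ℝ) ^ j ≤ r := by exact_mod_cast hr
      have hr2 : (r : ℝ) ≤ 2 * 2 ^ j := by
        have : (r : ℝ) ≤ 2 ^ (j + 1) := by exact_mod_cast hr'.le
        rwa [pow_succ, mul_comm] at this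
      gcongr
      rcases le_total 1 (p * 2 ^ j) with h | h
      · rw [min_eq_left h]; linarith [min_le_left 1 (p * (r : ℝ))]
      · rw [min_eq_right h]
        refine (min_le_right _ _).trans ?_
        nlinarith)
  refine hN.trans ?_
  calc ∑ j ∈ Finset.range N, 2 * (5 * (2 : ℝ) ^ j) ^ D *
        (2 * min 1 (p * 2 ^ j) / ((2 : ℝ) ^ j) ^ μ)
      = ∑ j ∈ Finset.range N, 4 * 5 ^ D *
          (((2 : ℝ) ^ (-(μ - D))) ^ j * min 1 (p * 2 ^ j)) := by
        refine Finset.sum_congr rfl fun j _ => ?_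
        have : ((2 : ℝ) ^ (-(μ - D))) ^ j = ((2 : ℝ) ^ j) ^ D / ((2 : ℝ) ^ j) ^ μ := by
          rw [← Real.rpow_natCast, ← Real.rpow_mul two_pos.le, mul_comm,
            Real.rpow_mul two_pos.le, Real.rpow_natCast, neg_sub,
            Real.rpow_sub (by positivity), Real.rpow_natCast]
        rw [this, mul_pow]; ring
    _ = 4 * 5 ^ D * ∑ j ∈ Finset.range N,
          ((2 : ℝ) ^ (-(μ - D))) ^ j * min 1 (p * 2 ^ j) := by rw [Finset.mul_sum]
    _ ≤ 4 * 5 ^ D * (C * rate D μ p) := by gcongr; exact hsum p h0 h1 N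
    _ = _ := by ring

/-- The power law `r ^ (-μ)` is summable over the lattice, uniformly in its size. -/
theorem exists_sum_one_div_rpow_le (D : ℕ) {μ : ℝ} (hμ : (D : ℝ) < μ) :
    ∃ C : ℝ, 0 < C ∧ ∀ (L : ℕ) (a : Mode D L),
      ∑ b with 1 ≤ modeDist a b, 1 / (modeDist a b : ℝ) ^ μ ≤ C := by
  obtain ⟨C, hC, h⟩ := exists_sum_min_div_rpow_le D hμ
  refine ⟨2 * (C * rate D μ (1 / 2)) + 1, ?_, fun L a => ?_⟩
  · have := rate_nonneg D hμ (p := 1 / 2) (by norm_num) (by norm_num)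
    positivity
  refine le_trans ?_ ((mul_le_mul_of_nonneg_left
    (h (1 / 2) (by norm_num) (by norm_num) L a) zero_le_two).trans (by linarith))
  rw [Finset.mul_sum]
  refine Finset.sum_le_sum fun b hb => ?_
  have hb1 : (1 : ℝ) ≤ modeDist a b := by exact_mod_cast (Finset.mem_filter.mp hb).2
  rw [← mul_div_assoc]
  gcongr
  rw [mul_min_of_nonneg _ _ zero_le_two, le_min_iff]
  constructor <;> linarith

/-! ### Exponentials of matrices -/

section Exp

variable {𝕜 m n : Type*} [RCLike 𝕜] [Fintype m] [Fintype n] [DecidableEq m] [DecidableEq n]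

open scoped Matrix.Norms.Operator in
theorem hasSum_matrix_exp (A : Matrix m m 𝕜) :
    HasSum (fun k : ℕ => ((k.factorial : 𝕜)⁻¹) • A ^ k) (NormedSpace.exp A) :=
  NormedSpace.exp_series_hasSum_exp' A

/-- Intertwining relations pass to exponentials, also for rectangular intertwiners. -/
theorem exp_mul_of_intertwine {A : Matrix m m 𝕜} {B : Matrix n n 𝕜} {T : Matrix m n 𝕜}
    (h : A * T = T * B) : NormedSpace.exp A * T = T * NormedSpace.exp B := by
  have hpow : ∀ k : ℕ, A ^ k * T = T * B ^ k := by
    intro k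
    induction k with
    | zero => simp
    | succ k ih => rw [pow_succ, Matrix.mul_assoc, h, ← Matrix.mul_assoc, ih, Matrix.mul_assoc,
        ← pow_succ]
  have h1 : HasSum (fun k : ℕ => ((k.factorial : 𝕜)⁻¹) • (T * B ^ k))
      (NormedSpace.exp A * T) := by
    have := (hasSum_matrix_exp A).map
      (AddMonoidHom.mk' (fun X : Matrix m m 𝕜 => X * T) fun X Y => Matrix.add_mul X Y T)
      (continuous_id.matrix_mul continuous_const)
    simpa [Function.comp_def, hpow] using this
  have h2 : HasSum (fun k : ℕ => ((k.factorial : 𝕜)⁻¹) • (T * B ^ k))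
      (T * NormedSpace.exp B) := by
    have := (hasSum_matrix_exp B).map
      (AddMonoidHom.mk' (fun X : Matrix n n 𝕜 => T * X) fun X Y => Matrix.mul_add T X Y)
      (continuous_const.matrix_mul continuous_id)
    simpa [Function.comp_def] using this
  exact h1.unique h2

theorem hasSum_matrix_exp_apply (A : Matrix m m 𝕜) (i j : m) :
    HasSum (fun k : ℕ => ((k.factorial : 𝕜)⁻¹) * (A ^ k) i j) (NormedSpace.exp A i j) := by
  exact (hasSum_matrix_exp A).map (Matrix.entryAddMonoidHom 𝕜 i j)
    (continuous_id.matrix_elem i j)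

/-- The exponential of a matrix supported on a reflexive and transitive relation is supported on
that relation. -/
theorem exp_apply_eq_zero {r : m → m → Prop} (hrefl : ∀ i, r i i)
    (htrans : ∀ i j k, r i j → r j k → r i k) {A : Matrix m m 𝕜}
    (hA : ∀ i j, ¬ r i j → A i j = 0) {i j : m} (hij : ¬ r i j) : NormedSpace.exp A i j = 0 := by
  have hpow : ∀ k : ℕ, ∀ i j, ¬ r i j → (A ^ k) i j = 0 := by
    intro k
    induction k with
    | zero =>
      intro i j hij
      rw [pow_zero, Matrix.one_apply_ne]
      rintro rfl
      exact hij (hrefl i)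
    | succ k ih =>
      intro i j hij
      rw [pow_succ, Matrix.mul_apply]
      refine Finset.sum_eq_zero fun l _ => ?_
      by_cases hil : r i l
      · rw [hA l j fun h => hij (htrans _ _ _ hil h), mul_zero]
      · rw [ih i l hil, zero_mul]
  refine (hasSum_matrix_exp_apply A i j).unique ?_
  simp only [hpow _ i j hij, mul_zero]
  exact hasSum_zero

/-- A row of the exponential depends only on the block of that row. -/
theorem exp_apply_congr {r : m → m → Prop}
    (hrefl : ∀ i, r i i) (htrans : ∀ i j k, r i j → r j k → r i k) {A B : Matrix m m 𝕜}
    (hA : ∀ i j, ¬ r i j → A i j = 0) {i : m}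
    (hAB : ∀ i' j, r i i' → A i' j = B i' j) (j : m) :
    NormedSpace.exp A i j = NormedSpace.exp B i j := by
  have hpow : ∀ k : ℕ, ∀ j, (A ^ k) i j = (B ^ k) i j ∧ (¬ r i j → (A ^ k) i j = 0) := by
    intro k
    induction k with
    | zero =>
      intro j
      refine ⟨by simp, fun hij => ?_⟩
      rw [pow_zero, Matrix.one_apply_ne]
      rintro rfl
      exact hij (hrefl i)
    | succ k ih =>
      intro j
      rw [pow_succ, pow_succ, Matrix.mul_apply, Matrix.mul_apply]
      refine ⟨Finset.sum_congr rfl fun l _ => ?_, fun hij => Finset.sum_eq_zero fun l _ => ?_⟩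
      · by_cases hil : r i l
        · rw [(ih l).1, hAB l j hil]
        · rw [← (ih l).1, (ih l).2 hil, zero_mul, zero_mul]
      · by_cases hil : r i l
        · rw [hA l j fun h => hij (htrans _ _ _ hil h), mul_zero]
        · rw [(ih l).2 hil, zero_mul]
  have h1 := hasSum_matrix_exp_apply A i j
  simp only [(hpow _ j).1] at h1
  exact h1.unique (hasSum_matrix_exp_apply B i j)

/-- The gates of a layer multiply to the exponential of the sum of their generators: generators on
disjoint supports have product zero, hence commute. -/
theorem list_prod_exp {l : List (Matrix m m 𝕜)}
    (h : l.Pairwise fun A B => A * B = 0 ∧ B * A = 0) :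
    (l.map NormedSpace.exp).prod = NormedSpace.exp l.sum := by
  induction l with
  | nil => simp
  | cons A l ih =>
    rw [List.pairwise_cons] at h
    rw [List.map_cons, List.prod_cons, List.sum_cons, ih h.2]
    refine (Matrix.exp_add_of_commute _ _ ?_).symm
    refine Commute.list_sum_right _ _ fun B hB => ?_
    exact (h.1 B hB).1.trans (h.1 B hB).2.symm

open scoped Kronecker

theorem exp_one_kronecker (H : Matrix m m 𝕜) :
    NormedSpace.exp ((1 : Matrix n n 𝕜) ⊗ₖ H) = (1 : Matrix n n 𝕜) ⊗ₖ NormedSpace.exp H := by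
  have hpow : ∀ k : ℕ, ((1 : Matrix n n 𝕜) ⊗ₖ H) ^ k = (1 : Matrix n n 𝕜) ⊗ₖ (H ^ k) := by
    intro k
    induction k with
    | zero => simp
    | succ k ih => rw [pow_succ, ih, ← Matrix.mul_kronecker_mul, one_mul, pow_succ]
  ext ⟨i, c⟩ ⟨j, b⟩
  have h1 := hasSum_matrix_exp_apply ((1 : Matrix n n 𝕜) ⊗ₖ H) (i, c) (j, b)
  have h2 := (hasSum_matrix_exp_apply H c b).mul_left ((1 : Matrix n n 𝕜) i j)
  refine h1.unique ?_
  simpa only [hpow, Matrix.kroneckerMap_apply, mul_left_comm] using h2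

theorem exp_kronecker_one (X : Matrix n n 𝕜) :
    NormedSpace.exp (X ⊗ₖ (1 : Matrix m m 𝕜)) = NormedSpace.exp X ⊗ₖ (1 : Matrix m m 𝕜) := by
  have hpow : ∀ k : ℕ, (X ⊗ₖ (1 : Matrix m m 𝕜)) ^ k = (X ^ k) ⊗ₖ (1 : Matrix m m 𝕜) := by
    intro k
    induction k with
    | zero => simp
    | succ k ih => rw [pow_succ, ih, ← Matrix.mul_kronecker_mul, one_mul, pow_succ]
  ext ⟨i, c⟩ ⟨j, b⟩
  have h1 := hasSum_matrix_exp_apply (X ⊗ₖ (1 : Matrix m m 𝕜)) (i, c) (j, b)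
  have h2 := (hasSum_matrix_exp_apply X i j).mul_right ((1 : Matrix m m 𝕜) c b)
  refine h1.unique ?_
  simpa only [hpow, Matrix.kroneckerMap_apply, mul_assoc] using h2

end Exp

theorem exp_map_ofReal {m : Type*} [Fintype m] [DecidableEq m] (A : Matrix m m ℝ) :
    NormedSpace.exp (A.map Complex.ofReal) = (NormedSpace.exp A).map Complex.ofReal := by
  ext i j
  have h1 := hasSum_matrix_exp_apply (A.map Complex.ofReal) i j
  have h2 := (hasSum_matrix_exp_apply A i j).mapL Complex.ofRealCLM
  refine h1.unique ?_
  have hk : ∀ k : ℕ, ((k.factorial : ℂ)⁻¹) * ((A.map Complex.ofReal) ^ k) i j =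
      Complex.ofRealCLM (((k.factorial : ℝ)⁻¹) * (A ^ k) i j) := by
    intro k
    have : (A.map Complex.ofReal) ^ k = (A ^ k).map Complex.ofReal :=
      (map_pow Complex.ofRealHom.mapMatrix A k).symm
    rw [this]
    simp
  simp only [hk]
  exact h2

/-- The exponential of a real antisymmetric matrix is orthogonal. -/
theorem exp_mul_transpose_of_antisymm {m : Type*} [Fintype m] [DecidableEq m] {A : Matrix m m ℝ}
    (h : Aᵀ = -A) :
    NormedSpace.exp A * (NormedSpace.exp A)ᵀ = 1 := by
  rw [← Matrix.exp_transpose, h, ← Matrix.exp_add_of_commute _ _ (Commute.refl A).neg_right,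
    add_neg_cancel, NormedSpace.exp_zero]

/-! ### Trace norm and form bounds -/

section FormBound

variable {ι : Type*} [Fintype ι]

/-- The pairing `∑ A_{ij} B_{ij} = tr (Aᵀ B)`. -/
def pairing (A B : Matrix ι ι ℝ) : ℝ := ∑ i, ∑ j, A i j * B i j

/-- `M` has operator norm at most `c`, expressed through its bilinear form. -/
def FormBound (M : Matrix ι ι ℝ) (c : ℝ) : Prop :=
  ∀ x y : ι → ℝ, |x ⬝ᵥ M *ᵥ y| ≤ c * (√(x ⬝ᵥ x) * √(y ⬝ᵥ y))

theorem dotProduct_mulVec_orthogonal [DecidableEq ι] {R : Matrix ι ι ℝ} (hR : R * Rᵀ = 1)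
    (x : ι → ℝ) : (Rᵀ *ᵥ x) ⬝ᵥ (Rᵀ *ᵥ x) = x ⬝ᵥ x := by
  rw [Matrix.dotProduct_mulVec, ← Matrix.mulVec_transpose, Matrix.transpose_transpose,
    Matrix.mulVec_mulVec, hR, Matrix.one_mulVec]

theorem FormBound.conj_orthogonal [DecidableEq ι] {M : Matrix ι ι ℝ} {c : ℝ} (h : FormBound M c)
    {R : Matrix ι ι ℝ} (hR : R * Rᵀ = 1) : FormBound (R * M * Rᵀ) c := by
  intro x y
  have := h (Rᵀ *ᵥ x) (Rᵀ *ᵥ y)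
  rw [dotProduct_mulVec_orthogonal hR, dotProduct_mulVec_orthogonal hR] at this
  rwa [← Matrix.mulVec_mulVec, ← Matrix.mulVec_mulVec, Matrix.dotProduct_mulVec x R,
    ← Matrix.mulVec_transpose]

/-- Schur's test. -/
theorem formBound_of_sum_le {M : Matrix ι ι ℝ} {c : ℝ} (hc : 0 ≤ c)
    (hrow : ∀ i, ∑ j, |M i j| ≤ c) (hcol : ∀ j, ∑ i, |M i j| ≤ c) : FormBound M c := by
  intro x y
  have h1 : |x ⬝ᵥ M *ᵥ y| ≤ ∑ p : ι × ι, (√|M p.1 p.2| * |x p.1|) * (√|M p.1 p.2| * |y p.2|) := by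
    rw [Fintype.sum_prod_type]
    simp only [dotProduct, Matrix.mulVec, Finset.mul_sum]
    refine (Finset.abs_sum_le_sum_abs _ _).trans (Finset.sum_le_sum fun i _ => ?_)
    refine (Finset.abs_sum_le_sum_abs _ _).trans (Finset.sum_le_sum fun j _ => le_of_eq ?_)
    rw [abs_mul, abs_mul]
    calc |x i| * (|M i j| * |y j|) = (√|M i j| * √|M i j|) * |x i| * |y j| := by
          rw [Real.mul_self_sqrt (abs_nonneg _)]; ring
      _ = _ := by ring
  have h2 : ∑ p : ι × ι, (√|M p.1 p.2| * |x p.1|) ^ 2 ≤ c * (x ⬝ᵥ x) := by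
    rw [Fintype.sum_prod_type, dotProduct, Finset.mul_sum]
    refine Finset.sum_le_sum fun i _ => ?_
    simp only [mul_pow, Real.sq_sqrt (abs_nonneg _), sq_abs]
    rw [← Finset.sum_mul, ← sq]
    exact mul_le_mul_of_nonneg_right (hrow i) (sq_nonneg _)
  have h3 : ∑ p : ι × ι, (√|M p.1 p.2| * |y p.2|) ^ 2 ≤ c * (y ⬝ᵥ y) := by
    rw [Fintype.sum_prod_type_right, dotProduct, Finset.mul_sum]
    refine Finset.sum_le_sum fun i _ => ?_
    simp only [mul_pow, Real.sq_sqrt (abs_nonneg _), sq_abs]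
    rw [← Finset.sum_mul, ← sq]
    exact mul_le_mul_of_nonneg_right (hcol i) (sq_nonneg _)
  refine (h1.trans (Real.sum_mul_le_sqrt_mul_sqrt _ _ _)).trans ?_
  calc _ ≤ √(c * (x ⬝ᵥ x)) * √(c * (y ⬝ᵥ y)) :=
        mul_le_mul (Real.sqrt_le_sqrt h2) (Real.sqrt_le_sqrt h3) (Real.sqrt_nonneg _)
          (Real.sqrt_nonneg _)
    _ = c * (√(x ⬝ᵥ x) * √(y ⬝ᵥ y)) := by
        rw [Real.sqrt_mul hc, Real.sqrt_mul hc]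
        linear_combination (√(x ⬝ᵥ x) * √(y ⬝ᵥ y)) * Real.mul_self_sqrt hc

/-- Duality of trace norm and operator norm, by evaluating the trace in an orthonormal
eigenbasis of `Aᵀ A`. -/
theorem abs_pairing_le [DecidableEq ι] (A : Matrix ι ι ℝ) {M : Matrix ι ι ℝ} {c : ℝ}
    (h : FormBound M c) : |pairing A M| ≤ traceNorm A * c := by
  set hA := Matrix.isHermitian_conjTranspose_mul_self A
  let u : ι → ι → ℝ := fun k => hA.eigenvectorBasis k
  set U : Matrix ι ι ℝ := (hA.eigenvectorUnitary : Matrix ι ι ℝ)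
  have hUu : ∀ i k, U i k = u k i := fun i k => rfl
  have hUU : U * Uᵀ = 1 := by
    have := Matrix.mem_unitaryGroup_iff.mp hA.eigenvectorUnitary.2
    exact this
  have hUU' : Uᵀ * U = 1 := mul_eq_one_comm.mp hUU
  have hnorm : ∀ k, u k ⬝ᵥ u k = 1 := fun k => by
    have := congrFun (congrFun hUU' k) k
    rw [Matrix.mul_apply, Matrix.one_apply_eq] at this
    simpa [dotProduct, Matrix.transpose_apply, hUu] using this
  have hAu : ∀ k, (A *ᵥ u k) ⬝ᵥ (A *ᵥ u k) = hA.eigenvalues k := fun k => by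
    rw [Matrix.dotProduct_mulVec, ← Matrix.mulVec_transpose, Matrix.mulVec_mulVec,
      ← Matrix.conjTranspose_eq_transpose_of_trivial A]
    have := hA.mulVec_eigenvectorBasis k
    change (Aᴴ * A) *ᵥ u k = hA.eigenvalues k • u k at this
    rw [this, smul_dotProduct, hnorm, smul_eq_mul, mul_one]
  have htr : pairing A M = ∑ k, (A *ᵥ u k) ⬝ᵥ (M *ᵥ u k) := by
    have h1 : pairing A M = (Aᵀ * M).trace := by
      rw [pairing, Finset.sum_comm]
      simp [Matrix.trace, Matrix.mul_apply]
    have h2 : (Aᵀ * M).trace = ((A * U)ᵀ * (M * U)).trace := by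
      rw [Matrix.trace_mul_comm (A * U)ᵀ, Matrix.transpose_mul, Matrix.mul_assoc M,
        ← Matrix.mul_assoc U, hUU, Matrix.one_mul, Matrix.trace_mul_comm]
    rw [h1, h2]
    simp only [Matrix.trace, Matrix.diag, Matrix.mul_apply, dotProduct, Matrix.mulVec,
      Matrix.transpose_apply, hUu]
  rw [htr, traceNorm, Finset.sum_mul]
  refine (Finset.abs_sum_le_sum_abs _ _).trans (Finset.sum_le_sum fun k _ => ?_)
  have := h (A *ᵥ u k) (u k)
  rw [hAu, hnorm, Real.sqrt_one, mul_one, mul_comm] at this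
  exact this

end FormBound

/-! ### Majorana operators -/

open scoped Classical in
/-- The sign in `annihilation`: parity of the number of occupied sites before `r`. -/
noncomputable def jwSign {D L : ℕ} (r : Site D L) (n : Finset (Site D L)) : ℂ :=
  (-1) ^ (n.filter fun s => toLex s < toLex r).card

theorem jwSign_mul_self {D L : ℕ} (r : Site D L) (n : Finset (Site D L)) :
    jwSign r n * jwSign r n = 1 := by
  rw [jwSign, ← mul_pow]; simp

theorem star_jwSign {D L : ℕ} (r : Site D L) (n : Finset (Site D L)) :
    star (jwSign r n) = jwSign r n := by
  simp [jwSign]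

theorem toLex_lt_irrefl {D L : ℕ} (r : Site D L) : ¬ toLex r < toLex r := lt_irrefl _

theorem toLex_lt_or_gt {D L : ℕ} {r s : Site D L} (h : r ≠ s) :
    (toLex r < toLex s ∧ ¬ toLex s < toLex r) ∨ (toLex s < toLex r ∧ ¬ toLex r < toLex s) := by
  have hne : toLex r ≠ toLex s := fun h' => h (toLex.injective h')
  rcases lt_or_gt_of_ne hne with h | h
  · exact Or.inl ⟨h, h.not_gt⟩
  · exact Or.inr ⟨h, h.not_gt⟩

open scoped Classical in
theorem jwSign_symmDiff {D L : ℕ} (r s : Site D L) (n : Finset (Site D L)) :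
    jwSign r (symmDiff n {s}) = (if toLex s < toLex r then -1 else 1) * jwSign r n := by
  by_cases hsr : toLex s < toLex r
  · rw [if_pos hsr]
    by_cases hs : s ∈ n
    · have h1 : symmDiff n {s} = n.erase s := by
        ext x; by_cases hx : x = s <;> simp [Finset.mem_symmDiff, hx, hs]
      have hmem : s ∈ n.filter fun s => toLex s < toLex r := Finset.mem_filter.mpr ⟨hs, hsr⟩
      have h2 : ((n.filter fun s => toLex s < toLex r).erase s).card + 1 =
          (n.filter fun s => toLex s < toLex r).card := Finset.card_erase_add_one hmem
      rw [jwSign, jwSign, h1, Finset.filter_erase, ← h2, pow_succ]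
      ring
    · have h1 : symmDiff n {s} = insert s n := by
        ext x; by_cases hx : x = s <;> simp [Finset.mem_symmDiff, hx, hs]
      rw [jwSign, jwSign, h1, Finset.filter_insert, if_pos hsr, Finset.card_insert_of_notMem
        (fun h => hs (Finset.mem_filter.mp h).1), pow_succ]
      ring
  · rw [if_neg hsr, one_mul, jwSign, jwSign]
    congr 2
    ext x
    rw [Finset.mem_filter, Finset.mem_filter, Finset.mem_symmDiff, Finset.mem_singleton]
    by_cases hx : x = s
    · subst hx; simp [hsr]
    · simp [hx]

/-- A Majorana operator toggles the occupation of its site; this is the coefficient with which it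
acts on the occupation state `n`. -/
noncomputable def majoranaCoeff {D L : ℕ} (a : Mode D L) (n : Finset (Site D L)) : ℂ :=
  jwSign a.1 n * if a.2 = 0 then 1 else if a.1 ∈ n then -Complex.I else Complex.I

theorem annihilation_apply {D L : ℕ} (r : Site D L) (m n : Finset (Site D L)) :
    annihilation r m n = if m = symmDiff n {r} then if r ∈ n then jwSign r n else 0 else 0 := by
  by_cases hr : r ∈ n
  · have h1 : symmDiff n {r} = n.erase r := by
      ext x; by_cases hx : x = r <;> simp [Finset.mem_symmDiff, hx, hr]
    simp [annihilation, jwSign, hr, h1]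
  · simp [annihilation, hr]

theorem annihilation_conjTranspose_apply {D L : ℕ} (r : Site D L) (m n : Finset (Site D L)) :
    (annihilation r)ᴴ m n = if m = symmDiff n {r} then if r ∈ n then 0 else jwSign r n else 0 := by
  rw [Matrix.conjTranspose_apply, annihilation_apply]
  by_cases h : m = symmDiff n {r}
  · have h' : n = symmDiff m {r} := by rw [h, symmDiff_symmDiff_cancel_right]
    rw [if_pos h', if_pos h]
    have hmem : r ∈ m ↔ r ∉ n := by simp [h, Finset.mem_symmDiff]
    by_cases hr : r ∈ n
    · rw [if_neg (fun h => hmem.mp h hr), if_pos hr, star_zero]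
    · rw [if_pos (hmem.mpr hr), if_neg hr, star_jwSign, h, jwSign_symmDiff,
        if_neg (toLex_lt_irrefl _), one_mul]
  · have h' : n ≠ symmDiff m {r} := by
      rintro rfl; exact h (symmDiff_symmDiff_cancel_right _ _).symm
    rw [if_neg h', if_neg h, star_zero]

theorem majorana_apply {D L : ℕ} (a : Mode D L) (m n : Finset (Site D L)) :
    majorana a m n = if m = symmDiff n {a.1} then majoranaCoeff a n else 0 := by
  by_cases ha : a.2 = 0
  · rw [majorana, if_pos ha, Matrix.add_apply, annihilation_apply,
      annihilation_conjTranspose_apply, majoranaCoeff, if_pos ha]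
    split_ifs <;> simp
  · rw [majorana, if_neg ha, Matrix.smul_apply, Matrix.sub_apply, annihilation_apply,
      annihilation_conjTranspose_apply, majoranaCoeff, if_neg ha]
    split_ifs <;> simp [mul_comm]

theorem majorana_mul_apply {D L : ℕ} (a b : Mode D L) (m n : Finset (Site D L)) :
    (majorana a * majorana b) m n = if m = symmDiff (symmDiff n {b.1}) {a.1} then
      majoranaCoeff a (symmDiff n {b.1}) * majoranaCoeff b n else 0 := by
  rw [Matrix.mul_apply, Finset.sum_eq_single (symmDiff n {b.1})]
  · rw [majorana_apply, majorana_apply, if_pos rfl]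
    split_ifs <;> simp
  · intro k _ hk
    rw [majorana_apply b, if_neg hk, mul_zero]
  · exact fun h => absurd (Finset.mem_univ _) h

theorem majorana_conjTranspose {D L : ℕ} (a : Mode D L) : (majorana a)ᴴ = majorana a := by
  by_cases ha : a.2 = 0
  · simp [majorana, ha, add_comm]
  · simp [majorana, ha, sub_eq_add_neg, add_comm]

theorem majorana_mul_self {D L : ℕ} (a : Mode D L) : majorana a * majorana a = 1 := by
  ext m n
  rw [majorana_mul_apply, symmDiff_symmDiff_cancel_right, Matrix.one_apply]
  refine if_congr Iff.rfl ?_ rfl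
  rw [majoranaCoeff, majoranaCoeff, jwSign_symmDiff, if_neg (toLex_lt_irrefl _), one_mul,
    mul_mul_mul_comm, jwSign_mul_self, one_mul]
  have hmem : a.1 ∈ symmDiff n {a.1} ↔ a.1 ∉ n := by simp [Finset.mem_symmDiff]
  by_cases h0 : a.2 = 0
  · simp [h0]
  · by_cases hr : a.1 ∈ n <;> simp [h0, hmem, hr]

theorem majorana_mul_anticomm {D L : ℕ} {a b : Mode D L} (hab : a ≠ b) :
    majorana a * majorana b = -(majorana b * majorana a) := by
  ext m n
  rw [Matrix.neg_apply, majorana_mul_apply, majorana_mul_apply, symmDiff_right_comm]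
  by_cases hm : m = symmDiff (symmDiff n {a.1}) {b.1}
  · rw [if_pos hm, if_pos hm]
    by_cases h1 : a.1 = b.1
    · have h2 : a.2 ≠ b.2 := fun h => hab (Prod.ext h1 h)
      have hmem : b.1 ∈ symmDiff n {b.1} ↔ b.1 ∉ n := by simp [Finset.mem_symmDiff]
      simp only [majoranaCoeff, h1, jwSign_symmDiff, toLex_lt_irrefl, if_false, one_mul, hmem]
      by_cases ha : a.2 = 0
      · have hb : b.2 ≠ 0 := fun h => h2 (ha.trans h.symm)
        by_cases hr : b.1 ∈ n <;> simp [ha, hb, hr] <;> ring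
      · have hb : b.2 = 0 := by
          have := a.2.isLt; have := b.2.isLt
          apply Fin.ext
          have ha' : (a.2 : ℕ) ≠ 0 := fun h => ha (Fin.ext h)
          have h2' : (a.2 : ℕ) ≠ b.2 := fun h => h2 (Fin.ext h)
          simp only [Fin.val_zero]
          omega
        by_cases hr : b.1 ∈ n <;> simp [ha, hb, hr] <;> ring
    · have hm1 : a.1 ∈ symmDiff n {b.1} ↔ a.1 ∈ n := by simp [Finset.mem_symmDiff, h1]
      have hm2 : b.1 ∈ symmDiff n {a.1} ↔ b.1 ∈ n := by
        simp [Finset.mem_symmDiff, Ne.symm h1]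
      simp only [majoranaCoeff, jwSign_symmDiff, hm1, hm2]
      rcases toLex_lt_or_gt h1 with ⟨h, h'⟩ | ⟨h, h'⟩
      · rw [if_neg h', if_pos h]; ring
      · rw [if_pos h, if_neg h']; ring
  · rw [if_neg hm, if_neg hm, neg_zero]

/-- The Clifford relations. -/
theorem majorana_mul_add_mul {D L : ℕ} (a b : Mode D L) :
    majorana a * majorana b + majorana b * majorana a = if a = b then 2 else 0 := by
  split_ifs with h
  · rw [h, majorana_mul_self]; norm_num
  · rw [majorana_mul_anticomm h, neg_add_cancel]

/-! ### Gaussian unitaries on Fock space -/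

/-- The quadratic operator `∑ A_{a,b} γ_a γ_b` on Fock space. -/
noncomputable def fockQuadratic {D L : ℕ} (A : Matrix (Mode D L) (Mode D L) ℝ) : FockOp D L :=
  ∑ a, ∑ b, (A a b : ℂ) • (majorana a * majorana b)

/-- The linear combination `∑ x_a γ_a`. -/
noncomputable def majoranaVec {D L : ℕ} (x : Mode D L → ℝ) : FockOp D L :=
  ∑ a, (x a : ℂ) • majorana a

theorem fockQuadratic_conjTranspose {D L : ℕ} {A : Matrix (Mode D L) (Mode D L) ℝ}
    (hA : Aᵀ = -A) : (fockQuadratic A)ᴴ = -fockQuadratic A := by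
  have hA' : ∀ a b, A b a = -A a b := fun a b => congrFun (congrFun hA a) b
  simp only [fockQuadratic, Matrix.conjTranspose_sum, Matrix.conjTranspose_smul,
    Matrix.conjTranspose_mul, majorana_conjTranspose, ← Finset.sum_neg_distrib]
  rw [Finset.sum_comm]
  refine Finset.sum_congr rfl fun a _ => Finset.sum_congr rfl fun b _ => ?_
  rw [hA' a b]
  simp

theorem majorana_mul_bilinear {D L : ℕ} (c a b : Mode D L) :
    majorana c * (majorana a * majorana b) = majorana a * majorana b * majorana c +
      ((if c = a then 2 else 0 : ℂ) • majorana b - (if c = b then 2 else 0 : ℂ) • majorana a) := by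
  have h1 : majorana c * majorana a = (if c = a then 2 else 0 : ℂ) • (1 : FockOp D L) -
      majorana a * majorana c := by
    rw [eq_sub_iff_add_eq, majorana_mul_add_mul]
    split_ifs <;> simp [ofNat_smul_eq_nsmul]
  have h2 : majorana c * majorana b = (if c = b then 2 else 0 : ℂ) • (1 : FockOp D L) -
      majorana b * majorana c := by
    rw [eq_sub_iff_add_eq, majorana_mul_add_mul]
    split_ifs <;> simp [ofNat_smul_eq_nsmul]
  rw [← mul_assoc, h1, sub_mul, mul_assoc (majorana a), h2, mul_sub, smul_mul_assoc, one_mul,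
    mul_smul_comm, mul_one, ← mul_assoc]
  abel

theorem majorana_mul_fockQuadratic {D L : ℕ} {A : Matrix (Mode D L) (Mode D L) ℝ}
    (hA : Aᵀ = -A) (c : Mode D L) :
    majorana c * fockQuadratic A =
      fockQuadratic A * majorana c + majoranaVec (((4 : ℝ) • A) c) := by
  have hA' : ∀ a b, A b a = -A a b := fun a b => congrFun (congrFun hA a) b
  have h1 : majorana c * fockQuadratic A = fockQuadratic A * majorana c +
      ((∑ a, ∑ b, (A a b : ℂ) • (if c = a then 2 else 0 : ℂ) • majorana b) -
        ∑ a, ∑ b, (A a b : ℂ) • (if c = b then 2 else 0 : ℂ) • majorana a) := by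
    simp only [fockQuadratic, Finset.mul_sum, Finset.sum_mul, mul_smul_comm, smul_mul_assoc,
      majorana_mul_bilinear, smul_add, smul_sub, Finset.sum_add_distrib, Finset.sum_sub_distrib]
  rw [h1]
  congr 1
  have h2 : ∑ a, ∑ b, (A a b : ℂ) • (if c = a then 2 else 0 : ℂ) • majorana b =
      ∑ b, (A c b : ℂ) • (2 : ℂ) • majorana b := by
    rw [Finset.sum_eq_single c]
    · simp
    · intro a _ ha
      simp [Ne.symm ha]
    · exact fun h => absurd (Finset.mem_univ _) h
  have h3 : ∑ a, ∑ b, (A a b : ℂ) • (if c = b then 2 else 0 : ℂ) • majorana a =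
      -∑ b, (A c b : ℂ) • (2 : ℂ) • majorana b := by
    rw [← Finset.sum_neg_distrib]
    refine Finset.sum_congr rfl fun a _ => ?_
    rw [Finset.sum_eq_single c]
    · simp [hA' c a]
    · intro b _ hb
      simp [Ne.symm hb]
    · exact fun h => absurd (Finset.mem_univ _) h
  rw [h2, h3, sub_neg_eq_add, ← Finset.sum_add_distrib, majoranaVec]
  refine Finset.sum_congr rfl fun b _ => ?_
  rw [smul_smul, ← add_smul]
  congr 1
  simp only [Matrix.smul_apply, smul_eq_mul]
  push_cast
  ring

/-- Conjugation by `W` acts on the Majorana operators as the real matrix `Q`: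
`W† γ_c W = ∑ Q_{c,b} γ_b`. -/
def Rotates {D L : ℕ} (W : FockOp D L) (Q : Matrix (Mode D L) (Mode D L) ℝ) : Prop :=
  ∀ c, majorana c * W = W * majoranaVec (Q c)

theorem majoranaVec_mul_of_rotates {D L : ℕ} {W : FockOp D L}
    {Q : Matrix (Mode D L) (Mode D L) ℝ} (h : Rotates W Q) (x : Mode D L → ℝ) :
    majoranaVec x * W = W * majoranaVec (x ᵥ* Q) := by
  simp only [majoranaVec, Finset.sum_mul, smul_mul_assoc]
  simp only [h _, majoranaVec, Finset.mul_sum, mul_smul_comm, Finset.smul_sum, smul_smul]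
  rw [Finset.sum_comm]
  refine Finset.sum_congr rfl fun b _ => ?_
  rw [← Finset.sum_smul]
  congr 1
  simp [Matrix.vecMul, dotProduct]

theorem rotates_one {D L : ℕ} : Rotates (1 : FockOp D L) 1 := by
  intro c
  rw [mul_one, one_mul, majoranaVec, Finset.sum_eq_single c]
  · simp
  · intro b _ hb
    simp [Matrix.one_apply_ne hb.symm]
  · exact fun h => absurd (Finset.mem_univ _) h

theorem Rotates.mul {D L : ℕ} {W W' : FockOp D L} {Q Q' : Matrix (Mode D L) (Mode D L) ℝ}
    (h : Rotates W Q) (h' : Rotates W' Q') : Rotates (W * W') (Q * Q') := by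
  intro c
  rw [← mul_assoc, h c, mul_assoc, majoranaVec_mul_of_rotates h', mul_assoc]
  rfl

section Kronecker

open scoped Kronecker

variable {m n : Type*} [Fintype m] [Fintype n]

/-- A vector of operators `F` is written as one block column with index `(row, component)`; left
multiplication of all components is a Kronecker product with the identity. -/
theorem kronecker_one_mul_of [DecidableEq m] (Y : Matrix n n ℂ) (F : m → Matrix n n ℂ) :
    (Y ⊗ₖ (1 : Matrix m m ℂ)) * Matrix.of (fun (p : n × m) j => F p.2 p.1 j) =
      Matrix.of fun p j => (Y * F p.2) p.1 j := by
  ext ⟨i, c⟩ j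
  simp only [Matrix.mul_apply, Matrix.of_apply, Fintype.sum_prod_type, Matrix.kroneckerMap_apply]
  refine Finset.sum_congr rfl fun k _ => ?_
  rw [Finset.sum_eq_single c]
  · simp
  · intro b _ hb
    simp [Matrix.one_apply_ne hb.symm]
  · exact fun h => absurd (Finset.mem_univ _) h

theorem one_kronecker_mul_of [DecidableEq n] (M : Matrix m m ℂ) (F : m → Matrix n n ℂ) :
    ((1 : Matrix n n ℂ) ⊗ₖ M) * Matrix.of (fun (p : n × m) j => F p.2 p.1 j) =
      Matrix.of fun p j => (∑ b, M p.2 b • F b) p.1 j := by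
  ext ⟨i, c⟩ j
  simp only [Matrix.mul_apply, Matrix.of_apply, Fintype.sum_prod_type, Matrix.kroneckerMap_apply,
    Matrix.sum_apply, Matrix.smul_apply, smul_eq_mul]
  rw [Finset.sum_eq_single i]
  · simp
  · intro b _ hb
    simp [Matrix.one_apply_ne hb.symm]
  · exact fun h => absurd (Finset.mem_univ _) h

/-- If the commutator of `X` with the vector of operators `F` is multiplication by the matrix `H`,
then conjugation with `exp X` multiplies that vector by `exp H`. -/
theorem mul_exp_of_mul_eq [DecidableEq m] [DecidableEq n] {X : Matrix n n ℂ} {H : Matrix m m ℂ}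
    {F : m → Matrix n n ℂ}
    (h : ∀ c, F c * X = X * F c + ∑ b, H c b • F b) (c : m) :
    F c * NormedSpace.exp X = NormedSpace.exp X * ∑ b, NormedSpace.exp H c b • F b := by
  -- the operators `F` stacked into one column
  set G : Matrix (n × m) n ℂ := Matrix.of fun p j => F p.2 p.1 j with hG
  have hint : (X ⊗ₖ (1 : Matrix m m ℂ) + (1 : Matrix n n ℂ) ⊗ₖ H) * G = G * X := by
    rw [Matrix.add_mul, hG, kronecker_one_mul_of, one_kronecker_mul_of]
    ext p j
    exact (congrFun (congrFun (h p.2) p.1) j).symm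
  have hcomm : Commute (X ⊗ₖ (1 : Matrix m m ℂ)) ((1 : Matrix n n ℂ) ⊗ₖ H) := by
    rw [Commute, SemiconjBy, ← Matrix.mul_kronecker_mul, ← Matrix.mul_kronecker_mul]
    simp
  have hexp := exp_mul_of_intertwine hint
  rw [Matrix.exp_add_of_commute _ _ hcomm, exp_kronecker_one, exp_one_kronecker,
    Matrix.mul_assoc, hG, one_kronecker_mul_of,
    kronecker_one_mul_of _ (fun c => ∑ b, NormedSpace.exp H c b • F b)] at hexp
  ext i j
  exact (congrFun (congrFun hexp (i, c)) j).symm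

end Kronecker

/-- A Gaussian unitary rotates the Majorana operators. The factor `4` arises because
`[γ_c, ∑ A_{a,b} γ_a γ_b] = 2 ∑ (A_{c,b} - A_{b,c}) γ_b` and `A` is antisymmetric. -/
theorem rotates_exp {D L : ℕ} {A : Matrix (Mode D L) (Mode D L) ℝ} (hA : Aᵀ = -A) :
    Rotates (NormedSpace.exp (fockQuadratic A)) (NormedSpace.exp ((4 : ℝ) • A)) := by
  intro c
  have h := mul_exp_of_mul_eq (X := fockQuadratic A) (H := ((4 : ℝ) • A).map Complex.ofReal)
    (F := majorana) (fun c => majorana_mul_fockQuadratic hA c) c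
  rw [exp_map_ofReal] at h
  exact h

theorem exp_mul_conjTranspose_of_antisymm {D L : ℕ} {A : Matrix (Mode D L) (Mode D L) ℝ}
    (hA : Aᵀ = -A) :
    NormedSpace.exp (fockQuadratic A) * (NormedSpace.exp (fockQuadratic A))ᴴ = 1 := by
  rw [← Matrix.exp_conjTranspose, fockQuadratic_conjTranspose hA,
    ← Matrix.exp_add_of_commute _ _ (Commute.refl (fockQuadratic A)).neg_right, add_neg_cancel,
    NormedSpace.exp_zero]

/-! ### Covariance matrices of states -/

/-- The correlation matrix of a state, as a real matrix. -/
noncomputable def covariance {D L : ℕ} (ρ : FockOp D L) : Matrix (Mode D L) (Mode D L) ℝ :=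
  fun a b => (correlation ρ a b).re

theorem correlation_eq_covariance {D L : ℕ} {ρ : FockOp D L} (hρ : ρ.IsHermitian)
    (a b : Mode D L) : correlation ρ a b = (covariance ρ a b : ℂ) := by
  refine (Complex.conj_eq_iff_re.mp ?_).symm
  have h : star ((majorana a * majorana b - majorana b * majorana a) * ρ).trace =
      -((majorana a * majorana b - majorana b * majorana a) * ρ).trace := by
    rw [← Matrix.trace_conjTranspose, Matrix.conjTranspose_mul, Matrix.conjTranspose_sub,
      Matrix.conjTranspose_mul, Matrix.conjTranspose_mul, majorana_conjTranspose,
      majorana_conjTranspose, hρ.eq, Matrix.trace_mul_comm, ← Matrix.trace_neg, ← Matrix.neg_mul,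
      neg_sub]
  rw [correlation, map_mul]
  change _ * star _ = _
  rw [h, map_div₀, Complex.conj_I, Complex.conj_ofNat]
  ring

theorem majoranaVec_conjTranspose {D L : ℕ} (x : Mode D L → ℝ) :
    (majoranaVec x)ᴴ = majoranaVec x := by
  simp [majoranaVec, Matrix.conjTranspose_sum, majorana_conjTranspose]

theorem majoranaVec_mul_majoranaVec {D L : ℕ} (x y : Mode D L → ℝ) :
    majoranaVec x * majoranaVec y =
      ∑ a, ∑ b, ((x a * y b : ℝ) : ℂ) • (majorana a * majorana b) := by
  simp only [majoranaVec, Finset.sum_mul]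
  refine Finset.sum_congr rfl fun a _ => ?_
  simp only [Finset.mul_sum, smul_mul_assoc, mul_smul_comm, smul_smul, Complex.ofReal_mul,
    mul_comm]

theorem majoranaVec_mul_self {D L : ℕ} (x : Mode D L → ℝ) :
    majoranaVec x * majoranaVec x = ((x ⬝ᵥ x : ℝ) : ℂ) • (1 : FockOp D L) := by
  have h2 : majoranaVec x * majoranaVec x + majoranaVec x * majoranaVec x =
      (2 : ℂ) • ((x ⬝ᵥ x : ℝ) : ℂ) • (1 : FockOp D L) := by
    conv_lhs => rw [majoranaVec_mul_majoranaVec]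
    conv_lhs => arg 2; rw [Finset.sum_comm]
    simp only [← Finset.sum_add_distrib]
    have : ∀ a b : Mode D L, ((x a * x b : ℝ) : ℂ) • (majorana a * majorana b) +
        ((x b * x a : ℝ) : ℂ) • (majorana b * majorana a) =
        if a = b then ((x a * x a : ℝ) : ℂ) • (2 : FockOp D L) else 0 := by
      intro a b
      rw [mul_comm (x b), ← smul_add, majorana_mul_add_mul]
      split_ifs with h
      · rw [h]
      · rw [smul_zero]
    simp only [this, Finset.sum_ite_eq, Finset.mem_univ, if_true]
    rw [← Finset.sum_smul, dotProduct, smul_smul, mul_comm, ← smul_smul, Complex.ofReal_sum]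
    congr 1
    simp [ofNat_smul_eq_nsmul]
  rw [← two_smul ℂ] at h2
  exact smul_right_injective _ (two_ne_zero) h2

/-- Cauchy–Schwarz for the inner product `tr (Aᴴ B ρ)` of operators, for a multiple `A` of a
unitary. -/
theorem norm_trace_mul_le {ι : Type*} [Fintype ι] [DecidableEq ι] {ρ A : Matrix ι ι ℂ}
    (hρ : ρ.PosSemidef) (htr : ρ.trace = 1) {c : ℝ} (hA : A * Aᴴ = (c : ℂ) • 1) :
    ‖(A * ρ).trace‖ ≤ √c := by
  obtain ⟨B, rfl⟩ : ∃ B : Matrix ι ι ℂ, ρ = Bᴴ * B := by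
    open scoped MatrixOrder Matrix.Norms.L2Operator in
    exact CStarAlgebra.nonneg_iff_eq_star_mul_self.mp hρ.nonneg
  have hsq : ∀ M : Matrix ι ι ℂ, ((∑ p : ι × ι, ‖M p.1 p.2‖ ^ 2 : ℝ) : ℂ) = (M * Mᴴ).trace := by
    intro M
    rw [Fintype.sum_prod_type]
    simp only [Matrix.trace, Matrix.diag, Matrix.mul_apply, Matrix.conjTranspose_apply]
    push_cast
    refine Finset.sum_congr rfl fun i _ => Finset.sum_congr rfl fun j _ => ?_
    exact (Complex.mul_conj' _).symm
  have hB : ∑ p : ι × ι, ‖B p.1 p.2‖ ^ 2 = 1 := by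
    have := hsq B
    rw [Matrix.trace_mul_comm, htr] at this
    exact_mod_cast this
  have hBA : ∑ p : ι × ι, ‖(B * A) p.1 p.2‖ ^ 2 = c := by
    have := hsq (B * A)
    rw [Matrix.conjTranspose_mul, Matrix.mul_assoc, ← Matrix.mul_assoc A, hA, Matrix.smul_mul,
      Matrix.one_mul, Matrix.mul_smul, Matrix.trace_smul, Matrix.trace_mul_comm, htr] at this
    simp only [smul_eq_mul, mul_one] at this
    exact_mod_cast this
  have h1 : (A * (Bᴴ * B)).trace = ∑ p : ι × ι, (B * A) p.1 p.2 * star (B p.1 p.2) := by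
    rw [← Matrix.mul_assoc, Matrix.trace_mul_comm, ← Matrix.mul_assoc, Fintype.sum_prod_type]
    rfl
  rw [h1]
  refine (norm_sum_le _ _).trans ?_
  simp only [norm_mul, norm_star]
  refine (Real.sum_mul_le_sqrt_mul_sqrt _ _ _).trans ?_
  rw [hBA, hB, Real.sqrt_one, mul_one]

/-- Real combinations of Majorana operators square to scalars by the Clifford relations, so the
expectation value of a product of two is at most the product of the lengths. -/
theorem trace_majoranaVec_le {D L : ℕ} {ρ : FockOp D L} (hρ : ρ.PosSemidef) (htr : ρ.trace = 1)
    (x y : Mode D L → ℝ) :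
    ‖(majoranaVec x * majoranaVec y * ρ).trace‖ ≤ √(x ⬝ᵥ x) * √(y ⬝ᵥ y) := by
  have hx : 0 ≤ x ⬝ᵥ x := Finset.sum_nonneg fun _ _ => mul_self_nonneg _
  rw [← Real.sqrt_mul hx]
  refine norm_trace_mul_le hρ htr ?_
  rw [Matrix.conjTranspose_mul, majoranaVec_conjTranspose, majoranaVec_conjTranspose, mul_assoc,
    ← mul_assoc (majoranaVec y), majoranaVec_mul_self, smul_mul_assoc, one_mul, mul_smul_comm,
    majoranaVec_mul_self, smul_smul, ← Complex.ofReal_mul, mul_comm]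

theorem dotProduct_covariance_mulVec {D L : ℕ} (ρ : FockOp D L) (x y : Mode D L → ℝ) :
    x ⬝ᵥ covariance ρ *ᵥ y = (Complex.I / 2 *
      ((majoranaVec x * majoranaVec y * ρ).trace -
        (majoranaVec y * majoranaVec x * ρ).trace)).re := by
  have h : Complex.I / 2 * ((majoranaVec x * majoranaVec y * ρ).trace -
      (majoranaVec y * majoranaVec x * ρ).trace) =
      ∑ a, ∑ b, ((x a * y b : ℝ) : ℂ) * correlation ρ a b := by
    rw [majoranaVec_mul_majoranaVec, majoranaVec_mul_majoranaVec y, Finset.sum_comm (γ := Mode D L)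
      (f := fun a b => ((y a * x b : ℝ) : ℂ) • (majorana a * majorana b))]
    simp only [Finset.sum_mul, Matrix.trace_sum, ← Finset.sum_sub_distrib, Finset.mul_sum,
      smul_mul_assoc, Matrix.trace_smul, smul_eq_mul, correlation, sub_mul, Matrix.trace_sub]
    refine Finset.sum_congr rfl fun a _ => Finset.sum_congr rfl fun b _ => ?_
    push_cast
    ring
  rw [h]
  simp only [dotProduct, Matrix.mulVec, Finset.mul_sum, Complex.re_sum, Complex.re_ofReal_mul,
    covariance]
  refine Finset.sum_congr rfl fun a _ => Finset.sum_congr rfl fun b _ => ?_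
  ring

/-- The covariance matrix of a state is a contraction. -/
theorem formBound_covariance {D L : ℕ} {ρ : FockOp D L} (hρ : ρ.PosSemidef)
    (htr : ρ.trace = 1) : FormBound (covariance ρ) 1 := by
  intro x y
  rw [dotProduct_covariance_mulVec, one_mul]
  refine (Complex.abs_re_le_norm _).trans ?_
  rw [norm_mul, norm_div, Complex.norm_I, Complex.norm_two]
  have h1 := trace_majoranaVec_le hρ htr x y
  have h2 := trace_majoranaVec_le hρ htr y x
  have h3 := norm_sub_le (majoranaVec x * majoranaVec y * ρ).trace
    (majoranaVec y * majoranaVec x * ρ).trace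
  rw [mul_comm (√(y ⬝ᵥ y))] at h2
  linarith

/-- A unitary that rotates the Majorana operators conjugates the covariance matrix. -/
theorem covariance_conj {D L : ℕ} (ρ : FockOp D L) {W : FockOp D L}
    {Q : Matrix (Mode D L) (Mode D L) ℝ} (hW : Wᴴ * W = 1) (h : Rotates W Q) :
    covariance (W * ρ * Wᴴ) = Q * covariance ρ * Qᵀ := by
  ext a b
  have hentry : (Q * covariance ρ * Qᵀ) a b = Q a ⬝ᵥ covariance ρ *ᵥ Q b := by
    rw [Matrix.dotProduct_mulVec]
    rfl
  have htr : ∀ a b, (majorana a * majorana b * (W * ρ * Wᴴ)).trace =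
      (majoranaVec (Q a) * majoranaVec (Q b) * ρ).trace := by
    intro a b
    have h1 : majorana a * majorana b * W = W * (majoranaVec (Q a) * majoranaVec (Q b)) := by
      rw [mul_assoc, h b, ← mul_assoc, h a, mul_assoc]
    rw [← mul_assoc, ← mul_assoc, h1, Matrix.trace_mul_comm, ← mul_assoc, ← mul_assoc, hW,
      one_mul]
  rw [hentry, dotProduct_covariance_mulVec, covariance, correlation, Matrix.sub_mul,
    Matrix.trace_sub, htr, htr]

/-- The expectation value of the observable `i ∑ A_{a,b} γ_a γ_b`. -/
theorem trace_mul_fockQuadratic {D L : ℕ} {ρ : FockOp D L} (hρ : ρ.IsHermitian)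
    {A : Matrix (Mode D L) (Mode D L) ℝ} (hA : Aᵀ = -A) :
    (ρ * (Complex.I • fockQuadratic A)).trace = (pairing A (covariance ρ) : ℂ) := by
  have hA' : ∀ a b, A b a = -A a b := fun a b => congrFun (congrFun hA a) b
  set t : Mode D L → Mode D L → ℂ := fun a b => (majorana a * majorana b * ρ).trace
  have h1 : (ρ * (Complex.I • fockQuadratic A)).trace =
      Complex.I * ∑ a, ∑ b, (A a b : ℂ) * t a b := by
    rw [Matrix.trace_mul_comm, fockQuadratic, smul_mul_assoc, Matrix.trace_smul, smul_eq_mul]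
    simp only [Finset.sum_mul, Matrix.trace_sum, smul_mul_assoc, Matrix.trace_smul, smul_eq_mul, t]
  have h2 : (pairing A (covariance ρ) : ℂ) =
      Complex.I / 2 * (∑ a, ∑ b, (A a b : ℂ) * t a b - ∑ a, ∑ b, (A a b : ℂ) * t b a) := by
    rw [pairing]
    push_cast
    simp only [← correlation_eq_covariance hρ, correlation, sub_mul, Matrix.trace_sub,
      ← Finset.sum_sub_distrib, Finset.mul_sum, t]
    refine Finset.sum_congr rfl fun a _ => Finset.sum_congr rfl fun b _ => ?_
    ring
  have h3 : ∑ a, ∑ b, (A a b : ℂ) * t b a = -∑ a, ∑ b, (A a b : ℂ) * t a b := by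
    rw [Finset.sum_comm, ← Finset.sum_neg_distrib]
    refine Finset.sum_congr rfl fun a _ => ?_
    rw [← Finset.sum_neg_distrib]
    refine Finset.sum_congr rfl fun b _ => ?_
    rw [hA' a b]
    push_cast
    ring
  rw [h1, h2, h3]
  ring

/-! ### Pauli strings and error probabilities -/

/-- Commutation sign of two Pauli letters. -/
noncomputable def letterSign (i j : Fin 4) : ℝ := if i = 0 ∨ j = 0 ∨ i = j then 1 else -1

theorem pauli_mul_comm (i j : Fin 4) :
    pauli i * pauli j = (letterSign i j : ℂ) • (pauli j * pauli i) := by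
  fin_cases i <;> fin_cases j <;> ext a b <;> fin_cases a <;> fin_cases b <;>
    simp [pauli, letterSign, Matrix.mul_apply]

theorem pauli_mul_self (i : Fin 4) : pauli i * pauli i = 1 := by
  fin_cases i <;> ext a b <;> fin_cases a <;> fin_cases b <;>
    simp [pauli, Matrix.mul_apply]

theorem pauli_conjTranspose (i : Fin 4) : (pauli i)ᴴ = pauli i := by
  fin_cases i <;> ext a b <;> fin_cases a <;> fin_cases b <;>
    simp [pauli, Matrix.conjTranspose_apply]

/-- Commutation sign of two Pauli strings. -/
noncomputable def pauliSign {n : ℕ} (s t : Fin n → Fin 4) : ℝ := ∏ q, letterSign (s q) (t q)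

theorem tensorOp_smul {n : ℕ} (c : Fin n → ℂ) (A : Fin n → Matrix (Fin 2) (Fin 2) ℂ) :
    tensorOp (fun q => c q • A q) = (∏ q, c q) • tensorOp A := by
  ext x y
  simp [tensorOp, Finset.prod_mul_distrib]

theorem tensorOp_one {n : ℕ} : tensorOp (fun _ : Fin n => 1) = 1 := by
  ext x y
  by_cases h : x = y
  · subst h
    rw [Matrix.one_apply_eq]
    exact Finset.prod_eq_one fun q _ => Matrix.one_apply_eq _
  · obtain ⟨q, hq⟩ := Function.ne_iff.mp h
    rw [Matrix.one_apply_ne h]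
    exact Finset.prod_eq_zero (Finset.mem_univ q) (Matrix.one_apply_ne hq)

theorem pauliString_mul_comm {n : ℕ} (s t : Fin n → Fin 4) :
    pauliString s * pauliString t = (pauliSign s t : ℂ) • (pauliString t * pauliString s) := by
  simp only [pauliString, tensorOp_mul]
  rw [pauliSign, Complex.ofReal_prod, ← tensorOp_smul]
  congr 1
  funext q
  exact pauli_mul_comm _ _

theorem pauliString_mul_self {n : ℕ} (s : Fin n → Fin 4) : pauliString s * pauliString s = 1 := by
  simp only [pauliString, tensorOp_mul, pauli_mul_self, tensorOp_one]

theorem pauliString_conjTranspose {n : ℕ} (s : Fin n → Fin 4) :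
    (pauliString s)ᴴ = pauliString s := by
  ext x y
  have h : ∀ q, star (pauli (s q) (y q) (x q)) = pauli (s q) (x q) (y q) := fun q =>
    congrFun (congrFun (pauli_conjTranspose (s q)) (x q)) (y q)
  simp only [Matrix.conjTranspose_apply, pauliString, tensorOp, star_prod, h]

theorem letterSign_eq (i j : Fin 4) : letterSign i j = 1 ∨ letterSign i j = -1 := by
  rw [letterSign]; split_ifs <;> simp

theorem pauliSign_eq {n : ℕ} (s t : Fin n → Fin 4) : pauliSign s t = 1 ∨ pauliSign s t = -1 := by
  rw [pauliSign]
  refine Finset.prod_induction _ (fun x => x = 1 ∨ x = -1) ?_ (Or.inl rfl)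
    fun q _ => letterSign_eq _ _
  rintro a b (rfl | rfl) (rfl | rfl) <;> simp

/-- A string changes sign only if an error occurs in its support. -/
theorem one_sub_pauliSign_le {n : ℕ} (s t : Fin n → Fin 4) :
    1 - pauliSign s t ≤ 2 * ∑ q with s q ≠ 0, if t q ≠ 0 then (1 : ℝ) else 0 := by
  have hnn : ∀ q ∈ Finset.univ.filter fun q => s q ≠ 0, (0 : ℝ) ≤ if t q ≠ 0 then 1 else 0 :=
    fun q _ => by split_ifs <;> norm_num
  by_cases h : ∃ q, s q ≠ 0 ∧ t q ≠ 0
  · obtain ⟨q, hs, ht⟩ := h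
    have h1 := Finset.single_le_sum hnn (Finset.mem_filter.mpr ⟨Finset.mem_univ q, hs⟩)
    rw [if_pos ht] at h1
    rcases pauliSign_eq s t with h | h <;> rw [h] <;> linarith
  · push Not at h
    have h1 : pauliSign s t = 1 := Finset.prod_eq_one fun q _ => by
      by_cases hs : s q = 0
      · simp [letterSign, hs]
      · simp [letterSign, h q hs]
    rw [h1, sub_self]
    exact mul_nonneg zero_le_two (Finset.sum_nonneg hnn)

theorem sum_prod_eq_one {ι β : Type*} [Fintype ι] [DecidableEq ι] [Fintype β] {f : ι → β → ℝ}
    (hf : ∀ i, ∑ b, f i b = 1) : ∑ ω : ι → β, ∏ i, f i (ω i) = 1 := by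
  have h := Finset.prod_univ_sum (fun _ : ι => (Finset.univ : Finset β)) f
  rw [Fintype.piFinset_univ] at h
  rw [← h, Finset.prod_congr rfl fun i _ => hf i, Finset.prod_const_one]

/-- Marginals of a product distribution. -/
theorem sum_prod_mul_apply {ι β : Type*} [Fintype ι] [DecidableEq ι] [Fintype β] {f : ι → β → ℝ}
    (hf : ∀ i, ∑ b, f i b = 1) (i₀ : ι) (g : β → ℝ) :
    ∑ ω : ι → β, (∏ i, f i (ω i)) * g (ω i₀) = ∑ b, f i₀ b * g b := by
  have h := Finset.prod_univ_sum (fun _ : ι => (Finset.univ : Finset β))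
    (fun i b => f i b * if i = i₀ then g b else 1)
  rw [Fintype.piFinset_univ] at h
  have h2 : ∀ ω : ι → β, (∏ i, f i (ω i)) * g (ω i₀) =
      ∏ i, f i (ω i) * if i = i₀ then g (ω i) else 1 := by
    intro ω
    rw [Finset.prod_mul_distrib, Finset.prod_ite_eq' Finset.univ i₀, if_pos (Finset.mem_univ i₀)]
  simp only [h2, ← h]
  rw [Finset.prod_eq_single i₀]
  · simp only [if_true]
  · intro i _ hi
    simp only [if_neg hi, mul_one]
    exact hf i
  · exact fun h => absurd (Finset.mem_univ _) h

/-- The probability of an error pattern in one application of the noise channel. -/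
noncomputable def errorProb {n : ℕ} (α : Fin 3 → ℝ) (p : ℝ) (s : Fin n → Fin 4) : ℝ :=
  ∏ q, noiseProb α p (s q)

section Noise

variable {α : Fin 3 → ℝ} {p : ℝ}

theorem noiseProb_nonneg (hα : ∀ j, 0 ≤ α j) (h0 : 0 ≤ p) (h1 : p ≤ 2 / 3) (j : Fin 4) :
    0 ≤ noiseProb α p j := by
  have := hα 0
  have := hα 1
  have := hα 2
  fin_cases j
  · change 0 ≤ 1 - 3 / 4 * p; linarith
  · change 0 ≤ 3 / 4 * p * α 0; positivity
  · change 0 ≤ 3 / 4 * p * α 1; positivity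
  · change 0 ≤ 3 / 4 * p * α 2; positivity

theorem sum_noiseProb (hα : ∑ j, α j = 1) : ∑ j, noiseProb α p j = 1 := by
  rw [Fin.sum_univ_three] at hα
  rw [Fin.sum_univ_four]
  change 1 - 3 / 4 * p + 3 / 4 * p * α 0 + 3 / 4 * p * α 1 + 3 / 4 * p * α 2 = 1
  linear_combination 3 / 4 * p * hα

theorem sum_noiseProb_indicator (hα : ∑ j, α j = 1) :
    ∑ j, noiseProb α p j * (if j ≠ 0 then 1 else 0) = 3 / 4 * p := by
  rw [Fin.sum_univ_three] at hα
  rw [Fin.sum_univ_four]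
  have h : ∀ j : Fin 4, j ≠ 0 → noiseProb α p j * (if j ≠ 0 then 1 else 0) = noiseProb α p j :=
    fun j hj => by rw [if_pos hj, mul_one]
  rw [h 1 (by decide), h 2 (by decide), h 3 (by decide), if_neg (by simp), mul_zero, zero_add]
  change 3 / 4 * p * α 0 + 3 / 4 * p * α 1 + 3 / 4 * p * α 2 = 3 / 4 * p
  linear_combination 3 / 4 * p * hα

theorem errorProb_nonneg {n : ℕ} (hα : ∀ j, 0 ≤ α j) (h0 : 0 ≤ p) (h1 : p ≤ 2 / 3)
    (s : Fin n → Fin 4) : 0 ≤ errorProb α p s :=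
  Finset.prod_nonneg fun _ _ => noiseProb_nonneg hα h0 h1 _

theorem sum_errorProb {n : ℕ} (hα : ∑ j, α j = 1) :
    ∑ s : Fin n → Fin 4, errorProb α p s = 1 :=
  sum_prod_eq_one fun _ => sum_noiseProb hα

theorem sum_errorProb_mul_indicator {n : ℕ} (hα : ∑ j, α j = 1) (q : Fin n) :
    ∑ s : Fin n → Fin 4, errorProb α p s * (if s q ≠ 0 then 1 else 0) = 3 / 4 * p := by
  rw [← sum_noiseProb_indicator hα]
  exact sum_prod_mul_apply (fun _ => sum_noiseProb hα) q fun j => if j ≠ 0 then 1 else 0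

theorem sum_errorProb_one_sub_pauliSign_le {n : ℕ} (hα : ∀ j, 0 ≤ α j) (hα1 : ∑ j, α j = 1)
    (h0 : 0 ≤ p) (h1 : p ≤ 2 / 3) (s : Fin n → Fin 4) :
    ∑ t, errorProb α p t * (1 - pauliSign s t) ≤ 3 / 2 * p * pauliWeight s := by
  calc ∑ t, errorProb α p t * (1 - pauliSign s t)
      ≤ ∑ t : Fin n → Fin 4, errorProb α p t *
          (2 * ∑ q with s q ≠ 0, if t q ≠ 0 then (1 : ℝ) else 0) :=
        Finset.sum_le_sum fun t _ => mul_le_mul_of_nonneg_left (one_sub_pauliSign_le s t)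
          (errorProb_nonneg hα h0 h1 t)
    _ = 2 * ∑ q with s q ≠ 0, ∑ t : Fin n → Fin 4,
          errorProb α p t * (if t q ≠ 0 then (1 : ℝ) else 0) := by
        rw [Finset.sum_comm, Finset.mul_sum]
        refine Finset.sum_congr rfl fun t _ => ?_
        rw [Finset.mul_sum, Finset.mul_sum, Finset.mul_sum]
        exact Finset.sum_congr rfl fun q _ => by ring
    _ = 3 / 2 * p * pauliWeight s := by
        simp only [sum_errorProb_mul_indicator hα1, Finset.sum_const, nsmul_eq_mul, pauliWeight]
        ring

end Noise

/-! ### Encoded circuits and error trajectories -/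

section Encoding

variable {D L n φ₀ ℓ : ℕ} (E : LocalEncoding D L n φ₀)

/-- A symmetric matrix of signs, one for each bilinear. -/
structure IsSignMatrix (χ : Matrix (Mode D L) (Mode D L) ℝ) : Prop where
  eq_or : ∀ a b, χ a b = 1 ∨ χ a b = -1
  symm : χᵀ = χ

theorem IsSignMatrix.hadamard {χ χ' : Matrix (Mode D L) (Mode D L) ℝ} (h : IsSignMatrix χ)
    (h' : IsSignMatrix χ') : IsSignMatrix (χ ⊙ χ') where
  eq_or a b := by
    rw [Matrix.hadamard_apply]
    rcases h.eq_or a b with h1 | h1 <;> rcases h'.eq_or a b with h2 | h2 <;> simp [h1, h2]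
  symm := by
    ext a b
    have h1 : χ b a = χ a b := congrFun (congrFun h.symm a) b
    have h2 : χ' b a = χ' a b := congrFun (congrFun h'.symm a) b
    rw [Matrix.transpose_apply, Matrix.hadamard_apply, Matrix.hadamard_apply, h1, h2]

/-- The matrix of trivial signs. -/
def noSigns : Matrix (Mode D L) (Mode D L) ℝ := Matrix.of fun _ _ => 1

theorem isSignMatrix_noSigns : IsSignMatrix (noSigns : Matrix (Mode D L) (Mode D L) ℝ) where
  eq_or _ _ := Or.inl rfl
  symm := rfl

theorem noSigns_hadamard (A : Matrix (Mode D L) (Mode D L) ℝ) : noSigns ⊙ A = A := by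
  ext a b
  rw [Matrix.hadamard_apply, noSigns, Matrix.of_apply, one_mul]

theorem IsSignMatrix.antisymm {χ A : Matrix (Mode D L) (Mode D L) ℝ} (h : IsSignMatrix χ)
    (hA : Aᵀ = -A) : (χ ⊙ A)ᵀ = -(χ ⊙ A) := by
  ext a b
  have h1 : χ b a = χ a b := congrFun (congrFun h.symm a) b
  have h2 : A b a = -A a b := congrFun (congrFun hA a) b
  rw [Matrix.transpose_apply, Matrix.neg_apply, Matrix.hadamard_apply, Matrix.hadamard_apply, h1,
    h2, mul_neg]

/-- The signs that the encoded bilinears acquire when they are commuted past the error `s`. -/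
noncomputable def LocalEncoding.errorSign (s : Fin n → Fin 4) :
    Matrix (Mode D L) (Mode D L) ℝ :=
  Matrix.of fun a b => pauliSign (E.string a b) s

theorem LocalEncoding.isSignMatrix_errorSign (s : Fin n → Fin 4) :
    IsSignMatrix (E.errorSign s) where
  eq_or a b := pauliSign_eq _ _
  symm := by
    ext a b
    change pauliSign (E.string b a) s = pauliSign (E.string a b) s
    rw [E.string_swap]

/-- `F` is an isometry that commutes with the encoded bilinears up to the signs `χ`; accumulated
Pauli errors are of this kind. -/
structure Twists (F : QubitOp n) (χ : Matrix (Mode D L) (Mode D L) ℝ) : Prop where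
  isometry : Fᴴ * F = 1
  comm : ∀ a b, pauliString (E.string a b) * F = (χ a b : ℂ) • (F * pauliString (E.string a b))

theorem twists_one : Twists E 1 noSigns where
  isometry := by simp
  comm a b := by simp [noSigns]

variable {E}

/-- Accumulated errors multiply their signs entrywise. -/
theorem Twists.pauliString_mul {F : QubitOp n} {χ : Matrix (Mode D L) (Mode D L) ℝ}
    (h : Twists E F χ) (s : Fin n → Fin 4) : Twists E (pauliString s * F) (E.errorSign s ⊙ χ) where
  isometry := by
    rw [Matrix.conjTranspose_mul, pauliString_conjTranspose, Matrix.mul_assoc,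
      ← Matrix.mul_assoc (pauliString s), pauliString_mul_self, Matrix.one_mul, h.isometry]
  comm a b := by
    rw [← Matrix.mul_assoc, pauliString_mul_comm, Matrix.smul_mul, Matrix.mul_assoc, h.comm,
      Matrix.mul_smul, smul_smul, Matrix.mul_assoc, Matrix.hadamard_apply, Complex.ofReal_mul]
    rfl

/-- After the error `F` an encoded quadratic operator acts on the code space as the quadratic
operator with flipped signs. This holds even though the relations between the encoded bilinears
fail outside the code space. -/
theorem Twists.quadratic_mul {F : QubitOp n} {χ : Matrix (Mode D L) (Mode D L) ℝ}
    (h : Twists E F χ) (A : Matrix (Mode D L) (Mode D L) ℝ) :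
    E.quadratic A * (F * E.code) = (F * E.code) * (Complex.I • fockQuadratic (χ ⊙ A)) := by
  have h1 : ∀ a b, E.bilinear a b * (F * E.code) =
      (χ a b : ℂ) • (F * E.code * (majorana a * majorana b)) := by
    intro a b
    rw [Matrix.mul_assoc, ← E.intertwines, LocalEncoding.bilinear, ← Matrix.mul_assoc,
      Matrix.smul_mul, h.comm, Matrix.smul_mul, Matrix.smul_mul, Matrix.smul_mul,
      Matrix.mul_smul, smul_comm, Matrix.mul_assoc]
  rw [LocalEncoding.quadratic, fockQuadratic, Matrix.smul_mul, Matrix.mul_smul]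
  simp only [Matrix.sum_mul, Matrix.mul_sum, Matrix.smul_mul, Matrix.mul_smul, h1, smul_smul,
    Matrix.hadamard_apply, Complex.ofReal_mul, mul_comm]

variable (E) in
/-- The projection onto the encoded sector commutes with the bilinears. -/
theorem LocalEncoding.commute_sector (a b : Mode D L) :
    Commute (E.codeᴴ * E.code) (majorana a * majorana b) := by
  by_cases hab : a = b
  · rw [hab, majorana_mul_self]
    exact Commute.one_right _
  set V := E.code
  set ph := E.phase a b
  set S := pauliString (E.string a b) with hS
  set g := majorana a * majorana b with hg
  have hint : ph • (S * V) = V * g := by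
    rw [← Matrix.smul_mul]; exact E.intertwines a b
  have hgg : g * g = -1 := by
    calc g * g = majorana a * (majorana b * majorana a) * majorana b := by
          rw [hg]; simp only [mul_assoc]
      _ = -(majorana a * majorana a * (majorana b * majorana b)) := by
          rw [majorana_mul_anticomm (Ne.symm hab)]; simp only [mul_assoc, mul_neg, neg_mul]
      _ = -1 := by rw [majorana_mul_self, majorana_mul_self, one_mul]
  have hgH : gᴴ = -g := by
    rw [hg, Matrix.conjTranspose_mul, majorana_conjTranspose, majorana_conjTranspose,
      majorana_mul_anticomm (Ne.symm hab)]
  -- the phase is `± i`, unless the code space is trivial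
  have hph : (ph * ph) • V = -V := by
    calc (ph * ph) • V = ph • (S * (ph • (S * V))) := by
          rw [Matrix.mul_smul, smul_smul, ← Matrix.mul_assoc, hS, pauliString_mul_self,
            Matrix.one_mul]
      _ = (ph • (S * V)) * g := by rw [Matrix.smul_mul, Matrix.mul_assoc, hint]
      _ = -V := by rw [hint, Matrix.mul_assoc, hgg, Matrix.mul_neg, Matrix.mul_one]
  have h1 : ph • (Vᴴ * (S * V)) = Vᴴ * V * g := by
    rw [← Matrix.mul_smul, hint, Matrix.mul_assoc]
  have h2 : star ph • (Vᴴ * (S * V)) = -(g * (Vᴴ * V)) := by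
    have := congrArg Matrix.conjTranspose hint
    rw [Matrix.conjTranspose_smul, Matrix.conjTranspose_mul, Matrix.conjTranspose_mul, hgH, hS,
      pauliString_conjTranspose] at this
    rw [← Matrix.mul_assoc, ← Matrix.smul_mul, this, Matrix.neg_mul, Matrix.neg_mul,
      Matrix.mul_assoc]
  have hstar : ph * star ph = 1 := by
    have := Complex.mul_conj' ph
    rw [E.norm_phase a b] at this
    simpa using this
  have h3 : Vᴴ * V * g = (ph * ph) • -(g * (Vᴴ * V)) := by
    rw [← h2, smul_smul, mul_assoc, hstar, mul_one, h1]
  calc Vᴴ * V * g = (ph * ph) • -(g * (Vᴴ * V)) := h3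
    _ = -(g * (Vᴴ * ((ph * ph) • V))) := by
        rw [smul_neg, Matrix.mul_smul, Matrix.mul_smul]
    _ = g * (Vᴴ * V) := by rw [hph, Matrix.mul_neg, Matrix.mul_neg, neg_neg]

variable (E) in
theorem LocalEncoding.commute_sector_exp (A : Matrix (Mode D L) (Mode D L) ℝ) :
    Commute (E.codeᴴ * E.code) (NormedSpace.exp (fockQuadratic A)) := by
  have h : Commute (E.codeᴴ * E.code) (fockQuadratic A) :=
    Commute.sum_right _ _ _ fun a _ => Commute.sum_right _ _ _ fun b _ =>
      (E.commute_sector a b).smul_right _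
  exact (exp_mul_of_intertwine h.symm.eq).symm

/-! ### Layers -/

/-- The generator of a layer: the sum of the coefficient matrices of its gates. -/
def GaussianLayer.generator (l : GaussianLayer D L ℓ) : Matrix (Mode D L) (Mode D L) ℝ :=
  (l.gates.map fun g => g.h).sum

/-- The rotation of the Majorana operators by a layer whose couplings carry the signs `χ`. -/
noncomputable def GaussianLayer.rotation (l : GaussianLayer D L ℓ)
    (χ : Matrix (Mode D L) (Mode D L) ℝ) : Matrix (Mode D L) (Mode D L) ℝ :=
  NormedSpace.exp ((4 : ℝ) • (χ ⊙ l.generator))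

/-- The unitary on Fock space of a layer whose couplings carry the signs `χ`. -/
noncomputable def GaussianLayer.fockUnitary (l : GaussianLayer D L ℓ)
    (χ : Matrix (Mode D L) (Mode D L) ℝ) : FockOp D L :=
  (l.gates.map fun g => NormedSpace.exp (fockQuadratic (χ ⊙ g.h))).prod

theorem Twists.unitary_mul {F : QubitOp n} {χ : Matrix (Mode D L) (Mode D L) ℝ}
    (h : Twists E F χ) (l : GaussianLayer D L ℓ) :
    l.unitary E * (F * E.code) = (F * E.code) * l.fockUnitary χ := by
  rw [GaussianLayer.unitary, GaussianLayer.fockUnitary]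
  induction l.gates with
  | nil => simp
  | cons g gs ih =>
    have hg : g.unitary E * (F * E.code) =
        F * E.code * NormedSpace.exp (fockQuadratic (χ ⊙ g.h)) := by
      refine exp_mul_of_intertwine ?_
      rw [Matrix.smul_mul, h.quadratic_mul, ← Matrix.mul_smul, smul_smul]
      simp
    rw [List.map_cons, List.map_cons, List.prod_cons, List.prod_cons, Matrix.mul_assoc, ih,
      ← Matrix.mul_assoc, hg, ← Matrix.mul_assoc]

variable (E) in
theorem LocalEncoding.commute_sector_fockUnitary (l : GaussianLayer D L ℓ)
    (χ : Matrix (Mode D L) (Mode D L) ℝ) : Commute (E.codeᴴ * E.code) (l.fockUnitary χ) := by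
  refine Commute.list_prod_right _ _ fun W hW => ?_
  obtain ⟨g, _, rfl⟩ := List.mem_map.mp hW
  exact E.commute_sector_exp _

theorem GaussianLayer.conjTranspose_mul_fockUnitary (l : GaussianLayer D L ℓ)
    {χ : Matrix (Mode D L) (Mode D L) ℝ} (hχ : IsSignMatrix χ) :
    (l.fockUnitary χ)ᴴ * l.fockUnitary χ = 1 := by
  have h : l.fockUnitary χ * (l.fockUnitary χ)ᴴ = 1 := ?_
  · exact mul_eq_one_comm.mp h
  rw [GaussianLayer.fockUnitary]
  induction l.gates with
  | nil => simp
  | cons g gs ih =>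
    rw [List.map_cons, List.prod_cons, Matrix.conjTranspose_mul, Matrix.mul_assoc,
      ← Matrix.mul_assoc (List.prod _), ih, Matrix.one_mul,
      exp_mul_conjTranspose_of_antisymm (hχ.antisymm g.antisymm)]

theorem GaussianLayer.generator_antisymm (l : GaussianLayer D L ℓ) :
    l.generatorᵀ = -l.generator := by
  rw [GaussianLayer.generator]
  induction l.gates with
  | nil => simp
  | cons g gs ih =>
    rw [List.map_cons, List.sum_cons, Matrix.transpose_add, ih, g.antisymm, neg_add]

theorem GaussianLayer.rotation_mul_transpose (l : GaussianLayer D L ℓ)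
    {χ : Matrix (Mode D L) (Mode D L) ℝ} (hχ : IsSignMatrix χ) :
    l.rotation χ * (l.rotation χ)ᵀ = 1 :=
  exp_mul_transpose_of_antisymm (by
    rw [Matrix.transpose_smul, hχ.antisymm l.generator_antisymm, smul_neg])

theorem hadamard_h_mul_eq_zero {g g' : GaussianGate D L ℓ} (h : Disjoint g.support g'.support)
    (χ : Matrix (Mode D L) (Mode D L) ℝ) : (χ ⊙ g.h) * (χ ⊙ g'.h) = 0 := by
  ext a b
  rw [Matrix.mul_apply]
  refine Finset.sum_eq_zero fun c _ => ?_
  rw [Matrix.hadamard_apply, Matrix.hadamard_apply]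
  by_cases h1 : g.h a c = 0
  · rw [h1, mul_zero, zero_mul]
  by_cases h2 : g'.h c b = 0
  · rw [h2, mul_zero, mul_zero]
  exact absurd (g'.local_h c b h2).1 (Finset.disjoint_left.mp h (g.local_h a c h1).2)

theorem GaussianLayer.rotates (l : GaussianLayer D L ℓ)
    {χ : Matrix (Mode D L) (Mode D L) ℝ} (hχ : IsSignMatrix χ) :
    Rotates (l.fockUnitary χ) (l.rotation χ) := by
  have h1 : Rotates (l.fockUnitary χ)
      ((l.gates.map fun g => (4 : ℝ) • (χ ⊙ g.h)).map NormedSpace.exp).prod := by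
    rw [GaussianLayer.fockUnitary]
    induction l.gates with
    | nil => exact rotates_one
    | cons g gs ih =>
      simp only [List.map_cons, List.prod_cons]
      exact (rotates_exp (hχ.antisymm g.antisymm)).mul ih
  have h2 : (l.gates.map fun g => (4 : ℝ) • (χ ⊙ g.h)).sum = (4 : ℝ) • (χ ⊙ l.generator) := by
    rw [GaussianLayer.generator]
    induction l.gates with
    | nil => simp
    | cons g gs ih =>
      rw [List.map_cons, List.sum_cons, ih, List.map_cons, List.sum_cons, Matrix.hadamard_add,
        smul_add]
  rw [GaussianLayer.rotation, ← h2, ← list_prod_exp]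
  · exact h1
  · rw [List.pairwise_map]
    refine l.disjoint.imp fun {g g'} h => ⟨?_, ?_⟩
    · rw [Matrix.smul_mul, Matrix.mul_smul, hadamard_h_mul_eq_zero h, smul_zero, smul_zero]
    · rw [Matrix.smul_mul, Matrix.mul_smul, hadamard_h_mul_eq_zero h.symm, smul_zero, smul_zero]

/-! ### Expansion into trajectories -/

/-- The signs after the errors `τ`, starting from `χ`. -/
noncomputable def LocalEncoding.trajectorySign (E : LocalEncoding D L n φ₀) :
    Matrix (Mode D L) (Mode D L) ℝ → List (Fin n → Fin 4) → Matrix (Mode D L) (Mode D L) ℝ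
  | χ, [] => χ
  | χ, s :: τ => E.trajectorySign (E.errorSign s ⊙ χ) τ

/-- The rotation of the Majorana operators by a circuit in which the errors `τ` occur, one
pattern after each layer, and the initial signs are `χ`. The lists are meant to have the same
length; layers without an error pattern are ignored. -/
noncomputable def LocalEncoding.trajectoryRotation (E : LocalEncoding D L n φ₀) :
    Matrix (Mode D L) (Mode D L) ℝ → List (GaussianLayer D L ℓ) → List (Fin n → Fin 4) →
      Matrix (Mode D L) (Mode D L) ℝ
  | χ, l :: c, s :: τ => E.trajectoryRotation (E.errorSign s ⊙ χ) c τ * l.rotation χ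
  | _, [], _ => 1
  | _, _ :: _, [] => 1

/-- The rotation of the Majorana operators by a circuit without errors. -/
noncomputable def idealRotation : List (GaussianLayer D L ℓ) → Matrix (Mode D L) (Mode D L) ℝ
  | [] => 1
  | l :: c => idealRotation c * l.rotation noSigns

theorem Twists.layer_conj {F : QubitOp n} {χ : Matrix (Mode D L) (Mode D L) ℝ}
    (h : Twists E F χ) (l : GaussianLayer D L ℓ) (ρ : FockOp D L) :
    l.unitary E * (F * E.code * ρ * (F * E.code)ᴴ) * (l.unitary E)ᴴ =
      F * E.code * (l.fockUnitary χ * ρ * (l.fockUnitary χ)ᴴ) * (F * E.code)ᴴ := by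
  calc l.unitary E * (F * E.code * ρ * (F * E.code)ᴴ) * (l.unitary E)ᴴ
      = (l.unitary E * (F * E.code)) * ρ * (l.unitary E * (F * E.code))ᴴ := by
        rw [Matrix.conjTranspose_mul (l.unitary E)]
        simp only [Matrix.mul_assoc]
    _ = _ := by
        rw [h.unitary_mul, Matrix.conjTranspose_mul (F * E.code)]
        simp only [Matrix.mul_assoc]

theorem LocalEncoding.sector_conj {ρ : FockOp D L} (hρ : E.codeᴴ * E.code * ρ = ρ)
    (l : GaussianLayer D L ℓ) (χ : Matrix (Mode D L) (Mode D L) ℝ) :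
    E.codeᴴ * E.code * (l.fockUnitary χ * ρ * (l.fockUnitary χ)ᴴ) =
      l.fockUnitary χ * ρ * (l.fockUnitary χ)ᴴ := by
  rw [← Matrix.mul_assoc, ← Matrix.mul_assoc, (E.commute_sector_fockUnitary l χ).eq,
    Matrix.mul_assoc (l.fockUnitary χ), hρ]

theorem Twists.trace_mul_quadratic {F : QubitOp n} {χ : Matrix (Mode D L) (Mode D L) ℝ}
    (h : Twists E F χ) (hχ : IsSignMatrix χ) {ρ : FockOp D L} (hρ : ρ.IsHermitian)
    (hsec : E.codeᴴ * E.code * ρ = ρ) {O : Matrix (Mode D L) (Mode D L) ℝ} (hO : Oᵀ = -O) :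
    (F * E.code * ρ * (F * E.code)ᴴ * E.quadratic O).trace =
      (pairing (χ ⊙ O) (covariance ρ) : ℂ) := by
  have hiso : (F * E.code)ᴴ * (F * E.code) = E.codeᴴ * E.code := by
    rw [Matrix.conjTranspose_mul, Matrix.mul_assoc, ← Matrix.mul_assoc Fᴴ, h.isometry,
      Matrix.one_mul]
  have hsec' : ρ * (E.codeᴴ * E.code) = ρ := by
    have := congrArg Matrix.conjTranspose hsec
    rwa [Matrix.conjTranspose_mul, Matrix.conjTranspose_mul, Matrix.conjTranspose_conjTranspose,
      hρ.eq] at this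
  rw [Matrix.mul_assoc, Matrix.mul_assoc, Matrix.trace_mul_comm, Matrix.mul_assoc,
    Matrix.mul_assoc, h.quadratic_mul, ← Matrix.mul_assoc (F * E.code)ᴴ, hiso, ← Matrix.mul_assoc,
    hsec', trace_mul_fockQuadratic hρ (hχ.antisymm hO)]

theorem idealEvolution_cons (E : LocalEncoding D L n φ₀) (l : GaussianLayer D L ℓ)
    (c : List (GaussianLayer D L ℓ)) (σ : QubitOp n) :
    idealEvolution E (l :: c) σ =
      idealEvolution E c (l.unitary E * σ * (l.unitary E)ᴴ) := rfl

theorem noisyEvolution_cons (E : LocalEncoding D L n φ₀) (α : Fin 3 → ℝ) (p : ℝ)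
    (l : GaussianLayer D L ℓ) (c : List (GaussianLayer D L ℓ)) (σ : QubitOp n) :
    noisyEvolution E α p (l :: c) σ =
      noisyEvolution E α p c (pauliNoise α p (l.unitary E * σ * (l.unitary E)ᴴ)) := rfl

/-- The noiseless expectation value is that of the rotated covariance matrix. -/
theorem trace_idealEvolution (c : List (GaussianLayer D L ℓ)) {ρ : FockOp D L}
    (hρ : ρ.IsHermitian) (hsec : E.codeᴴ * E.code * ρ = ρ)
    {O : Matrix (Mode D L) (Mode D L) ℝ} (hO : Oᵀ = -O) :
    (idealEvolution E c (E.code * ρ * E.codeᴴ) * E.quadratic O).trace =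
      (pairing O (idealRotation c * covariance ρ * (idealRotation c)ᵀ) : ℂ) := by
  induction c generalizing ρ with
  | nil =>
    have := (twists_one E).trace_mul_quadratic isSignMatrix_noSigns hρ hsec hO
    rw [Matrix.one_mul, noSigns_hadamard] at this
    simpa [idealEvolution, idealRotation] using this
  | cons l c ih =>
    have h1 := (twists_one E).layer_conj l ρ
    rw [Matrix.one_mul] at h1
    have h2 := ih (Matrix.isHermitian_mul_mul_conjTranspose (l.fockUnitary noSigns) hρ)
      (LocalEncoding.sector_conj hsec l noSigns)
    rw [← h1, covariance_conj ρ (l.conjTranspose_mul_fockUnitary isSignMatrix_noSigns)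
      (l.rotates isSignMatrix_noSigns)] at h2
    rw [idealEvolution_cons, h2, idealRotation, Matrix.transpose_mul]
    simp only [Matrix.mul_assoc]

theorem noisyEvolution_sum {ι : Type*} (E : LocalEncoding D L n φ₀) (α : Fin 3 → ℝ) (p : ℝ)
    (c : List (GaussianLayer D L ℓ)) (s : Finset ι) (w : ι → ℂ) (σ : ι → QubitOp n) :
    noisyEvolution E α p c (∑ i ∈ s, w i • σ i) =
      ∑ i ∈ s, w i • noisyEvolution E α p c (σ i) := by
  induction c generalizing σ with
  | nil => rfl
  | cons l c ih =>
    have h1 : pauliNoise α p (l.unitary E * (∑ i ∈ s, w i • σ i) * (l.unitary E)ᴴ) =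
        ∑ i ∈ s, w i • pauliNoise α p (l.unitary E * σ i * (l.unitary E)ᴴ) := by
      simp only [pauliNoise, Finset.mul_sum, Finset.sum_mul, Finset.smul_sum, Matrix.mul_smul,
        Matrix.smul_mul]
      rw [Finset.sum_comm]
      refine Finset.sum_congr rfl fun i _ => Finset.sum_congr rfl fun t _ => ?_
      rw [smul_comm]
    have h2 := ih fun i => pauliNoise α p (l.unitary E * σ i * (l.unitary E)ᴴ)
    rw [noisyEvolution_cons, h1, h2]
    rfl

theorem sum_fin_cons {β : Type*} [Fintype β] {k : ℕ} (f : (Fin (k + 1) → β) → ℝ) :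
    ∑ ω, f ω = ∑ s, ∑ ω : Fin k → β, f (Fin.cons s ω) := by
  rw [← Fintype.sum_prod_type']
  exact (Fintype.sum_equiv (Fin.consEquiv fun _ : Fin (k + 1) => β) _ _ fun x => rfl).symm

/-- The noisy expectation value is the average over error trajectories of the expectation values
in Gaussian evolutions with flipped signs. -/
theorem Twists.trace_noisyEvolution (α : Fin 3 → ℝ) (p : ℝ) (c : List (GaussianLayer D L ℓ))
    {F : QubitOp n} {χ : Matrix (Mode D L) (Mode D L) ℝ} (h : Twists E F χ)
    (hχ : IsSignMatrix χ) {ρ : FockOp D L} (hρ : ρ.IsHermitian)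
    (hsec : E.codeᴴ * E.code * ρ = ρ) {O : Matrix (Mode D L) (Mode D L) ℝ} (hO : Oᵀ = -O) :
    (noisyEvolution E α p c (F * E.code * ρ * (F * E.code)ᴴ) * E.quadratic O).trace =
      ((∑ ω : Fin c.length → Fin n → Fin 4, (∏ i, errorProb α p (ω i)) *
        pairing (E.trajectorySign χ (List.ofFn ω) ⊙ O)
          (E.trajectoryRotation χ c (List.ofFn ω) * covariance ρ *
            (E.trajectoryRotation χ c (List.ofFn ω))ᵀ) : ℝ) : ℂ) := by
  induction c generalizing F χ ρ with
  | nil =>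
    have := h.trace_mul_quadratic hχ hρ hsec hO
    simpa [noisyEvolution, LocalEncoding.trajectoryRotation, LocalEncoding.trajectorySign]
      using this
  | cons l c ih =>
    set ρ' := l.fockUnitary χ * ρ * (l.fockUnitary χ)ᴴ with hρ'
    have hnoise : pauliNoise α p (l.unitary E * (F * E.code * ρ * (F * E.code)ᴴ) *
        (l.unitary E)ᴴ) = ∑ s : Fin n → Fin 4, (errorProb α p s : ℂ) •
          (pauliString s * F * E.code * ρ' * (pauliString s * F * E.code)ᴴ) := by
      rw [h.layer_conj, pauliNoise]
      refine Finset.sum_congr rfl fun s _ => ?_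
      simp only [hρ', Matrix.conjTranspose_mul, pauliString_conjTranspose, Matrix.mul_assoc,
        errorProb]
    have hstep : noisyEvolution E α p (l :: c) (F * E.code * ρ * (F * E.code)ᴴ) =
        ∑ s : Fin n → Fin 4, (errorProb α p s : ℂ) • noisyEvolution E α p c
          (pauliString s * F * E.code * ρ' * (pauliString s * F * E.code)ᴴ) := by
      rw [← noisyEvolution_sum, ← hnoise, noisyEvolution_cons]
    have hih := fun s => ih (h.pauliString_mul s) ((E.isSignMatrix_errorSign s).hadamard hχ)
      (Matrix.isHermitian_mul_mul_conjTranspose (l.fockUnitary χ) hρ)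
      (LocalEncoding.sector_conj hsec l χ)
    rw [hstep, Matrix.sum_mul, Matrix.trace_sum]
    simp only [Matrix.smul_mul, Matrix.trace_smul, hρ', hih]
    rw [covariance_conj ρ (l.conjTranspose_mul_fockUnitary hχ) (l.rotates hχ)]
    have hreal := sum_fin_cons (k := c.length) fun ω : Fin (c.length + 1) → Fin n → Fin 4 =>
      (∏ i, errorProb α p (ω i)) * pairing (E.trajectorySign χ (List.ofFn ω) ⊙ O)
        (E.trajectoryRotation χ (l :: c) (List.ofFn ω) * covariance ρ *
          (E.trajectoryRotation χ (l :: c) (List.ofFn ω))ᵀ)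
    refine Eq.trans ?_ (congrArg Complex.ofReal hreal.symm)
    rw [Complex.ofReal_sum]
    refine Finset.sum_congr rfl fun s _ => ?_
    rw [smul_eq_mul, ← Complex.ofReal_mul, Finset.mul_sum]
    congr 1
    refine Finset.sum_congr rfl fun ω _ => ?_
    rw [Fin.prod_univ_succ, List.ofFn_succ]
    simp only [Fin.cons_zero, Fin.cons_succ, LocalEncoding.trajectorySign,
      LocalEncoding.trajectoryRotation, Matrix.transpose_mul, Matrix.mul_assoc]
    exact (mul_assoc _ _ _).symm

end Encoding

/-! ### Locality of the rotations -/

section Locality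

variable {D L n φ₀ ℓ : ℕ}

/-- An orthogonal matrix that vanishes beyond the distance `R`. -/
structure IsLocalRotation (X : Matrix (Mode D L) (Mode D L) ℝ) (R : ℕ) : Prop where
  orthogonal : X * Xᵀ = 1
  range : ∀ a b, R < modeDist a b → X a b = 0

theorem isLocalRotation_one (R : ℕ) :
    IsLocalRotation (1 : Matrix (Mode D L) (Mode D L) ℝ) R where
  orthogonal := by simp
  range a b h := by
    refine Matrix.one_apply_ne ?_
    rintro rfl
    rw [modeDist_self] at h
    omega

theorem IsLocalRotation.mul {X Y : Matrix (Mode D L) (Mode D L) ℝ} {R R' : ℕ}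
    (hX : IsLocalRotation X R) (hY : IsLocalRotation Y R') : IsLocalRotation (X * Y) (R + R') where
  orthogonal := by
    rw [Matrix.transpose_mul, Matrix.mul_assoc, ← Matrix.mul_assoc Y, hY.orthogonal,
      Matrix.one_mul, hX.orthogonal]
  range a b h := by
    rw [Matrix.mul_apply]
    refine Finset.sum_eq_zero fun c _ => ?_
    by_cases hc : R < modeDist a c
    · rw [hX.range a c hc, zero_mul]
    · rw [hY.range c b (by have := modeDist_triangle a c b; omega), mul_zero]

theorem IsLocalRotation.mono {X : Matrix (Mode D L) (Mode D L) ℝ} {R R' : ℕ}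
    (hX : IsLocalRotation X R) (h : R ≤ R') : IsLocalRotation X R' where
  orthogonal := hX.orthogonal
  range a b hab := hX.range a b (by omega)

theorem IsLocalRotation.sum_sq {X : Matrix (Mode D L) (Mode D L) ℝ} {R : ℕ}
    (hX : IsLocalRotation X R) (a : Mode D L) : ∑ b, X a b ^ 2 = 1 := by
  have := congrFun (congrFun hX.orthogonal a) a
  rw [Matrix.mul_apply, Matrix.one_apply_eq] at this
  rw [← this]
  exact Finset.sum_congr rfl fun b _ => sq _

theorem IsLocalRotation.abs_apply_le {X : Matrix (Mode D L) (Mode D L) ℝ} {R : ℕ}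
    (hX : IsLocalRotation X R) (a b : Mode D L) : |X a b| ≤ 1 := by
  rw [← sq_le_one_iff_abs_le_one, ← hX.sum_sq a]
  exact Finset.single_le_sum (f := fun b => X a b ^ 2) (fun _ _ => sq_nonneg _)
    (Finset.mem_univ b)

/-- The rows of a local rotation are unit vectors with few entries, so their `ℓ¹` norm is at most
the square root of the volume of a ball. -/
theorem IsLocalRotation.sum_abs_le {X : Matrix (Mode D L) (Mode D L) ℝ} {R : ℕ}
    (hX : IsLocalRotation X R) (a : Mode D L) :
    ∑ b, |X a b| ≤ √(2 * (2 * (R : ℝ) + 1) ^ D) := by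
  have h1 : ∑ b, |X a b| = ∑ b with modeDist a b ≤ R, |X a b| := by
    rw [Finset.sum_filter]
    refine Finset.sum_congr rfl fun b _ => ?_
    split_ifs with h
    · rfl
    · rw [hX.range a b (by omega), abs_zero]
  rw [h1]
  refine Real.le_sqrt_of_sq_le ?_
  refine (sq_sum_le_card_mul_sum_sq).trans ?_
  have h2 : ∑ b with modeDist a b ≤ R, |X a b| ^ 2 ≤ 1 := by
    rw [← hX.sum_sq a]
    simp only [sq_abs]
    exact Finset.sum_le_sum_of_subset_of_nonneg (Finset.filter_subset _ _)
      fun _ _ _ => sq_nonneg _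
  have h3 := card_modeBall_le_real a R
  calc _ ≤ (2 * (2 * (R : ℝ) + 1) ^ D) * 1 := by gcongr
    _ = _ := mul_one _

/-- Two modes are equal or belong to the same gate of the layer. -/
def GaussianLayer.SameGate (l : GaussianLayer D L ℓ) (a b : Mode D L) : Prop :=
  a = b ∨ ∃ g ∈ l.gates, a.1 ∈ g.support ∧ b.1 ∈ g.support

theorem GaussianLayer.sameGate_trans (l : GaussianLayer D L ℓ) (a b c : Mode D L)
    (hab : l.SameGate a b) (hbc : l.SameGate b c) : l.SameGate a c := by
  rcases hab with rfl | ⟨g, hg, ha, hb⟩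
  · exact hbc
  rcases hbc with rfl | ⟨g', hg', hb', hc⟩
  · exact Or.inr ⟨g, hg, ha, hb⟩
  have h : ∀ x ∈ l.gates, ∀ y ∈ l.gates, x = y ∨ Disjoint x.support y.support := by
    intro x hx y hy
    exact List.Pairwise.forall_of_forall_of_flip
      (R := fun x y : GaussianGate D L ℓ => x = y ∨ Disjoint x.support y.support)
      (fun _ _ => Or.inl rfl) (l.disjoint.imp fun h => Or.inr h)
      (l.disjoint.imp fun h => Or.inr h.symm) hx hy
  rcases h g hg g' hg' with rfl | hdis
  · exact Or.inr ⟨g, hg, ha, hc⟩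
  · exact absurd hb' (Finset.disjoint_left.mp hdis hb)

theorem GaussianLayer.modeDist_le_of_sameGate (l : GaussianLayer D L ℓ) {a b : Mode D L}
    (h : l.SameGate a b) : modeDist a b ≤ ℓ := by
  rcases h with rfl | ⟨g, _, ha, hb⟩
  · rw [modeDist_self]; exact Nat.zero_le _
  · exact g.diam_le _ ha _ hb

theorem GaussianLayer.generator_eq_zero (l : GaussianLayer D L ℓ) {a b : Mode D L}
    (h : ¬ l.SameGate a b) : l.generator a b = 0 := by
  have h' : ∀ g ∈ l.gates, g.h a b = 0 := fun g hg => by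
    by_contra hne
    exact h (Or.inr ⟨g, hg, g.local_h a b hne⟩)
  rw [GaussianLayer.generator]
  revert h'
  induction l.gates with
  | nil => exact fun _ => rfl
  | cons g gs ih =>
    intro h'
    rw [List.map_cons, List.sum_cons, Matrix.add_apply, h' g List.mem_cons_self,
      ih fun g hg => h' g (List.mem_cons_of_mem _ hg), add_zero]

theorem GaussianLayer.rotation_eq_zero (l : GaussianLayer D L ℓ)
    (χ : Matrix (Mode D L) (Mode D L) ℝ) {a b : Mode D L} (h : ¬ l.SameGate a b) :
    l.rotation χ a b = 0 :=
  exp_apply_eq_zero (r := l.SameGate) (fun _ => Or.inl rfl) l.sameGate_trans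
    (fun i j hij => by
      rw [Matrix.smul_apply, Matrix.hadamard_apply, l.generator_eq_zero hij, mul_zero, smul_zero])
    h

theorem GaussianLayer.isLocalRotation (l : GaussianLayer D L ℓ)
    {χ : Matrix (Mode D L) (Mode D L) ℝ} (hχ : IsSignMatrix χ) :
    IsLocalRotation (l.rotation χ) ℓ where
  orthogonal := l.rotation_mul_transpose hχ
  range a b h := l.rotation_eq_zero χ fun h' => by
    have := l.modeDist_le_of_sameGate h'
    omega

/-- Flipped signs change the rotation of a mode only if they affect the gate of that mode. -/
theorem GaussianLayer.abs_rotation_sub_le (l : GaussianLayer D L ℓ)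
    {χ : Matrix (Mode D L) (Mode D L) ℝ} (hχ : IsSignMatrix χ)
    {N : Matrix (Mode D L) (Mode D L) ℝ} (hN : ∀ a b, 1 - χ a b ≤ N a b) (a c : Mode D L) :
    |(l.rotation χ - l.rotation noSigns) a c| ≤ if modeDist a c ≤ ℓ then
      ∑ a' with modeDist a a' ≤ ℓ, ∑ b' with modeDist a b' ≤ ℓ, N a' b' else 0 := by
  have hN0 : ∀ a b, 0 ≤ N a b := fun a b => by
    refine le_trans ?_ (hN a b)
    rcases hχ.eq_or a b with h | h <;> rw [h] <;> norm_num
  have hQ := l.isLocalRotation hχ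
  have hQ' := l.isLocalRotation isSignMatrix_noSigns
  rw [Matrix.sub_apply]
  split_ifs with hac
  · by_cases hall : ∀ a' b', l.SameGate a a' → l.SameGate a b' → χ a' b' = 1
    · have heq : l.rotation χ a c = l.rotation noSigns a c := by
        refine exp_apply_congr (r := l.SameGate) (fun _ => Or.inl rfl) l.sameGate_trans
          (fun i j hij => ?_) (fun a' b' ha' => ?_) c
        · rw [Matrix.smul_apply, Matrix.hadamard_apply, l.generator_eq_zero hij, mul_zero,
            smul_zero]
        · rw [noSigns_hadamard, Matrix.smul_apply, Matrix.smul_apply, Matrix.hadamard_apply]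
          by_cases hab : l.SameGate a' b'
          · rw [hall a' b' ha' (l.sameGate_trans _ _ _ ha' hab), one_mul]
          · rw [l.generator_eq_zero hab, mul_zero]
      rw [heq, sub_self, abs_zero]
      exact Finset.sum_nonneg fun _ _ => Finset.sum_nonneg fun _ _ => hN0 _ _
    · push Not at hall
      obtain ⟨a', b', ha', hb', hne⟩ := hall
      have hneg : χ a' b' = -1 := (hχ.eq_or a' b').resolve_left hne
      have h2 : 2 ≤ N a' b' := by
        have := hN a' b'
        rw [hneg] at this
        linarith
      have h3 : N a' b' ≤ ∑ b' with modeDist a b' ≤ ℓ, N a' b' :=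
        Finset.single_le_sum (f := fun b' => N a' b') (fun _ _ => hN0 _ _)
          (Finset.mem_filter.mpr ⟨Finset.mem_univ _, l.modeDist_le_of_sameGate hb'⟩)
      have h4 : ∑ b' with modeDist a b' ≤ ℓ, N a' b' ≤
          ∑ a' with modeDist a a' ≤ ℓ, ∑ b' with modeDist a b' ≤ ℓ, N a' b' :=
        Finset.single_le_sum (f := fun a' => ∑ b' with modeDist a b' ≤ ℓ, N a' b')
          (fun _ _ => Finset.sum_nonneg fun _ _ => hN0 _ _)
          (Finset.mem_filter.mpr ⟨Finset.mem_univ a', l.modeDist_le_of_sameGate ha'⟩)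
      have h5 := abs_sub (l.rotation χ a c) (l.rotation noSigns a c)
      have h6 := hQ.abs_apply_le a c
      have h7 := hQ'.abs_apply_le a c
      linarith
  · rw [hQ.range a c (by omega), hQ'.range a c (by omega), sub_self, abs_zero]

theorem isLocalRotation_idealRotation (c : List (GaussianLayer D L ℓ)) :
    IsLocalRotation (idealRotation c) (c.length * ℓ) := by
  induction c with
  | nil => exact isLocalRotation_one _
  | cons l c ih =>
    refine (ih.mul (l.isLocalRotation isSignMatrix_noSigns)).mono ?_
    rw [List.length_cons, add_mul, one_mul]

theorem LocalEncoding.isLocalRotation_trajectoryRotation (E : LocalEncoding D L n φ₀)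
    (c : List (GaussianLayer D L ℓ)) {χ : Matrix (Mode D L) (Mode D L) ℝ}
    (hχ : IsSignMatrix χ) (τ : List (Fin n → Fin 4)) :
    IsLocalRotation (E.trajectoryRotation χ c τ) (c.length * ℓ) := by
  induction c generalizing χ τ with
  | nil => exact isLocalRotation_one _
  | cons l c ih =>
    cases τ with
    | nil => exact isLocalRotation_one _
    | cons s τ =>
      refine ((ih ((E.isSignMatrix_errorSign s).hadamard hχ) τ).mul (l.isLocalRotation hχ)).mono ?_
      rw [List.length_cons, add_mul, one_mul]

/-! ### Spreading of correlations -/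

/-- A bound on the correlations at distance `r` after rotations of range `R` on a state whose
correlations decay as `K / r ^ μ`: no decay inside the light cone, and the same power law
outside, amplified by the volume of the light cone. -/
noncomputable def corrBound (D : ℕ) (K μ : ℝ) (R r : ℕ) : ℝ :=
  if r ≤ 4 * R then 1 else 2 * (2 * (R : ℝ) + 1) ^ D * (|K| * 2 ^ μ) / (r : ℝ) ^ μ

theorem corrBound_nonneg (D : ℕ) (K μ : ℝ) (R r : ℕ) : 0 ≤ corrBound D K μ R r := by
  rw [corrBound]; split_ifs <;> positivity

theorem mul_mul_transpose_apply (X Γ Y : Matrix (Mode D L) (Mode D L) ℝ) (a b : Mode D L) :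
    (X * Γ * Yᵀ) a b = X a ⬝ᵥ Γ *ᵥ Y b := by
  rw [Matrix.dotProduct_mulVec]
  rfl

/-- Inside the light cone the covariance matrix is a contraction and the rows of `X` and `Y` are
unit vectors. Outside, these rows live on balls of radius `R` around `a` and `b`, whose points are at
distance at least `r / 2` from each other when `4 R < r`. -/
theorem abs_mul_mul_transpose_le_corrBound {K μ : ℝ} (hμ : 0 < μ)
    {Γ : Matrix (Mode D L) (Mode D L) ℝ} (hΓ : FormBound Γ 1)
    (hdecay : ∀ a b : Mode D L, a.1 ≠ b.1 → |Γ a b| ≤ K / (modeDist a b : ℝ) ^ μ) {R : ℕ}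
    {X Y : Matrix (Mode D L) (Mode D L) ℝ} (hX : IsLocalRotation X R) (hY : IsLocalRotation Y R)
    (a b : Mode D L) : |(X * Γ * Yᵀ) a b| ≤ corrBound D K μ R (modeDist a b) := by
  rw [mul_mul_transpose_apply, corrBound]
  split_ifs with hr
  · have hself : ∀ {X : Matrix (Mode D L) (Mode D L) ℝ}, IsLocalRotation X R → ∀ a,
        X a ⬝ᵥ X a = 1 := fun {X} hX a => by
      rw [← hX.sum_sq a, dotProduct]
      exact Finset.sum_congr rfl fun b _ => (sq _).symm
    have := hΓ (X a) (Y b)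
    rwa [hself hX, hself hY, Real.sqrt_one, mul_one, mul_one] at this
  · push Not at hr
    set r := modeDist a b
    have hr0 : (0 : ℝ) < r := by exact_mod_cast (by omega : 0 < r)
    set M : ℝ := |K| * 2 ^ μ / (r : ℝ) ^ μ with hM
    have hM0 : 0 ≤ M := by positivity
    have hterm : ∀ c e, |X a c * (Γ c e * Y b e)| ≤ |X a c| * (M * |Y b e|) := by
      intro c e
      rw [abs_mul, abs_mul]
      by_cases hc : R < modeDist a c
      · rw [hX.range a c hc, abs_zero, zero_mul, zero_mul]
      by_cases he : R < modeDist b e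
      · rw [hY.range b e he, abs_zero]
        simp
      have h1 := modeDist_triangle a c b
      have h2 := modeDist_triangle c e b
      rw [modeDist_comm e b] at h2
      have h3 : r ≤ 2 * modeDist c e := by omega
      have hne : c.1 ≠ e.1 := by
        intro h
        have : modeDist c e = 0 := by rw [modeDist, h, siteDist_self]
        omega
      have h4 : (r : ℝ) / 2 ≤ modeDist c e := by
        rw [div_le_iff₀ two_pos, mul_comm]
        exact_mod_cast h3
      have h5 : |Γ c e| ≤ M := by
        refine (hdecay c e hne).trans ?_
        calc K / (modeDist c e : ℝ) ^ μ ≤ |K| / ((r : ℝ) / 2) ^ μ := by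
              have := le_abs_self K
              gcongr
          _ = M := by
              rw [hM, Real.div_rpow hr0.le two_pos.le, div_div_eq_mul_div]
      gcongr
    calc |X a ⬝ᵥ Γ *ᵥ Y b| ≤ ∑ c, ∑ e, |X a c| * (M * |Y b e|) := by
          simp only [dotProduct, Matrix.mulVec, Finset.mul_sum]
          refine (Finset.abs_sum_le_sum_abs _ _).trans (Finset.sum_le_sum fun c _ => ?_)
          exact (Finset.abs_sum_le_sum_abs _ _).trans (Finset.sum_le_sum fun e _ => hterm c e)
      _ = M * ((∑ c, |X a c|) * ∑ e, |Y b e|) := by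
          rw [Finset.sum_mul_sum, Finset.mul_sum]
          refine Finset.sum_congr rfl fun c _ => ?_
          rw [Finset.mul_sum]
          exact Finset.sum_congr rfl fun e _ => by ring
      _ ≤ M * (√(2 * (2 * (R : ℝ) + 1) ^ D) * √(2 * (2 * (R : ℝ) + 1) ^ D)) := by
          refine mul_le_mul_of_nonneg_left ?_ hM0
          exact mul_le_mul (hX.sum_abs_le a) (hY.sum_abs_le b)
            (Finset.sum_nonneg fun _ _ => abs_nonneg _) (Real.sqrt_nonneg _)
      _ = 2 * (2 * (R : ℝ) + 1) ^ D * (|K| * 2 ^ μ) / (r : ℝ) ^ μ := by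
          rw [Real.mul_self_sqrt (by positivity), hM]
          ring

end Locality

/-! ### Comparison of noisy and ideal rotations -/

section Pairing

variable {κ ι : Type*} [Fintype ι]

theorem pairing_sum_smul_sub [Fintype κ] (O : Matrix κ κ ℝ) (w : ι → ℝ) (A B : ι → Matrix κ κ ℝ) :
    ∑ i, w i * (pairing O (A i) - pairing O (B i)) =
      pairing O (∑ i, w i • (A i - B i)) := by
  simp only [pairing, Matrix.sum_apply, Matrix.smul_apply, Matrix.sub_apply, smul_eq_mul,
    Finset.mul_sum, ← Finset.sum_sub_distrib]
  rw [Finset.sum_comm]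
  refine Finset.sum_congr rfl fun a _ => ?_
  rw [Finset.sum_comm]
  refine Finset.sum_congr rfl fun b _ => Finset.sum_congr rfl fun i _ => ?_
  ring

/-- Schur's test with a symmetric entrywise majorant, for which row sums suffice. -/
theorem formBound_of_symm_bound [Fintype κ] {M T : Matrix κ κ ℝ} {c : ℝ} (hc : 0 ≤ c)
    (hM : ∀ a b, |M a b| ≤ T a b) (hT : ∀ a b, T a b = T b a) (hrow : ∀ a, ∑ b, T a b ≤ c) :
    FormBound M c := by
  refine formBound_of_sum_le hc (fun a => (Finset.sum_le_sum fun b _ => hM a b).trans (hrow a))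
    fun b => (Finset.sum_le_sum fun a _ => ?_).trans (hrow b)
  rw [hT b a]
  exact hM a b

theorem abs_sum_smul_apply_le (w : ι → ℝ) (hw : ∀ i, 0 ≤ w i) (A : ι → Matrix κ κ ℝ)
    (a b : κ) : |(∑ i, w i • A i) a b| ≤ ∑ i, w i * |A i a b| := by
  rw [Matrix.sum_apply]
  refine (Finset.abs_sum_le_sum_abs _ _).trans (Finset.sum_le_sum fun i _ => ?_)
  rw [Matrix.smul_apply, smul_eq_mul, abs_mul, abs_of_nonneg (hw i)]

end Pairing

section Telescope

variable {D L n φ₀ ℓ : ℕ} {ι : Type*} [Fintype ι]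

/-- Averaged over the errors, one layer with flipped signs differs little from the ideal layer,
in operator norm: the rotation of a given mode is affected only with small probability, and the
covariance matrix has summable rows. -/
theorem GaussianLayer.formBound_average (l : GaussianLayer D L ℓ)
    {Γ : Matrix (Mode D L) (Mode D L) ℝ} {R r : ℕ} {β : Matrix (Mode D L) (Mode D L) ℝ}
    (hβ : ∀ X Y : Matrix (Mode D L) (Mode D L) ℝ, IsLocalRotation X R →
      IsLocalRotation Y R → ∀ a b,
      |(X * Γ * Yᵀ) a b| ≤ β a b) (hβs : ∀ a b, β a b = β b a)
    {S m η : ℝ} (hS0 : 0 ≤ S) (hm0 : 0 ≤ m) (hη0 : 0 ≤ η) (hS : ∀ a, ∑ b, β a b ≤ S)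
    (hm : ∀ a : Mode D L, ((Finset.univ.filter fun b => modeDist a b ≤ ℓ).card : ℝ) ≤ m)
    {w : ι → ℝ} (hw : ∀ i, 0 ≤ w i) {N : ι → Matrix (Mode D L) (Mode D L) ℝ}
    (hη : ∀ a, ∑ i, w i *
      ∑ a' with modeDist a a' ≤ ℓ, ∑ b' with modeDist a b' ≤ ℓ, N i a' b' ≤ η)
    {χ X : ι → Matrix (Mode D L) (Mode D L) ℝ} (hχ : ∀ i, IsSignMatrix (χ i))
    (hN : ∀ i a b, 1 - χ i a b ≤ N i a b) (hX : ∀ i, IsLocalRotation (X i) r)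
    (hr : r + ℓ ≤ R) :
    FormBound (∑ i, w i • (l.rotation (χ i) * X i * Γ * (l.rotation (χ i) * X i)ᵀ -
      l.rotation noSigns * X i * Γ * (l.rotation noSigns * X i)ᵀ)) (2 * η * m * S) := by
  set H : ι → Mode D L → ℝ := fun i a =>
    ∑ a' with modeDist a a' ≤ ℓ, ∑ b' with modeDist a b' ≤ ℓ, N i a' b' with hH
  set T : Matrix (Mode D L) (Mode D L) ℝ := Matrix.of fun a b =>
    (∑ c with modeDist a c ≤ ℓ, β c b) + ∑ c with modeDist b c ≤ ℓ, β a c with hT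
  have hβ0 : ∀ a b, 0 ≤ β a b := fun a b =>
    (abs_nonneg _).trans (hβ 1 1 (isLocalRotation_one R) (isLocalRotation_one R) a b)
  -- the difference of the conjugations, with one factor replaced at a time
  have hsplit : ∀ i, l.rotation (χ i) * X i * Γ * (l.rotation (χ i) * X i)ᵀ -
      l.rotation noSigns * X i * Γ * (l.rotation noSigns * X i)ᵀ =
      (l.rotation (χ i) - l.rotation noSigns) * (X i * Γ * (l.rotation (χ i) * X i)ᵀ) +
        (l.rotation noSigns * X i * Γ * (X i)ᵀ) *
          (l.rotation (χ i) - l.rotation noSigns)ᵀ := by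
    intro i
    simp only [Matrix.transpose_mul, Matrix.transpose_sub, Matrix.sub_mul, Matrix.mul_sub,
      Matrix.mul_assoc]
    abel
  have hlocal : ∀ i, IsLocalRotation (l.rotation (χ i) * X i) R := fun i =>
    ((l.isLocalRotation (hχ i)).mul (hX i)).mono (by omega)
  have hlocal' : ∀ i, IsLocalRotation (l.rotation noSigns * X i) R := fun i =>
    ((l.isLocalRotation isSignMatrix_noSigns).mul (hX i)).mono (by omega)
  have hXR : ∀ i, IsLocalRotation (X i) R := fun i => (hX i).mono (by omega)
  have hdiff : ∀ i a c, |(l.rotation (χ i) - l.rotation noSigns) a c| ≤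
      if modeDist a c ≤ ℓ then H i a else 0 := fun i a c =>
    l.abs_rotation_sub_le (hχ i) (hN i) a c
  have hentry : ∀ i a b, |(l.rotation (χ i) * X i * Γ * (l.rotation (χ i) * X i)ᵀ -
      l.rotation noSigns * X i * Γ * (l.rotation noSigns * X i)ᵀ) a b| ≤
      H i a * (∑ c with modeDist a c ≤ ℓ, β c b) +
        H i b * ∑ c with modeDist b c ≤ ℓ, β a c := by
    intro i a b
    rw [hsplit, Matrix.add_apply]
    refine (abs_add_le _ _).trans (add_le_add ?_ ?_)
    · rw [Matrix.mul_apply, Finset.mul_sum, Finset.sum_filter]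
      refine (Finset.abs_sum_le_sum_abs _ _).trans (Finset.sum_le_sum fun c _ => ?_)
      rw [abs_mul]
      have h1 := hdiff i a c
      have h2 := hβ _ _ (hXR i) (hlocal i) c b
      split_ifs at h1 ⊢ with hc
      · exact mul_le_mul h1 h2 (abs_nonneg _) ((abs_nonneg _).trans h1)
      · rw [le_antisymm h1 (abs_nonneg _), zero_mul]
    · rw [Matrix.mul_apply, Finset.mul_sum, Finset.sum_filter]
      refine (Finset.abs_sum_le_sum_abs _ _).trans (Finset.sum_le_sum fun c _ => ?_)
      rw [abs_mul, Matrix.transpose_apply, mul_comm]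
      have h1 := hdiff i b c
      have h2 := hβ _ _ (hlocal' i) (hXR i) a c
      split_ifs at h1 ⊢ with hc
      · exact mul_le_mul h1 h2 (abs_nonneg _) ((abs_nonneg _).trans h1)
      · rw [le_antisymm h1 (abs_nonneg _), zero_mul]
  have hTsymm : ∀ a b, (η • T) a b = (η • T) b a := by
    intro a b
    rw [Matrix.smul_apply, Matrix.smul_apply, hT, Matrix.of_apply, Matrix.of_apply, add_comm]
    simp only [hβs _ b, hβs _ a]
  have hrow : ∀ a, ∑ b, (η • T) a b ≤ 2 * η * m * S := by
    intro a
    have h1 : ∑ b, ∑ c with modeDist a c ≤ ℓ, β c b ≤ m * S := by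
      rw [Finset.sum_comm]
      refine (Finset.sum_le_card_nsmul _ _ S fun c _ => hS c).trans ?_
      rw [nsmul_eq_mul]
      exact mul_le_mul_of_nonneg_right (hm a) hS0
    have h2 : ∑ b, ∑ c with modeDist b c ≤ ℓ, β a c ≤ m * S := by
      simp only [Finset.sum_filter]
      rw [Finset.sum_comm]
      calc ∑ c, ∑ b, (if modeDist b c ≤ ℓ then β a c else 0)
          = ∑ c, ((Finset.univ.filter fun b => modeDist c b ≤ ℓ).card : ℝ) * β a c := by
            refine Finset.sum_congr rfl fun c _ => ?_
            rw [← Finset.sum_filter, Finset.sum_const, nsmul_eq_mul]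
            simp only [modeDist_comm c]
        _ ≤ ∑ c, m * β a c :=
            Finset.sum_le_sum fun c _ => mul_le_mul_of_nonneg_right (hm c) (hβ0 a c)
        _ = m * ∑ c, β a c := by rw [Finset.mul_sum]
        _ ≤ m * S := mul_le_mul_of_nonneg_left (hS a) hm0
    simp only [Matrix.smul_apply, smul_eq_mul, ← Finset.mul_sum]
    calc η * ∑ b, T a b ≤ η * (m * S + m * S) := by
          refine mul_le_mul_of_nonneg_left ?_ hη0
          simp only [hT, Matrix.of_apply, Finset.sum_add_distrib]
          exact add_le_add h1 h2
      _ = 2 * η * m * S := by ring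
  refine formBound_of_symm_bound (by positivity) (fun a b => ?_) hTsymm hrow
  refine (abs_sum_smul_apply_le w hw _ a b).trans ?_
  have hsum0 : ∀ a b, 0 ≤ ∑ c with modeDist a c ≤ ℓ, β c b := fun a b =>
    Finset.sum_nonneg fun _ _ => hβ0 _ _
  have hsum0' : ∀ a b, 0 ≤ ∑ c with modeDist b c ≤ ℓ, β a c := fun a b =>
    Finset.sum_nonneg fun _ _ => hβ0 _ _
  calc _ ≤ ∑ i, w i * (H i a * (∑ c with modeDist a c ≤ ℓ, β c b) +
        H i b * ∑ c with modeDist b c ≤ ℓ, β a c) :=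
        Finset.sum_le_sum fun i _ => mul_le_mul_of_nonneg_left (hentry i a b) (hw i)
    _ = (∑ i, w i * H i a) * (∑ c with modeDist a c ≤ ℓ, β c b) +
        (∑ i, w i * H i b) * ∑ c with modeDist b c ≤ ℓ, β a c := by
        rw [Finset.sum_mul, Finset.sum_mul, ← Finset.sum_add_distrib]
        exact Finset.sum_congr rfl fun i _ => by ring
    _ ≤ η * (∑ c with modeDist a c ≤ ℓ, β c b) + η * ∑ c with modeDist b c ≤ ℓ, β a c :=
        add_le_add (mul_le_mul_of_nonneg_right (hη a) (hsum0 a b))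
          (mul_le_mul_of_nonneg_right (hη b) (hsum0' a b))
    _ = (η • T) a b := by
        rw [Matrix.smul_apply, hT, Matrix.of_apply, smul_eq_mul, mul_add]

/-- Replacing the layers of the trajectories by ideal layers one after the other, from the last
layer that is still noisy: what follows the replaced layer is ideal, hence one and the same
orthogonal matrix for all trajectories. -/
theorem LocalEncoding.abs_average_trajectory_sub_ideal_le (E : LocalEncoding D L n φ₀)
    {Γ : Matrix (Mode D L) (Mode D L) ℝ} {R : ℕ} {β : Matrix (Mode D L) (Mode D L) ℝ}
    (hβ : ∀ X Y : Matrix (Mode D L) (Mode D L) ℝ, IsLocalRotation X R →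
      IsLocalRotation Y R → ∀ a b,
      |(X * Γ * Yᵀ) a b| ≤ β a b) (hβs : ∀ a b, β a b = β b a)
    {S m η : ℝ} (hS0 : 0 ≤ S) (hm0 : 0 ≤ m) (hη0 : 0 ≤ η) (hS : ∀ a, ∑ b, β a b ≤ S)
    (hm : ∀ a : Mode D L, ((Finset.univ.filter fun b => modeDist a b ≤ ℓ).card : ℝ) ≤ m)
    {w : ι → ℝ} (hw : ∀ i, 0 ≤ w i) {N : ι → Matrix (Mode D L) (Mode D L) ℝ}
    (hη : ∀ a, ∑ i, w i *
      ∑ a' with modeDist a a' ≤ ℓ, ∑ b' with modeDist a b' ≤ ℓ, N i a' b' ≤ η)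
    (O : Matrix (Mode D L) (Mode D L) ℝ) (c : List (GaussianLayer D L ℓ))
    {χ X : ι → Matrix (Mode D L) (Mode D L) ℝ} {τ : ι → List (Fin n → Fin 4)}
    (hτ : ∀ i, (τ i).length = c.length) (hχ : ∀ i, IsSignMatrix (χ i))
    (hN : ∀ i a b, 1 - χ i a b + ((τ i).map fun s => 1 - E.errorSign s a b).sum ≤ N i a b)
    {r : ℕ} (hX : ∀ i, IsLocalRotation (X i) r) (hr : r + c.length * ℓ ≤ R) :
    |∑ i, w i * (pairing O (E.trajectoryRotation (χ i) c (τ i) * X i * Γ *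
        (E.trajectoryRotation (χ i) c (τ i) * X i)ᵀ) -
      pairing O (idealRotation c * X i * Γ * (idealRotation c * X i)ᵀ))| ≤
      c.length * (traceNorm O * (2 * η * m * S)) := by
  induction c generalizing χ X τ r with
  | nil =>
    simp [LocalEncoding.trajectoryRotation, idealRotation]
  | cons l c ih =>
    have hcons : ∀ i, ∃ s τ', τ i = s :: τ' := fun i =>
      List.exists_cons_of_ne_nil (List.ne_nil_of_length_eq_add_one (hτ i))
    choose s τ' hτ' using hcons
    have hsign0 : ∀ (s : Fin n → Fin 4) a b, 0 ≤ 1 - E.errorSign s a b := fun s a b => by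
      rcases (E.isSignMatrix_errorSign s).eq_or a b with h | h <;> rw [h] <;> norm_num
    have hlist0 : ∀ (τ : List (Fin n → Fin 4)) a b,
        0 ≤ (τ.map fun s => 1 - E.errorSign s a b).sum := fun τ a b =>
      List.sum_nonneg fun x hx => by
        obtain ⟨s, _, rfl⟩ := List.mem_map.mp hx
        exact hsign0 s a b
    rw [List.length_cons, add_mul, one_mul] at hr
    have h1 := ih (χ := fun i => E.errorSign (s i) ⊙ χ i)
      (X := fun i => l.rotation (χ i) * X i) (τ := τ')
      (fun i => by
        have := hτ i
        rw [hτ', List.length_cons, List.length_cons] at this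
        omega)
      (fun i => (E.isSignMatrix_errorSign (s i)).hadamard (hχ i))
      (fun i a b => by
        refine le_trans ?_ (hN i a b)
        rw [hτ', List.map_cons, List.sum_cons, Matrix.hadamard_apply, ← add_assoc]
        refine add_le_add ?_ le_rfl
        rcases (E.isSignMatrix_errorSign (s i)).eq_or a b with h | h <;>
          rcases (hχ i).eq_or a b with h' | h' <;> rw [h, h'] <;> norm_num)
      (r := ℓ + r) (fun i => (l.isLocalRotation (hχ i)).mul (hX i)) (by omega)
    have h2 := l.formBound_average hβ hβs hS0 hm0 hη0 hS hm hw hη hχ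
      (fun i a b => le_trans (le_add_of_nonneg_right (hlist0 _ a b)) (hN i a b)) hX (by omega)
    have h3 := abs_pairing_le O
      (h2.conj_orthogonal (isLocalRotation_idealRotation c).orthogonal)
    have hconj : idealRotation c * (∑ i, w i • (l.rotation (χ i) * X i * Γ *
          (l.rotation (χ i) * X i)ᵀ - l.rotation noSigns * X i * Γ *
          (l.rotation noSigns * X i)ᵀ)) * (idealRotation c)ᵀ =
        ∑ i, w i • (idealRotation c * (l.rotation (χ i) * X i) * Γ *
          (idealRotation c * (l.rotation (χ i) * X i))ᵀ -
          idealRotation c * l.rotation noSigns * X i * Γ *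
          (idealRotation c * l.rotation noSigns * X i)ᵀ) := by
      rw [Matrix.mul_sum, Matrix.sum_mul]
      refine Finset.sum_congr rfl fun i _ => ?_
      simp only [Matrix.mul_smul, Matrix.smul_mul, Matrix.mul_sub, Matrix.sub_mul,
        Matrix.transpose_mul, Matrix.mul_assoc]
    rw [hconj, ← pairing_sum_smul_sub] at h3
    have hsum : ∑ i, w i * (pairing O (E.trajectoryRotation (χ i) (l :: c) (τ i) * X i * Γ *
          (E.trajectoryRotation (χ i) (l :: c) (τ i) * X i)ᵀ) -
        pairing O (idealRotation (l :: c) * X i * Γ * (idealRotation (l :: c) * X i)ᵀ)) =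
        ∑ i, w i * (pairing O (E.trajectoryRotation (E.errorSign (s i) ⊙ χ i) c (τ' i) *
            (l.rotation (χ i) * X i) * Γ *
            (E.trajectoryRotation (E.errorSign (s i) ⊙ χ i) c (τ' i) *
              (l.rotation (χ i) * X i))ᵀ) -
          pairing O (idealRotation c * (l.rotation (χ i) * X i) * Γ *
            (idealRotation c * (l.rotation (χ i) * X i))ᵀ)) +
        ∑ i, w i * (pairing O (idealRotation c * (l.rotation (χ i) * X i) * Γ *
            (idealRotation c * (l.rotation (χ i) * X i))ᵀ) -
          pairing O (idealRotation c * l.rotation noSigns * X i * Γ *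
            (idealRotation c * l.rotation noSigns * X i)ᵀ)) := by
      rw [← Finset.sum_add_distrib]
      refine Finset.sum_congr rfl fun i _ => ?_
      rw [hτ', LocalEncoding.trajectoryRotation, idealRotation,
        Matrix.mul_assoc (E.trajectoryRotation _ c (τ' i)) (l.rotation (χ i))]
      ring
    rw [hsum, List.length_cons]
    refine (abs_add_le _ _).trans ((add_le_add h1 h3).trans (le_of_eq ?_))
    push_cast
    ring

end Telescope

/-! ### The error bound -/

section ErrorBound

variable {D L n φ₀ ℓ : ℕ}

/-- A weighted sum of the correlation bound splits into the light cone, where only its volume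
counts, and the lattice sum of the power law. -/
theorem sum_mul_corrBound_le (K μ : ℝ) (R : ℕ) {v : ℕ → ℝ} (hv : ∀ r, 0 ≤ v r)
    (a : Mode D L) :
    ∑ b, v (modeDist a b) * corrBound D K μ R (modeDist a b) ≤
      ∑ b with modeDist a b ≤ 4 * R, v (modeDist a b) +
        2 * (2 * (R : ℝ) + 1) ^ D * (|K| * 2 ^ μ) *
          ∑ b with 1 ≤ modeDist a b, v (modeDist a b) / (modeDist a b : ℝ) ^ μ := by
  rw [Finset.mul_sum, Finset.sum_filter, Finset.sum_filter, ← Finset.sum_add_distrib]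
  refine Finset.sum_le_sum fun b _ => ?_
  have hv' := hv (modeDist a b)
  rw [corrBound]
  by_cases h : modeDist a b ≤ 4 * R
  · rw [if_pos h, if_pos h, mul_one]
    refine le_add_of_nonneg_right ?_
    split_ifs <;> positivity
  · rw [if_neg h, if_neg h, if_pos (by omega), zero_add]
    refine le_of_eq ?_
    ring

theorem LocalEncoding.isSignMatrix_trajectorySign (E : LocalEncoding D L n φ₀)
    {χ : Matrix (Mode D L) (Mode D L) ℝ} (hχ : IsSignMatrix χ) (τ : List (Fin n → Fin 4)) :
    IsSignMatrix (E.trajectorySign χ τ) := by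
  induction τ generalizing χ with
  | nil => exact hχ
  | cons s τ ih => exact ih ((E.isSignMatrix_errorSign s).hadamard hχ)

theorem LocalEncoding.one_sub_trajectorySign_le (E : LocalEncoding D L n φ₀)
    {χ : Matrix (Mode D L) (Mode D L) ℝ} (hχ : IsSignMatrix χ) (τ : List (Fin n → Fin 4))
    (a b : Mode D L) : 1 - E.trajectorySign χ τ a b ≤
      1 - χ a b + (τ.map fun s => 1 - E.errorSign s a b).sum := by
  induction τ generalizing χ with
  | nil => simp [LocalEncoding.trajectorySign]
  | cons s τ ih =>
    refine (ih ((E.isSignMatrix_errorSign s).hadamard hχ)).trans ?_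
    rw [List.map_cons, List.sum_cons, Matrix.hadamard_apply, ← add_assoc]
    refine add_le_add ?_ le_rfl
    rcases (E.isSignMatrix_errorSign s).eq_or a b with h | h <;>
      rcases hχ.eq_or a b with h' | h' <;> rw [h, h'] <;> norm_num

/-- The expected number of sign flips of a bilinear is at most proportional to the depth, the
error rate and the weight of its Pauli string. -/
theorem LocalEncoding.average_flips_le (E : LocalEncoding D L n φ₀) {α : Fin 3 → ℝ} {p : ℝ}
    (hα : ∀ j, 0 ≤ α j) (hα1 : ∑ j, α j = 1) (h0 : 0 ≤ p) (h1 : p ≤ 2 / 3) (d : ℕ)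
    (a b : Mode D L) :
    ∑ ω : Fin d → Fin n → Fin 4, (∏ i, errorProb α p (ω i)) *
      ((List.ofFn ω).map fun s => 1 - E.errorSign s a b).sum ≤
      3 / 2 * d * p * (φ₀ + modeDist a b) := by
  have hlist : ∀ ω : Fin d → Fin n → Fin 4,
      ((List.ofFn ω).map fun s => 1 - E.errorSign s a b).sum =
        ∑ i, (1 - E.errorSign (ω i) a b) := fun ω => by
    rw [List.map_ofFn, List.sum_ofFn]
    rfl
  simp only [hlist, Finset.mul_sum]
  rw [Finset.sum_comm]
  have hone : ∀ i : Fin d, ∑ ω : Fin d → Fin n → Fin 4, (∏ i, errorProb α p (ω i)) *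
      (1 - E.errorSign (ω i) a b) ≤ 3 / 2 * p * (φ₀ + modeDist a b) := by
    intro i
    rw [sum_prod_mul_apply (fun _ => sum_errorProb hα1) i fun s => 1 - E.errorSign s a b]
    refine (sum_errorProb_one_sub_pauliSign_le hα hα1 h0 h1 (E.string a b)).trans ?_
    have : (pauliWeight (E.string a b) : ℝ) ≤ φ₀ + modeDist a b := by
      exact_mod_cast E.weight_le a b
    gcongr
  refine (Finset.sum_le_card_nsmul _ _ _ fun i _ => hone i).trans (le_of_eq ?_)
  rw [Finset.card_univ, Fintype.card_fin, nsmul_eq_mul]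
  ring

theorem pairing_hadamard {κ : Type*} [Fintype κ] (χ A M : Matrix κ κ ℝ) :
    pairing (χ ⊙ A) M = pairing A (χ ⊙ M) := by
  simp only [pairing, Matrix.hadamard_apply]
  exact Finset.sum_congr rfl fun a _ => Finset.sum_congr rfl fun b _ => by ring

namespace SimulationTask

variable {K μ : ℝ} (S : SimulationTask D φ₀ ℓ K μ)

/-- The error is an average over trajectories, with the signs of the measured bilinears moved from
the observable to the covariance matrix. -/
theorem error_eq (p : ℝ) :
    S.error p = |∑ ω : Fin S.depth → Fin S.n → Fin 4, (∏ i, errorProb S.α p (ω i)) *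
      (pairing S.O (S.encoding.trajectorySign noSigns (List.ofFn ω) ⊙
        (S.encoding.trajectoryRotation noSigns S.circuit (List.ofFn ω) * covariance S.ρ₀ *
          (S.encoding.trajectoryRotation noSigns S.circuit (List.ofFn ω))ᵀ)) -
      pairing S.O (idealRotation S.circuit * covariance S.ρ₀ * (idealRotation S.circuit)ᵀ))| := by
  have hρ := S.ρ₀_posSemidef.isHermitian
  have h1 := trace_idealEvolution S.circuit hρ S.ρ₀_encoded S.O_antisymm
  have h2 := (twists_one S.encoding).trace_noisyEvolution S.α p S.circuit isSignMatrix_noSigns hρ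
    S.ρ₀_encoded S.O_antisymm
  rw [Matrix.one_mul] at h2
  rw [error, noiseless, noisy, qubitState, h1, h2, ← Complex.ofReal_sub, Complex.norm_real,
    Real.norm_eq_abs, abs_sub_comm]
  simp only [pairing_hadamard, mul_sub, Finset.sum_sub_distrib]
  rw [← Finset.sum_mul, sum_prod_eq_one fun _ => sum_errorProb S.α_sum, one_mul]
  rfl

theorem error_eq_zero_of_depth (h : S.depth = 0) (p : ℝ) : S.error p = 0 := by
  have hc : S.circuit = [] := List.length_eq_zero_iff.mp h
  rw [error, noiseless, noisy, hc]
  simp [idealEvolution, noisyEvolution]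

theorem abs_covariance_le (a b : Mode D S.L) (h : a.1 ≠ b.1) :
    |covariance S.ρ₀ a b| ≤ K / (modeDist a b : ℝ) ^ μ :=
  (Complex.abs_re_le_norm _).trans (S.decay a b h)

/-- The error is at most the effect `B₁` of the errors on the measured bilinears plus the effect of
the errors on the `S.depth` layers. Here `s` bounds the expected number of flips of a bilinear
within one gate, `m` the number of modes within reach of a gate, and `B` the row sums of the
correlations. -/
theorem error_le_add (hμ : 0 < μ) {p : ℝ} (h0 : 0 ≤ p) (h1 : p ≤ 2 / 3) {B₁ B m s : ℝ}
    (hB₁0 : 0 ≤ B₁) (hB0 : 0 ≤ B) (hm0 : 0 ≤ m)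
    (hB₁ : ∀ a : Mode D S.L, ∑ b, min 2 (3 / 2 * S.depth * p * (φ₀ + modeDist a b)) *
      corrBound D K μ (S.depth * ℓ) (modeDist a b) ≤ B₁)
    (hB : ∀ a : Mode D S.L, ∑ b, corrBound D K μ (S.depth * ℓ) (modeDist a b) ≤ B)
    (hm : ∀ a : Mode D S.L, ((Finset.univ.filter fun b => modeDist a b ≤ ℓ).card : ℝ) ≤ m)
    (hs : s = 3 / 2 * S.depth * p * (φ₀ + 2 * ℓ)) :
    S.error p ≤ B₁ + S.depth * (2 * (m * (m * s)) * m * B) := by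
  set d := S.depth with hd
  set E := S.encoding
  set R := d * ℓ with hR
  set Γ := covariance S.ρ₀ with hΓ
  set w : (Fin d → Fin S.n → Fin 4) → ℝ := fun ω => ∏ i, errorProb S.α p (ω i) with hw
  set T : (Fin d → Fin S.n → Fin 4) → Matrix (Mode D S.L) (Mode D S.L) ℝ := fun ω =>
    E.trajectoryRotation noSigns S.circuit (List.ofFn ω) with hT
  set χ : (Fin d → Fin S.n → Fin 4) → Matrix (Mode D S.L) (Mode D S.L) ℝ := fun ω =>
    E.trajectorySign noSigns (List.ofFn ω) with hχ
  set N : (Fin d → Fin S.n → Fin 4) → Matrix (Mode D S.L) (Mode D S.L) ℝ := fun ω =>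
    Matrix.of fun a b => ((List.ofFn ω).map fun s => 1 - E.errorSign s a b).sum with hN
  have hw0 : ∀ ω, 0 ≤ w ω := fun ω =>
    Finset.prod_nonneg fun i _ => errorProb_nonneg S.α_nonneg h0 h1 _
  have hw1 : ∑ ω, w ω = 1 := sum_prod_eq_one fun _ => sum_errorProb S.α_sum
  have hflips : ∀ a b, ∑ ω, w ω * N ω a b ≤ 3 / 2 * d * p * (φ₀ + modeDist a b) :=
    fun a b => E.average_flips_le S.α_nonneg S.α_sum h0 h1 d a b
  have hχs : ∀ ω, IsSignMatrix (χ ω) := fun ω =>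
    E.isSignMatrix_trajectorySign isSignMatrix_noSigns _
  have hχN : ∀ ω a b, 1 - χ ω a b ≤ N ω a b := fun ω a b => by
    refine (E.one_sub_trajectorySign_le isSignMatrix_noSigns (List.ofFn ω) a b).trans ?_
    simp [noSigns, hN]
  have hcorr : ∀ X Y : Matrix (Mode D S.L) (Mode D S.L) ℝ, IsLocalRotation X R →
      IsLocalRotation Y R → ∀ a b, |(X * Γ * Yᵀ) a b| ≤ corrBound D K μ R (modeDist a b) :=
    fun X Y hX hY a b => abs_mul_mul_transpose_le_corrBound hμ
      (formBound_covariance S.ρ₀_posSemidef S.ρ₀_trace) S.abs_covariance_le hX hY a b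
  have hTloc : ∀ ω, IsLocalRotation (T ω) R := fun ω =>
    E.isLocalRotation_trajectoryRotation S.circuit isSignMatrix_noSigns _
  have hs0 : 0 ≤ s := by rw [hs]; positivity
  -- signs of the measured bilinears
  have hmeas : |∑ ω, w ω * (pairing S.O (χ ω ⊙ (T ω * Γ * (T ω)ᵀ)) -
      pairing S.O (T ω * Γ * (T ω)ᵀ))| ≤ B₁ := by
    rw [pairing_sum_smul_sub]
    have hform : FormBound (∑ ω, w ω • (χ ω ⊙ (T ω * Γ * (T ω)ᵀ) - T ω * Γ * (T ω)ᵀ)) B₁ := by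
      refine formBound_of_symm_bound (T := Matrix.of fun a b =>
        min 2 (3 / 2 * (d : ℝ) * p * (φ₀ + modeDist a b)) * corrBound D K μ R (modeDist a b))
        hB₁0 (fun a b => ?_) (fun a b => ?_) hB₁
      · refine (abs_sum_smul_apply_le w hw0 _ a b).trans ?_
        have hterm : ∀ ω, w ω * |(χ ω ⊙ (T ω * Γ * (T ω)ᵀ) - T ω * Γ * (T ω)ᵀ) a b| ≤
            w ω * (1 - χ ω a b) * corrBound D K μ R (modeDist a b) := by
          intro ω
          have h := hcorr _ _ (hTloc ω) (hTloc ω) a b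
          have h' : 0 ≤ 1 - χ ω a b := by
            rcases (hχs ω).eq_or a b with h | h <;> rw [h] <;> norm_num
          have heq : (χ ω ⊙ (T ω * Γ * (T ω)ᵀ) - T ω * Γ * (T ω)ᵀ) a b =
              -((1 - χ ω a b) * (T ω * Γ * (T ω)ᵀ) a b) := by
            rw [Matrix.sub_apply, Matrix.hadamard_apply]
            ring
          rw [heq, abs_neg, abs_mul, abs_of_nonneg h', mul_assoc (w ω)]
          exact mul_le_mul_of_nonneg_left (mul_le_mul_of_nonneg_left h h') (hw0 ω)
        refine (Finset.sum_le_sum fun ω _ => hterm ω).trans ?_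
        rw [← Finset.sum_mul, Matrix.of_apply]
        refine mul_le_mul_of_nonneg_right (le_min ?_ ?_) (corrBound_nonneg _ _ _ _ _)
        · calc ∑ ω, w ω * (1 - χ ω a b) ≤ ∑ ω, w ω * 2 := by
                refine Finset.sum_le_sum fun ω _ => mul_le_mul_of_nonneg_left ?_ (hw0 ω)
                rcases (hχs ω).eq_or a b with h | h <;> rw [h] <;> norm_num
            _ = 2 := by rw [← Finset.sum_mul, hw1, one_mul]
        · exact (Finset.sum_le_sum fun ω _ =>
            mul_le_mul_of_nonneg_left (hχN ω a b) (hw0 ω)).trans (hflips a b)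
      · rw [Matrix.of_apply, Matrix.of_apply, modeDist_comm]
    refine (abs_pairing_le S.O hform).trans ?_
    exact mul_le_of_le_one_left hB₁0 S.O_normalized
  -- signs of the couplings
  have hη : ∀ a, ∑ ω, w ω * ∑ a' with modeDist a a' ≤ ℓ, ∑ b' with modeDist a b' ≤ ℓ,
      N ω a' b' ≤ m * (m * s) := by
    intro a
    have hswap : ∑ ω, w ω * ∑ a' with modeDist a a' ≤ ℓ, ∑ b' with modeDist a b' ≤ ℓ,
        N ω a' b' = ∑ a' with modeDist a a' ≤ ℓ, ∑ b' with modeDist a b' ≤ ℓ,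
          ∑ ω, w ω * N ω a' b' := by
      simp only [Finset.mul_sum]
      rw [Finset.sum_comm]
      exact Finset.sum_congr rfl fun a' _ => Finset.sum_comm
    have hbound : ∀ a' ∈ Finset.univ.filter fun a' => modeDist a a' ≤ ℓ,
        ∀ b' ∈ Finset.univ.filter fun b' => modeDist a b' ≤ ℓ, ∑ ω, w ω * N ω a' b' ≤ s := by
      intro a' ha' b' hb'
      have ha := (Finset.mem_filter.mp ha').2
      have hb := (Finset.mem_filter.mp hb').2
      refine (hflips a' b').trans ?_
      have hdist : modeDist a' b' ≤ 2 * ℓ := by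
        have := modeDist_triangle a' a b'
        rw [modeDist_comm a' a] at this
        omega
      have hdist' : (modeDist a' b' : ℝ) ≤ 2 * ℓ := by exact_mod_cast hdist
      rw [hs]
      gcongr
    rw [hswap]
    have hinner : ∀ a' ∈ Finset.univ.filter fun a' => modeDist a a' ≤ ℓ,
        ∑ b' with modeDist a b' ≤ ℓ, ∑ ω, w ω * N ω a' b' ≤ m * s := fun a' ha' => by
      refine (Finset.sum_le_card_nsmul _ _ s (hbound a' ha')).trans ?_
      rw [nsmul_eq_mul]
      exact mul_le_mul_of_nonneg_right (hm a) hs0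
    refine (Finset.sum_le_card_nsmul _ _ (m * s) hinner).trans ?_
    rw [nsmul_eq_mul]
    exact mul_le_mul_of_nonneg_right (hm a) (by positivity)
  have hcirc := E.abs_average_trajectory_sub_ideal_le (ℓ := ℓ) (R := R) hcorr
    (β := Matrix.of fun a b => corrBound D K μ R (modeDist a b))
    (fun a b => by rw [Matrix.of_apply, Matrix.of_apply, modeDist_comm]) hB0 hm0
    (by positivity : 0 ≤ m * (m * s)) hB hm hw0 hη S.O S.circuit
    (χ := fun _ => noSigns) (X := fun _ => 1) (τ := fun ω => List.ofFn ω)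
    (fun ω => List.length_ofFn) (fun _ => isSignMatrix_noSigns)
    (fun ω a b => by simp [noSigns, hN]) (r := 0) (fun _ => isLocalRotation_one 0)
    (by rw [zero_add]; exact le_rfl)
  simp only [Matrix.mul_one] at hcirc
  have hcirc' : |∑ ω, w ω * (pairing S.O (T ω * Γ * (T ω)ᵀ) -
      pairing S.O (idealRotation S.circuit * Γ * (idealRotation S.circuit)ᵀ))| ≤
      d * (2 * (m * (m * s)) * m * B) := by
    refine hcirc.trans ?_
    refine mul_le_mul_of_nonneg_left ?_ (Nat.cast_nonneg _)
    exact mul_le_of_le_one_left (by positivity) S.O_normalized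
  have hsplit : ∑ ω, w ω * (pairing S.O (χ ω ⊙ (T ω * Γ * (T ω)ᵀ)) -
      pairing S.O (idealRotation S.circuit * Γ * (idealRotation S.circuit)ᵀ)) =
      ∑ ω, w ω * (pairing S.O (χ ω ⊙ (T ω * Γ * (T ω)ᵀ)) - pairing S.O (T ω * Γ * (T ω)ᵀ)) +
      ∑ ω, w ω * (pairing S.O (T ω * Γ * (T ω)ᵀ) -
        pairing S.O (idealRotation S.circuit * Γ * (idealRotation S.circuit)ᵀ)) := by
    rw [← Finset.sum_add_distrib]
    exact Finset.sum_congr rfl fun ω _ => by ring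
  rw [S.error_eq p]
  refine (le_of_eq (congrArg abs hsplit)).trans ((abs_add_le _ _).trans (add_le_add hmeas hcirc'))

end SimulationTask

/-- The bound with constant uniform in all systems. Each light-cone volume costs `d ^ D`, the
expected number of errors per qubit is of order `p d`, and one more power of `d` comes from the
length of the strings in the light cone or from the number of layers. -/
theorem exists_error_le (D φ₀ ℓ : ℕ) (K μ : ℝ) (hμ : (D : ℝ) < μ) :
    ∃ C : ℝ, 0 < C ∧ ∀ (S : SimulationTask D φ₀ ℓ K μ) (p : ℝ), 0 ≤ p → p ≤ 2 / 3 →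
      S.error p ≤ C * rate D μ p * (S.depth : ℝ) ^ (D + 2) := by
  obtain ⟨C₁, hC₁, hsum⟩ := exists_sum_min_div_rpow_le D hμ
  obtain ⟨C₂, hC₂, hsum'⟩ := exists_sum_one_div_rpow_le D hμ
  obtain ⟨C₃, hC₃, hrate⟩ := exists_le_mul_rate D hμ
  have hμ0 : 0 < μ := (Nat.cast_nonneg D).trans_lt hμ
  set A : ℝ := |K| * 2 ^ μ with hA
  have hA0 : 0 ≤ A := by positivity
  set m : ℝ := 2 * (2 * (ℓ : ℝ) + 1) ^ D with hm
  have hm0 : 0 ≤ m := by positivity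
  -- `c₁`: measured bilinears inside the light cone; `c₂`: those outside; `s₀ * d ^ D`: row sums of
  -- the correlations; `c₃`: errors that act on the layers
  set c₁ : ℝ := 3 * (8 * (ℓ : ℝ) + 1) ^ D * (φ₀ + 4 * ℓ)
  set c₂ : ℝ := 4 * (φ₀ + 1) * (2 * (ℓ : ℝ) + 1) ^ D * A * C₁
  set s₀ : ℝ := 2 * (8 * (ℓ : ℝ) + 1) ^ D + 2 * (2 * (ℓ : ℝ) + 1) ^ D * A * C₂
  set c₃ : ℝ := 3 * m ^ 3 * (φ₀ + 2 * ℓ) * s₀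
  refine ⟨c₁ * C₃ + c₂ + c₃ * C₃ + 1, by positivity, fun S p h0 h1 => ?_⟩
  have hf := rate_nonneg D hμ h0 h1
  rcases Nat.eq_zero_or_pos S.depth with hd | hd
  · rw [S.error_eq_zero_of_depth hd]
    positivity
  set d : ℝ := (S.depth : ℝ)
  have hd1 : (1 : ℝ) ≤ d := Nat.one_le_cast.mpr hd
  have hR : ((S.depth * ℓ : ℕ) : ℝ) = d * ℓ := by push_cast; rfl
  -- volumes of the light cone in terms of the depth
  have hvol : ∀ k : ℝ, 0 ≤ k → (k * (d * ℓ) + 1) ^ D ≤ (k * ℓ + 1) ^ D * d ^ D := by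
    intro k hk
    rw [← mul_pow]
    refine pow_le_pow_left₀ (by positivity) ?_ _
    calc k * (d * ℓ) + 1 ≤ k * (d * ℓ) + d := by linarith
      _ = (k * ℓ + 1) * d := by ring
  have hcone : ∀ a : Mode D S.L,
      ((Finset.univ.filter fun b => modeDist a b ≤ 4 * (S.depth * ℓ)).card : ℝ) ≤
        2 * ((8 * (ℓ : ℝ) + 1) ^ D * d ^ D) := by
    intro a
    refine (card_modeBall_le_real a _).trans ?_
    have : (2 * ((4 * (S.depth * ℓ) : ℕ) : ℝ) + 1) ^ D = (8 * (d * ℓ) + 1) ^ D := by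
      push_cast; ring
    rw [this]
    exact mul_le_mul_of_nonneg_left (hvol 8 (by norm_num)) zero_le_two
  have hamp : 2 * (2 * ((S.depth * ℓ : ℕ) : ℝ) + 1) ^ D * A ≤
      2 * ((2 * (ℓ : ℝ) + 1) ^ D * d ^ D) * A := by
    rw [hR]
    exact mul_le_mul_of_nonneg_right
      (mul_le_mul_of_nonneg_left (hvol 2 (by norm_num)) zero_le_two) hA0
  have hB : ∀ a : Mode D S.L, ∑ b, corrBound D K μ (S.depth * ℓ) (modeDist a b) ≤
      s₀ * d ^ D := by
    intro a
    have h := sum_mul_corrBound_le K μ (S.depth * ℓ) (v := fun _ => 1) (fun _ => zero_le_one) a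
    simp only [one_mul, Finset.sum_const, nsmul_eq_mul, mul_one] at h
    refine h.trans ?_
    calc _ ≤ 2 * ((8 * (ℓ : ℝ) + 1) ^ D * d ^ D) +
          2 * ((2 * (ℓ : ℝ) + 1) ^ D * d ^ D) * A * C₂ := by
          refine add_le_add (hcone a) (mul_le_mul hamp (hsum' _ a) ?_ (by positivity))
          exact Finset.sum_nonneg fun _ _ => by positivity
      _ = s₀ * d ^ D := by ring
  have hB₁ : ∀ a : Mode D S.L, ∑ b, min 2 (3 / 2 * d * p * (φ₀ + modeDist a b)) *
      corrBound D K μ (S.depth * ℓ) (modeDist a b) ≤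
      c₁ * p * d ^ (D + 2) + c₂ * rate D μ p * d ^ (D + 1) := by
    intro a
    have h := sum_mul_corrBound_le K μ (S.depth * ℓ)
      (v := fun r => min 2 (3 / 2 * d * p * (φ₀ + r))) (fun r => by positivity) a
    refine h.trans ?_
    have hnear : ∑ b with modeDist a b ≤ 4 * (S.depth * ℓ),
        min 2 (3 / 2 * d * p * (φ₀ + modeDist a b)) ≤ c₁ * p * d ^ (D + 2) := by
      refine (Finset.sum_le_card_nsmul _ _ (3 / 2 * d * p * ((φ₀ + 4 * ℓ) * d))
        fun b hb => ?_).trans ?_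
      · refine (min_le_right _ _).trans ?_
        have hb' : (modeDist a b : ℝ) ≤ 4 * (d * ℓ) := by
          have := (Finset.mem_filter.mp hb).2
          rw [← hR]
          exact_mod_cast this
        have : (φ₀ : ℝ) + modeDist a b ≤ (φ₀ + 4 * ℓ) * d := by
          have : (φ₀ : ℝ) ≤ φ₀ * d := le_mul_of_one_le_right (Nat.cast_nonneg _) hd1
          linarith
        gcongr
      · rw [nsmul_eq_mul]
        refine (mul_le_mul_of_nonneg_right (hcone a) (by positivity)).trans (le_of_eq ?_)
        rw [pow_add]
        ring
    have hfar : ∑ b with 1 ≤ modeDist a b, min 2 (3 / 2 * d * p * (φ₀ + modeDist a b)) /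
        (modeDist a b : ℝ) ^ μ ≤ 2 * (φ₀ + 1) * d * (C₁ * rate D μ p) := by
      refine le_trans ?_ (mul_le_mul_of_nonneg_left (hsum p h0 h1 S.L a) (by positivity))
      rw [Finset.mul_sum]
      refine Finset.sum_le_sum fun b hb => ?_
      have hb1 : (1 : ℝ) ≤ modeDist a b := by exact_mod_cast (Finset.mem_filter.mp hb).2
      rw [← mul_div_assoc]
      refine div_le_div_of_nonneg_right ?_ (by positivity)
      have hφ : (0 : ℝ) ≤ φ₀ := Nat.cast_nonneg _
      rw [mul_min_of_nonneg _ _ (by positivity)]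
      refine min_le_min ?_ ?_
      · nlinarith
      · have h3 : (φ₀ : ℝ) + modeDist a b ≤ (φ₀ + 1) * modeDist a b := by nlinarith
        calc 3 / 2 * d * p * (φ₀ + modeDist a b) ≤ 2 * d * p * ((φ₀ + 1) * modeDist a b) := by
              gcongr
              norm_num
          _ = _ := by ring
    calc _ ≤ c₁ * p * d ^ (D + 2) + 2 * ((2 * (ℓ : ℝ) + 1) ^ D * d ^ D) * A *
          (2 * (φ₀ + 1) * d * (C₁ * rate D μ p)) := by
          refine add_le_add hnear (mul_le_mul hamp hfar ?_ (by positivity))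
          exact Finset.sum_nonneg fun _ _ => by positivity
      _ = _ := by rw [pow_succ]; ring
  have hmain := S.error_le_add hμ0 h0 h1 (by positivity) (by positivity) hm0 hB₁ hB
    (fun a => card_modeBall_le_real a ℓ) rfl
  refine hmain.trans ?_
  have hp := hrate p h0 h1
  have hpow : d ^ (D + 1) ≤ d ^ (D + 2) := pow_le_pow_right₀ hd1 (by omega)
  calc c₁ * p * d ^ (D + 2) + c₂ * rate D μ p * d ^ (D + 1) +
        d * (2 * (m * (m * (3 / 2 * d * p * (φ₀ + 2 * ℓ)))) * m * (s₀ * d ^ D))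
      = c₁ * p * d ^ (D + 2) + c₂ * rate D μ p * d ^ (D + 1) + c₃ * p * d ^ (D + 2) := by
        rw [pow_add]
        ring
    _ ≤ c₁ * (C₃ * rate D μ p) * d ^ (D + 2) + c₂ * rate D μ p * d ^ (D + 2) +
        c₃ * (C₃ * rate D μ p) * d ^ (D + 2) := by gcongr
    _ ≤ (c₁ * C₃ + c₂ + c₃ * C₃ + 1) * rate D μ p * d ^ (D + 2) := by
        have : 0 ≤ rate D μ p * d ^ (D + 2) := by positivity
        linarith

end ErrorBound

end FermionNoise

theorem mainTheorem3 (D φ₀ ℓ : ℕ) (K μ : ℝ) (hμ : (D : ℝ) < μ) :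
    (∃ C : ℝ, 0 < C ∧
      ∀ (S : FermionNoise.SimulationTask D φ₀ ℓ K μ) (p : ℝ), 0 ≤ p → p ≤ 2 / 3 →
        S.error p ≤ C * FermionNoise.rate D μ p * (S.depth : ℝ) ^ (D + 2)) ∧
    Filter.Tendsto (FermionNoise.rate D μ) (nhdsWithin 0 (Set.Ioi 0)) (nhds 0) ∧
    ∀ d₀ : ℕ, FermionNoise.Stable
      (fun S : {S : FermionNoise.SimulationTask D φ₀ ℓ K μ // S.depth ≤ d₀} => S.1.error) := by
  have hbound := FermionNoise.exists_error_le D φ₀ ℓ K μ hμ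
  refine ⟨hbound, FermionNoise.tendsto_rate D hμ, fun d₀ => ?_⟩
  obtain ⟨C, hC, h⟩ := hbound
  refine ⟨fun p => C * FermionNoise.rate D μ p * (d₀ : ℝ) ^ (D + 2), ?_, ?_, ?_⟩
  · exact ((continuous_const.mul (FermionNoise.continuous_rate D hμ)).mul
      continuous_const).continuousOn
  · have := ((FermionNoise.tendsto_rate D hμ).const_mul C).mul_const ((d₀ : ℝ) ^ (D + 2))
    rwa [mul_zero, zero_mul] at this
  · rintro ⟨S, hS⟩ p ⟨h0, h1⟩
    refine (h S p h0 h1).trans ?_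
    have hf := FermionNoise.rate_nonneg D hμ h0 h1
    have hS' : (S.depth : ℝ) ≤ d₀ := by exact_mod_cast hS
    dsimp only
    gcongr
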